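/- An instance consists of $n \ge 1$ agents with weights $\eta_1,\dots,\eta_n \in \mathbb{R}_{>0}$ and $m$ indivisible goods, where all agents have the same additive valuation $v : 2^{[m]} \to \mathbb{R}_{\ge 0}$, so $v(S) = \sum_{j \in S} v(\{j\})$ and $v(\emptyset)=0$. An allocation is a partition $\mathbf{x} = (\mathbf{x}_1,\dots,\mathbf{x}_n)$ of $[m]$ into (possibly empty) bundles; its Nash welfare is $\mathrm{NW}(\mathbf{x}) = \bigl(\prod_{i} v(\mathbf{x}_i)^{\eta_i}\bigr)^{1/\sum_i \eta_i}$. It is $\varepsilon$-approximately Nash optimal if $\mathrm{NW}(\mathbf{x}) \ge (1-\varepsilon)\,\mathrm{NW}(\mathbf{x}^*)$, where $\mathbf{x}^*$ maximizes $\mathrm{NW}$. It is weakly weighted envy-free up to one good (wwEF1) if for all agents $i,h$ there is a good $j \in \mathbf{x}_h$ with $$\frac{v(\mathbf{x}_i)}{\eta_i} \ge \frac{v(\mathbf{x}_h)}{\eta_h} - \frac{v(\{j\})}{\min\{\eta_i,\eta_h\}}.$$ Theorem. There are an algorithm, a polynomial $p$ and a constant $c$ such that for every $\varepsilon \in (0,1)$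 and every such instance whose maximum Nash welfare is nonzero, the algorithm, given $\varepsilon$, $n$, $m$, the weights and the values of the goods, halts after at most $p\bigl(m^{c/\varepsilon^2}\bigr)$ steps and outputs an allocation that is both $\varepsilon$-approximately Nash optimal and wwEF1. Here an algorithm is a single program, independent of the input, for a random access machine over the real numbers. One step is one elementary operation: reading or writing a memory cell; addition, subtraction, multiplication, division or a power with positive base, on reals; addition, (truncated) subtraction or multiplication on natural numbers; a comparison; or a branch. The only constants are natural numbers, and reals cannot be rounded to integers. -/

import Mathlib

noncomputable section

/-! ## Instances, allocations, Nash welfare, fairness -/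

/-- An instance with `n` agents and `m` indivisible goods: normalized nonnegative valuations
`v i : 2^M → ℝ` and positive weights `η i` of the agents. -/
structure Instance (n m : ℕ) where
  v : Fin n → Finset (Fin m) → ℝ
  v_nonneg : ∀ i S, 0 ≤ v i S
  v_empty : ∀ i, v i ∅ = 0
  η : Fin n → ℝ
  η_pos : ∀ i, 0 < η i

/-- An allocation is an ordered partition of the goods into `n` (possibly empty) bundles, given by
the map that sends every good to its owner. -/
abbrev Allocation (n m : ℕ) := Fin m → Fin n

/-- The bundle of agent `i`. -/
def Allocation.bundle {n m : ℕ} (x : Allocation n m) (i : Fin n) : Finset (Fin m) :=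
  Finset.univ.filter fun j => x j = i

namespace Instance

variable {n m : ℕ} (I : Instance n m)

/-- All valuations are additive. -/
def IsAdditive : Prop := ∀ i S, I.v i S = ∑ j ∈ S, I.v i {j}

/-- All agents have the same valuation (their weights may differ). -/
def IsIdentical : Prop := ∀ i h, I.v i = I.v h

/-- The Nash welfare of an allocation: the weighted geometric mean of the utilities. -/
def nashWelfare (x : Allocation n m) : ℝ :=
  (∏ i, I.v i (x.bundle i) ^ I.η i) ^ (1 / ∑ i, I.η i)

/-- Allocations of maximum Nash welfare. -/
def IsNashOptimal (x : Allocation n m) : Prop := ∀ y, I.nashWelfare y ≤ I.nashWelfare x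

/-- `x` is an `α`-approximation: `NW(x) ≥ α · NW(x*)` for a Nash optimal `x*`. -/
def IsApproximation (α : ℝ) (x : Allocation n m) : Prop :=
  ∃ xopt, I.IsNashOptimal xopt ∧ α * I.nashWelfare xopt ≤ I.nashWelfare x

/-- The optimum Nash welfare is nonzero. -/
def HasNonzeroOptimum : Prop := ∃ xopt, I.IsNashOptimal xopt ∧ I.nashWelfare xopt ≠ 0

/-- Weak weighted envy-freeness up to one good. -/
def IsWWEF1 (x : Allocation n m) : Prop :=
  ∀ i h, ∃ j ∈ x.bundle h,
    I.v i (x.bundle i) / I.η i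
      ≥ I.v i (x.bundle h) / I.η h - I.v i {j} / min (I.η i) (I.η h)

end Instance

/-! ## The machine model: a real RAM

A program uses finitely many unbounded arrays of natural numbers (also used for addresses) and
finitely many unbounded arrays of real numbers. Each elementary operation has unit cost: reading
or writing an array entry, `+`, `-`, `*` on natural numbers, `+`, `-`, `*`, `/` and powers with
positive base on real numbers, comparison, branching. There is no rounding of reals to integers,
and the only constants are natural numbers. -/

namespace RealRAM

/-- The memory: `int k i` and `real k i` are the `i`-th entries of the `k`-th integer and of the
`k`-th real array. -/
structure Mem where
  int : ℕ → ℕ → ℕ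
  real : ℕ → ℕ → ℝ

/-- Overwrite one integer entry. -/
def Mem.setInt (s : Mem) (k i a : ℕ) : Mem :=
  { s with int := Function.update s.int k (Function.update (s.int k) i a) }

/-- Overwrite one real entry. -/
def Mem.setReal (s : Mem) (k i : ℕ) (a : ℝ) : Mem :=
  { s with real := Function.update s.real k (Function.update (s.real k) i a) }

/-- Integer expressions; `get k e` reads entry `e` of the integer array `k`. -/
inductive IntExp where
  | const (c : ℕ)
  | get (k : ℕ) (e : IntExp)
  | add (a b : IntExp)
  | sub (a b : IntExp)
  | mul (a b : IntExp)

/-- Value of an integer expression (subtraction is truncated at `0`). -/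
def IntExp.eval (s : Mem) : IntExp → ℕ
  | .const c => c
  | .get k e => s.int k (e.eval s)
  | .add a b => a.eval s + b.eval s
  | .sub a b => a.eval s - b.eval s
  | .mul a b => a.eval s * b.eval s

/-- Number of elementary operations in an integer expression. -/
def IntExp.cost : IntExp → ℕ
  | .const _ => 1
  | .get _ e => e.cost + 1
  | .add a b => a.cost + b.cost + 1
  | .sub a b => a.cost + b.cost + 1
  | .mul a b => a.cost + b.cost + 1

/-- Real expressions; `get k e` reads entry `e` of the real array `k`, and `ofInt` regards a
natural number as a real. -/
inductive RealExp where
  | ofInt (e : IntExp)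
  | get (k : ℕ) (e : IntExp)
  | add (a b : RealExp)
  | sub (a b : RealExp)
  | mul (a b : RealExp)
  | div (a b : RealExp)
  | pow (a b : RealExp)

/-- Value of a real expression. Division by `0` returns `0`; so does a power whose base is not
positive. -/
def RealExp.eval (s : Mem) : RealExp → ℝ
  | .ofInt e => (e.eval s : ℝ)
  | .get k e => s.real k (e.eval s)
  | .add a b => a.eval s + b.eval s
  | .sub a b => a.eval s - b.eval s
  | .mul a b => a.eval s * b.eval s
  | .div a b => a.eval s / b.eval s
  | .pow a b => if 0 < a.eval s then (a.eval s) ^ (b.eval s) else 0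

/-- Number of elementary operations in a real expression. -/
def RealExp.cost : RealExp → ℕ
  | .ofInt e => e.cost + 1
  | .get _ e => e.cost + 1
  | .add a b => a.cost + b.cost + 1
  | .sub a b => a.cost + b.cost + 1
  | .mul a b => a.cost + b.cost + 1
  | .div a b => a.cost + b.cost + 1
  | .pow a b => a.cost + b.cost + 1

/-- Tests. -/
inductive Test where
  | ltInt (a b : IntExp)
  | ltReal (a b : RealExp)
  | not (a : Test)
  | and (a b : Test)

/-- Truth of a test. -/
def Test.holds (s : Mem) : Test → Prop
  | .ltInt a b => a.eval s < b.eval s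
  | .ltReal a b => a.eval s < b.eval s
  | .not a => ¬ a.holds s
  | .and a b => a.holds s ∧ b.holds s

/-- Number of elementary operations in a test. -/
def Test.cost : Test → ℕ
  | .ltInt a b => a.cost + b.cost + 1
  | .ltReal a b => a.cost + b.cost + 1
  | .not a => a.cost + 1
  | .and a b => a.cost + b.cost + 1

/-- Programs. -/
inductive Program where
  | nop
  | setInt (k : ℕ) (i e : IntExp)
  | setReal (k : ℕ) (i : IntExp) (e : RealExp)
  | seq (p q : Program)
  | branch (b : Test) (p q : Program)
  | loop (b : Test) (p : Program)

/-- `Runs p s t s'`: started in memory `s`, the program `p` halts after exactly `t` elementary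
steps, in memory `s'`. -/
inductive Runs : Program → Mem → ℕ → Mem → Prop where
  | nop (s : Mem) : Runs .nop s 1 s
  | setInt (s : Mem) (k : ℕ) (i e : IntExp) :
      Runs (.setInt k i e) s (i.cost + e.cost + 1) (s.setInt k (i.eval s) (e.eval s))
  | setReal (s : Mem) (k : ℕ) (i : IntExp) (e : RealExp) :
      Runs (.setReal k i e) s (i.cost + e.cost + 1) (s.setReal k (i.eval s) (e.eval s))
  | seq {p q : Program} {s s' s'' : Mem} {t t' : ℕ} :
      Runs p s t s' → Runs q s' t' s'' → Runs (.seq p q) s (t + t') s''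
  | branch_true {b : Test} {p q : Program} {s s' : Mem} {t : ℕ} :
      b.holds s → Runs p s t s' → Runs (.branch b p q) s (b.cost + 1 + t) s'
  | branch_false {b : Test} {p q : Program} {s s' : Mem} {t : ℕ} :
      ¬ b.holds s → Runs q s t s' → Runs (.branch b p q) s (b.cost + 1 + t) s'
  | loop_false {b : Test} {p : Program} {s : Mem} :
      ¬ b.holds s → Runs (.loop b p) s (b.cost + 1) s
  | loop_true {b : Test} {p : Program} {s s' s'' : Mem} {t t' : ℕ} :
      b.holds s → Runs p s t s' → Runs (.loop b p) s' t' s'' →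
        Runs (.loop b p) s (b.cost + 1 + t + t') s''

end RealRAM

/-- The initial memory for an instance with additive valuations and accuracy `ε`. Integer array
`0` holds `n, m`; real array `0` holds `ε`; real array `1` holds the weights `η i`; real array `2`
holds the values `v i {j}`, at position `i * m + j`. Every other entry is `0`. -/
def Instance.input {n m : ℕ} (I : Instance n m) (ε : ℝ) : RealRAM.Mem where
  int k a := if k = 0 ∧ a = 0 then n else if k = 0 ∧ a = 1 then m else 0
  real k a :=
    if k = 0 ∧ a = 0 then ε
    else if k = 1 then (if h : a < n then I.η ⟨a, h⟩ else 0)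
    else if k = 2 then
      ∑ i : Fin n, ∑ j : Fin m, (if a = (i : ℕ) * m + (j : ℕ) then I.v i {j} else 0)
    else 0

/-- A final memory presents the allocation `x` if integer array `1` holds, at position `j`, the
owner of good `j`. -/
def RealRAM.Mem.Outputs {n m : ℕ} (s : RealRAM.Mem) (x : Allocation n m) : Prop :=
  ∀ j : Fin m, s.int 1 (j : ℕ) = (x j : ℕ)

end

noncomputable section

namespace RealRAM

/-! ## Counting-loop programs -/

/-! The values are rounded, a dynamic program finds an almost optimal allocation, and a local search
repairs fairness without lowering the welfare. Let `δ = ε / 3`.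

Rounding (`classes_spec`): there are at most `m` positive class values, each more than `1 + δ` times
the previous one, and rounding down to them costs every good at most a factor `1 + δ`.

Order of the agents (`exists_relabeling`): as all agents share one valuation, bundles can be
permuted among them. By the rearrangement inequality, applied to logarithms, an optimum can be
compared with an assignment that gives bundles of increasing rounded value to agents of increasing
weight.

Dynamic program (`IsTable.exists_ge`): the agents are served in this order. For a bundle of value
`w`, a class is small if its value is below `δ ^ 2 * w`. If `(1 + δ) ^ K * δ > 1`, a class more than
`2 * K` above the last small one has value above `w`, so no bundle up to this one contains such a
good. A state therefore consists of the last small class, the volume of the small goods in use as a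
multiple of that class's value, and exact counts for `2 * K` classes. This makes `(2 * m + 1) ^ (2 +
2 * K)` states with `K ≤ 1 + 1 / δ ^ 2`. Goods of one class are interchangeable, so counts suffice
for the large classes; small goods are filled in greedily. The threshold only rises and the class
values grow geometrically, so all roundings of the volume together cost at most `(1 + δ) * δ * w`,
and greedy filling stops within `δ ^ 2 * w` of its target. The agent receives at least `(1 - 2 * δ)
* w`; with the rounding of the values the total factor is `1 - 3 * δ = 1 - ε`.

Repair (`nash_le_nash_update`, `UpInv.update`): a move along a violation of wwEF1 does not decrease
the weighted product, by Bernoulli's inequality. Moves to lighter agents end because a potential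
drops. Moves to agents at least as heavy then follow, always of largest gain, and the receiver is
marked. Maximality keeps moves from unmarked to lighter agents unnecessary, and a marked agent never
loses a good, so `m` such moves suffice.

Running time (`Stmt.runs_compile`): the programs use counting loops whose bounds lie in an array
that no statement writes. They terminate by construction, and their cost is a fixed polynomial in
the largest bound. -/

@[simp] theorem Mem.setInt_int (s : Mem) (k i a k' i' : ℕ) :
    (s.setInt k i a).int k' i' = if k' = k ∧ i' = i then a else s.int k' i' := by
  unfold Mem.setInt
  by_cases h : k' = k
  · subst h; by_cases h' : i' = i <;> simp [h', Function.update]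
  · simp [h, Function.update]

@[simp] theorem Mem.setInt_real (s : Mem) (k i a : ℕ) : (s.setInt k i a).real = s.real := rfl

@[simp] theorem Mem.setReal_real (s : Mem) (k i : ℕ) (a : ℝ) (k' i' : ℕ) :
    (s.setReal k i a).real k' i' = if k' = k ∧ i' = i then a else s.real k' i' := by
  unfold Mem.setReal
  by_cases h : k' = k
  · subst h; by_cases h' : i' = i <;> simp [h', Function.update]
  · simp [h, Function.update]

@[simp] theorem Mem.setReal_int (s : Mem) (k i : ℕ) (a : ℝ) : (s.setReal k i a).int = s.int := rfl

instance : Add IntExp := ⟨.add⟩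
instance : Sub IntExp := ⟨.sub⟩
instance : Mul IntExp := ⟨.mul⟩
instance : Add RealExp := ⟨.add⟩
instance : Sub RealExp := ⟨.sub⟩
instance : Mul RealExp := ⟨.mul⟩
instance : Div RealExp := ⟨.div⟩

/-- The scalar integer variable stored in entry `0` of array `k`. -/
def ivar (k : ℕ) : IntExp := .get k (.const 0)

/-- The scalar real variable stored in entry `0` of array `k`. -/
def rvar (k : ℕ) : RealExp := .get k (.const 0)

@[simp] theorem IntExp.eval_ivar (s : Mem) (k : ℕ) : (ivar k).eval s = s.int k 0 := rfl
@[simp] theorem RealExp.eval_rvar (s : Mem) (k : ℕ) : (rvar k).eval s = s.real k 0 := rfl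
@[simp] theorem IntExp.eval_add (s : Mem) (a b : IntExp) :
    (a + b).eval s = a.eval s + b.eval s := rfl
@[simp] theorem IntExp.eval_sub (s : Mem) (a b : IntExp) :
    (a - b).eval s = a.eval s - b.eval s := rfl
@[simp] theorem IntExp.eval_mul (s : Mem) (a b : IntExp) :
    (a * b).eval s = a.eval s * b.eval s := rfl
@[simp] theorem IntExp.eval_const (s : Mem) (c : ℕ) : (IntExp.const c).eval s = c := rfl
@[simp] theorem IntExp.eval_get (s : Mem) (k : ℕ) (e : IntExp) :
    (IntExp.get k e).eval s = s.int k (e.eval s) := rfl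
@[simp] theorem RealExp.eval_add (s : Mem) (a b : RealExp) :
    (a + b).eval s = a.eval s + b.eval s := rfl
@[simp] theorem RealExp.eval_sub (s : Mem) (a b : RealExp) :
    (a - b).eval s = a.eval s - b.eval s := rfl
@[simp] theorem RealExp.eval_mul (s : Mem) (a b : RealExp) :
    (a * b).eval s = a.eval s * b.eval s := rfl
@[simp] theorem RealExp.eval_div (s : Mem) (a b : RealExp) :
    (a / b).eval s = a.eval s / b.eval s := rfl
@[simp] theorem RealExp.eval_ofInt (s : Mem) (e : IntExp) :
    (RealExp.ofInt e).eval s = (e.eval s : ℝ) := rfl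
@[simp] theorem RealExp.eval_get (s : Mem) (k : ℕ) (e : IntExp) :
    (RealExp.get k e).eval s = s.real k (e.eval s) := rfl
@[simp] theorem RealExp.eval_pow (s : Mem) (a b : RealExp) :
    (RealExp.pow a b).eval s = if 0 < a.eval s then (a.eval s) ^ (b.eval s) else 0 := rfl
@[simp] theorem Test.holds_ltInt (s : Mem) (a b : IntExp) :
    (Test.ltInt a b).holds s ↔ a.eval s < b.eval s := Iff.rfl
@[simp] theorem Test.holds_ltReal (s : Mem) (a b : RealExp) :
    (Test.ltReal a b).holds s ↔ a.eval s < b.eval s := Iff.rfl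
@[simp] theorem Test.holds_not (s : Mem) (a : Test) : (Test.not a).holds s ↔ ¬ a.holds s := Iff.rfl
@[simp] theorem Test.holds_and (s : Mem) (a b : Test) :
    (Test.and a b).holds s ↔ a.holds s ∧ b.holds s := Iff.rfl

/-- Programs whose only loops are counting loops: `loop k c p` executes `p` with the counter
`int k 0` running from `0` to `int 0 c` (exclusive). -/
inductive Stmt where
  | nop
  | setInt (k : ℕ) (i e : IntExp)
  | setReal (k : ℕ) (i : IntExp) (e : RealExp)
  | seq (p q : Stmt)
  | ite (b : Test) (p q : Stmt)
  | loop (k c : ℕ) (p : Stmt)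

namespace Stmt

/-- Translation to real RAM programs. -/
def compile : Stmt → Program
  | nop => .nop
  | setInt k i e => .setInt k i e
  | setReal k i e => .setReal k i e
  | seq p q => .seq p.compile q.compile
  | ite b p q => .branch b p.compile q.compile
  | loop k c p => .seq (.setInt k (.const 0) (.const 0))
      (.loop (.ltInt (ivar k) (.get 0 (.const c)))
        (.seq p.compile (.setInt k (.const 0) (ivar k + .const 1))))

/-- The memory after `i` rounds of a counting loop with body `f` and counter `int k 0`. -/
def iterate (f : Mem → Mem) (k : ℕ) (s : Mem) : ℕ → Mem
  | 0 => s.setInt k 0 0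
  | i + 1 => (f (iterate f k s i)).setInt k 0 (i + 1)

open Classical in
/-- The memory after executing a statement. -/
def run : Stmt → Mem → Mem
  | nop, s => s
  | setInt k i e, s => s.setInt k (i.eval s) (e.eval s)
  | setReal k i e, s => s.setReal k (i.eval s) (e.eval s)
  | seq p q, s => q.run (p.run s)
  | ite b p q, s => if b.holds s then p.run s else q.run s
  | loop k c p, s => iterate p.run k s (s.int 0 c)

/-- The integer arrays a statement may modify. -/
def modInt : Stmt → List ℕ
  | nop => []
  | setInt k _ _ => [k]
  | setReal _ _ _ => []
  | seq p q => p.modInt ++ q.modInt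
  | ite _ p q => p.modInt ++ q.modInt
  | loop k _ p => k :: p.modInt

/-- The real arrays a statement may modify. -/
def modReal : Stmt → List ℕ
  | nop => []
  | setInt _ _ _ => []
  | setReal k _ _ => [k]
  | seq p q => p.modReal ++ q.modReal
  | ite _ p q => p.modReal ++ q.modReal
  | loop _ _ p => p.modReal

/-- No statement modifies the integer array `0`, and no loop body modifies its counter. -/
def wf : Stmt → Bool
  | nop => true
  | setInt k _ _ => k != 0
  | setReal _ _ _ => true
  | seq p q => p.wf && q.wf
  | ite _ p q => p.wf && q.wf
  | loop k _ p => k != 0 && !(p.modInt.contains k) && p.wf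

/-- A bound on the running time, as a polynomial in a bound on the loop lengths. -/
def costPoly : Stmt → Polynomial ℝ
  | nop => 1
  | setInt _ i e => (i.cost + e.cost + 1 : ℕ)
  | setReal _ i e => (i.cost + e.cost + 1 : ℕ)
  | seq p q => p.costPoly + q.costPoly
  | ite b p q => (b.cost + 1 : ℕ) + p.costPoly + q.costPoly
  -- Resetting the counter costs 3 and the final failed test 6. Each round adds 6 for the test and 6
  -- for the increment.
  | loop _ _ p => 9 + Polynomial.X * (p.costPoly + 12)

theorem iterate_int (f : Mem → Mem) (k k' : ℕ) (s : Mem) (hk : k' ≠ k)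
    (hf : ∀ t : Mem, (f t).int k' = t.int k') (i : ℕ) : (iterate f k s i).int k' = s.int k' := by
  induction i with
  | zero => ext a; simp [iterate, hk]
  | succ i ih => ext a; simp [iterate, hk, hf, ih]

theorem iterate_real (f : Mem → Mem) (k k' : ℕ) (s : Mem)
    (hf : ∀ t : Mem, (f t).real k' = t.real k') (i : ℕ) :
    (iterate f k s i).real k' = s.real k' := by
  induction i with
  | zero => simp [iterate]
  | succ i ih => simp [iterate, hf, ih]

/-- Frame rule. `modInt` is a computable list, so for a concrete program the side condition is
settled by `decide`. -/
theorem run_int (p : Stmt) (k : ℕ) (hk : k ∉ p.modInt) (s : Mem) :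
    (p.run s).int k = s.int k := by
  induction p generalizing s with
  | nop => rfl
  | setInt k' i e => ext a; simp [modInt] at hk; simp [run, hk]
  | setReal k' i e => rfl
  | seq p q hp hq => simp [modInt] at hk; simp [run, hp hk.1, hq hk.2]
  | ite b p q hp hq => simp [modInt] at hk; unfold run; split <;> simp [hp hk.1, hq hk.2]
  | loop k' c p hp =>
    simp [modInt] at hk
    exact iterate_int _ _ _ _ hk.1 (hp hk.2) _

theorem run_real (p : Stmt) (k : ℕ) (hk : k ∉ p.modReal) (s : Mem) :
    (p.run s).real k = s.real k := by
  induction p generalizing s with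
  | nop => rfl
  | setInt k' i e => rfl
  | setReal k' i e => ext a; simp [modReal] at hk; simp [run, hk]
  | seq p q hp hq => simp [modReal] at hk; simp [run, hp hk.1, hq hk.2]
  | ite b p q hp hq => simp [modReal] at hk; unfold run; split <;> simp [hp hk.1, hq hk.2]
  | loop k' c p hp => exact iterate_real _ _ _ _ (hp hk) _

/-- Array `0` holds the loop bounds, so these stay constant during a run. -/
theorem wf_modInt {p : Stmt} (h : p.wf) : 0 ∉ p.modInt := by
  induction p with
  | nop => simp [modInt]
  | setInt k i e => simp [wf] at h; simp [modInt, Ne.symm h]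
  | setReal k i e => simp [modInt]
  | seq p q hp hq => simp [wf] at h; simp [modInt, hp h.1, hq h.2]
  | ite b p q hp hq => simp [wf] at h; simp [modInt, hp h.1, hq h.2]
  | loop k c p hp => simp [wf] at h; simp [modInt, hp h.2, Ne.symm h.1.1]

theorem costPoly_nonneg (p : Stmt) {M : ℝ} (hM : 0 ≤ M) : 0 ≤ p.costPoly.eval M := by
  induction p with
  | nop => simp [costPoly]
  | setInt k i e => simp [costPoly]; positivity
  | setReal k i e => simp [costPoly]; positivity
  | seq p q hp hq => simp [costPoly]; positivity
  | ite b p q hp hq => simp [costPoly]; positivity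
  | loop k c p hp => simp [costPoly]; positivity

theorem iterate_int_self (f : Mem → Mem) (k : ℕ) (s : Mem) (i : ℕ) :
    (iterate f k s i).int k 0 = i := by
  cases i <;> simp [iterate]

/-- A well-formed statement runs as described by `run`, in time bounded by `costPoly`. -/
theorem runs_compile (p : Stmt) (h : p.wf) (M : ℝ) (s : Mem) (hs : ∀ c, (s.int 0 c : ℝ) ≤ M) :
    ∃ t : ℕ, Runs p.compile s t (p.run s) ∧ (t : ℝ) ≤ p.costPoly.eval M := by
  have hM : 0 ≤ M := le_trans (Nat.cast_nonneg _) (hs 0)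
  induction p generalizing s with
  | nop => exact ⟨1, .nop s, by simp [costPoly]⟩
  | setInt k i e => exact ⟨_, .setInt s k i e, by simp [costPoly]⟩
  | setReal k i e => exact ⟨_, .setReal s k i e, by simp [costPoly]⟩
  | seq p q hp hq =>
    simp [wf] at h
    obtain ⟨t, ht, ht'⟩ := hp h.1 s hs
    obtain ⟨u, hu, hu'⟩ := hq h.2 (p.run s) (by rw [run_int p 0 (wf_modInt h.1)]; exact hs)
    exact ⟨t + u, .seq ht hu, by simp [costPoly]; linarith⟩
  | ite b p q hp hq =>
    simp [wf] at h
    have h1 := p.costPoly_nonneg hM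
    have h2 := q.costPoly_nonneg hM
    by_cases hb : b.holds s
    · obtain ⟨t, ht, ht'⟩ := hp h.1 s hs
      refine ⟨b.cost + 1 + t, ?_, by simp [costPoly]; linarith⟩
      simp only [run, hb, if_true]
      exact .branch_true hb ht
    · obtain ⟨t, ht, ht'⟩ := hq h.2 s hs
      refine ⟨b.cost + 1 + t, ?_, by simp [costPoly]; linarith⟩
      simp only [run, hb, if_false]
      exact .branch_false hb ht
  | loop k c p hp =>
    simp [wf] at h
    obtain ⟨⟨hk0, hkp⟩, hwf⟩ := h
    have h0 : ∀ i, (iterate p.run k s i).int 0 = s.int 0 := fun i =>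
      iterate_int _ _ _ _ (Ne.symm hk0) (fun t => run_int p 0 (wf_modInt hwf) t) i
    -- The induction is on the number `r` of remaining rounds, because `Runs` unfolds a loop at its
    -- first round while `iterate` unfolds at its last.
    have key : ∀ r i, i + r = s.int 0 c → ∃ t : ℕ,
        Runs (.loop (.ltInt (ivar k) (.get 0 (.const c)))
          (.seq p.compile (.setInt k (.const 0) (ivar k + .const 1)))) (iterate p.run k s i) t
          (iterate p.run k s (s.int 0 c)) ∧ (t : ℝ) ≤ 6 + r * (p.costPoly.eval M + 12) := by
      intro r
      induction r with
      | zero =>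
        intro i hi
        simp at hi
        subst hi
        refine ⟨_, .loop_false ?_, ?_⟩
        · simp [iterate_int_self, h0]
        · simp [Test.cost, ivar, IntExp.cost]
      | succ r ih =>
        intro i hi
        obtain ⟨u, hu, hu'⟩ := ih (i + 1) (by omega)
        obtain ⟨t, ht, ht'⟩ := hp hwf (iterate p.run k s i) (by rw [h0]; exact hs)
        refine ⟨_, .loop_true (t' := u) ?_ (.seq ht (.setInt _ k _ _)) ?_, ?_⟩
        · simp [iterate_int_self, h0]; omega
        · have : (p.run (iterate p.run k s i)).int k 0 = i := by
            rw [run_int p k hkp, iterate_int_self]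
          simpa [this, iterate] using hu
        · have e1 : (IntExp.const 0).cost = 1 := rfl
          have e2 : (ivar k + IntExp.const 1).cost = 4 := rfl
          have e3 : (Test.ltInt (ivar k) (.get 0 (.const c))).cost = 5 := rfl
          rw [e1, e2, e3]
          push_cast
          nlinarith
    obtain ⟨t, ht, ht'⟩ := key (s.int 0 c) 0 (by simp)
    refine ⟨_, .seq (.setInt s k _ _) ht, ?_⟩
    have e1 : (IntExp.const 0).cost = 1 := rfl
    simp only [costPoly, e1, Polynomial.eval_add, Polynomial.eval_mul, Polynomial.eval_X]
    have := mul_le_mul_of_nonneg_right (hs c)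
      (add_nonneg (p.costPoly_nonneg hM) (by norm_num : (0:ℝ) ≤ 12))
    push_cast
    simp
    linarith

/-- Invariant rule for counting loops. -/
theorem loop_inv {k c : ℕ} {p : Stmt} {s : Mem} (Inv : ℕ → Mem → Prop)
    (h0 : Inv 0 (s.setInt k 0 0))
    (hstep : ∀ i < s.int 0 c, ∀ t : Mem, t.int k 0 = i →
      (∀ k' ∉ k :: p.modInt, t.int k' = s.int k') → (∀ k' ∉ p.modReal, t.real k' = s.real k') →
      Inv i t → Inv (i + 1) ((p.run t).setInt k 0 (i + 1))) :
    Inv (s.int 0 c) ((loop k c p).run s) := by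
  have key : ∀ i ≤ s.int 0 c, Inv i (iterate p.run k s i) := by
    intro i hi
    induction i with
    | zero => exact h0
    | succ i ih =>
      refine hstep i (by omega) _ (iterate_int_self _ _ _ _) (fun k' hk' => ?_) (fun k' hk' => ?_)
        (ih (by omega))
      · simp only [List.mem_cons, not_or] at hk'
        exact iterate_int _ _ _ _ hk'.1 (run_int p k' hk'.2) _
      · exact iterate_real _ _ _ _ (run_real p k' hk') _
  exact key _ le_rfl

end Stmt
end RealRAM

namespace NashWelfare

open Finset

/-! ## Improving moves of single goods -/

/-- Value of the bundle of agent `i`, where `a j` is the value and `x j` the owner of good `j`. -/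
def val (m : ℕ) (a : ℕ → ℝ) (x : ℕ → ℕ) (i : ℕ) : ℝ :=
  ∑ j ∈ range m, if x j = i then a j else 0

/-- The weighted product of the bundle values. -/
def nash (n m : ℕ) (η a : ℕ → ℝ) (x : ℕ → ℕ) : ℝ := ∏ i ∈ range n, val m a x i ^ η i

/-- Value per unit of weight. -/
def level (m : ℕ) (η a : ℕ → ℝ) (x : ℕ → ℕ) (i : ℕ) : ℝ := val m a x i / η i

variable {n m : ℕ} {η a : ℕ → ℝ} {x : ℕ → ℕ}

theorem val_update {i j : ℕ} (hj : j < m) (k : ℕ) :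
    val m a (Function.update x j i) k =
      val m a x k + (if i = k then a j else 0) - (if x j = k then a j else 0) := by
  have hj' : j ∈ range m := mem_range.2 hj
  unfold val
  rw [← add_sum_erase _ _ hj', ← add_sum_erase (range m) (fun j => if x j = k then a j else 0) hj']
  have : ∑ l ∈ (range m).erase j, (if Function.update x j i l = k then a l else 0) =
      ∑ l ∈ (range m).erase j, (if x l = k then a l else 0) :=
    sum_congr rfl fun l hl => by rw [Function.update_of_ne (ne_of_mem_erase hl)]
  rw [this]
  simp
  ring

theorem val_nonneg (ha : ∀ j < m, 0 ≤ a j) (k : ℕ) : 0 ≤ val m a x k :=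
  sum_nonneg fun j hj => by split; exacts [ha j (mem_range.1 hj), le_rfl]

/-- Two-agent form of the fact that an improving move increases the Nash welfare. -/
theorem rpow_mul_rpow_le_of_move {p q v s t : ℝ} (hp : 0 < p) (hq : 0 < q) (hv : 0 ≤ v)
    (hs : 0 < s) (ht : 0 < t) (h : p / s + v / min s t < q / t) :
    0 < q - v ∧ p ^ s * q ^ t ≤ (p + v) ^ s * (q - v) ^ t := by
  have hmin : 0 < min s t := lt_min hs ht
  have hqv : 0 < q - v := by
    have h1 : v / t ≤ v / min s t := div_le_div_of_nonneg_left hv hmin (min_le_right _ _)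
    have h2 : v / t < q / t := by have := div_pos hp hs; linarith
    have := (div_lt_div_iff_of_pos_right ht).1 h2
    linarith
  refine ⟨hqv, ?_⟩
  -- Bernoulli needs an exponent at least `1`. If the receiver is heavier, it is applied to the
  -- receiver's growth `1 + v / p` with exponent `s / t`; otherwise to the donor's shrinkage `1 - v
  -- / q` with exponent `t / s`. The hypothesis compares exactly the two slopes that arise.
  rcases le_total t s with hts | hts
  · rw [min_eq_right hts] at h
    have h1 : p / s < (q - v) / t := by rw [sub_div]; linarith
    have h1' : p * t < (q - v) * s := (div_lt_div_iff₀ hs ht).1 h1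
    have hb := one_add_mul_self_le_rpow_one_add (s := v / p)
      (by have := div_nonneg hv hp.le; linarith)
      (p := s / t) ((one_le_div ht).2 hts)
    have h2 : q / (q - v) ≤ (1 + v / p) ^ (s / t) := by
      refine le_trans ?_ hb
      have : q / (q - v) = 1 + v / (q - v) := by field_simp; ring
      rw [this]
      gcongr
      rw [div_mul_div_comm, div_le_div_iff₀ hqv (by positivity)]
      nlinarith
    have h3 : (q / (q - v)) ^ t ≤ (1 + v / p) ^ s := by
      calc (q / (q - v)) ^ t ≤ ((1 + v / p) ^ (s / t)) ^ t := by gcongr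
        _ = (1 + v / p) ^ s := by
          rw [← Real.rpow_mul (by positivity)]; congr 1; field_simp
    have h4 : p + v = p * (1 + v / p) := by field_simp
    have h5 : q = (q - v) * (q / (q - v)) := by field_simp
    calc p ^ s * q ^ t = p ^ s * ((q - v) ^ t * (q / (q - v)) ^ t) := by
          rw [← Real.mul_rpow hqv.le (by positivity), ← h5]
      _ ≤ p ^ s * ((q - v) ^ t * (1 + v / p) ^ s) := by gcongr
      _ = (p + v) ^ s * (q - v) ^ t := by
          rw [h4, Real.mul_rpow hp.le (by positivity)]; ring
  · rw [min_eq_left hts] at h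
    have hpv : 0 < p + v := by linarith
    have h1 : (p + v) / s < q / t := by rw [add_div]; linarith
    have h1' : (p + v) * t < q * s := (div_lt_div_iff₀ hs ht).1 h1
    have hb := one_add_mul_self_le_rpow_one_add (s := -(v / q))
      (by have : v / q ≤ 1 := by rw [div_le_one hq]; linarith
          linarith)
      (p := t / s) ((one_le_div hs).2 hts)
    have h2 : p / (p + v) ≤ ((q - v) / q) ^ (t / s) := by
      have e : (q - v) / q = 1 + -(v / q) := by field_simp; ring
      rw [e]
      refine le_trans ?_ hb
      have : p / (p + v) = 1 + -(v / (p + v)) := by field_simp; ring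
      rw [this, mul_neg]
      gcongr
      rw [div_mul_div_comm, div_le_div_iff₀ (by positivity) hpv]
      nlinarith
    have h3 : (p / (p + v)) ^ s ≤ ((q - v) / q) ^ t := by
      calc (p / (p + v)) ^ s ≤ (((q - v) / q) ^ (t / s)) ^ s := by gcongr
        _ = ((q - v) / q) ^ t := by
          rw [← Real.rpow_mul (by positivity)]; congr 1; field_simp
    have h4 : p = (p + v) * (p / (p + v)) := by field_simp
    have h5 : q - v = q * ((q - v) / q) := by field_simp
    calc p ^ s * q ^ t = (p + v) ^ s * (p / (p + v)) ^ s * q ^ t := by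
          rw [← Real.mul_rpow hpv.le (by positivity), ← h4]
      _ ≤ (p + v) ^ s * ((q - v) / q) ^ t * q ^ t := by gcongr
      _ = (p + v) ^ s * (q - v) ^ t := by
          rw [mul_assoc, ← Real.mul_rpow (by positivity) hq.le, mul_comm ((q - v) / q), ← h5]

/-- Moving a good to an agent who envies its owner even without it increases the Nash welfare. -/
theorem nash_le_nash_update (hη : ∀ i < n, 0 < η i) (ha : ∀ j < m, 0 ≤ a j)
    (hx : ∀ j < m, x j < n) (hpos : ∀ i < n, 0 < val m a x i) {i j : ℕ} (hi : i < n) (hj : j < m)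
    (h : level m η a x i + a j / min (η i) (η (x j)) < level m η a x (x j)) :
    nash n m η a x ≤ nash n m η a (Function.update x j i) ∧
      ∀ k < n, 0 < val m a (Function.update x j i) k := by
  have hxj := hx j hj
  have hne : i ≠ x j := by
    rintro rfl
    have : 0 ≤ a j / min (η (x j)) (η (x j)) := by
      rw [min_self]; exact div_nonneg (ha j hj) (hη _ hi).le
    linarith
  obtain ⟨h1, h2⟩ := rpow_mul_rpow_le_of_move (hpos i hi) (hpos _ hxj) (ha j hj) (hη i hi)
    (hη _ hxj) h
  have hi' : val m a (Function.update x j i) i = val m a x i + a j := by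
    rw [val_update hj]; simp [hne.symm]
  have hh' : val m a (Function.update x j i) (x j) = val m a x (x j) - a j := by
    rw [val_update hj]; simp [hne]
  have ho : ∀ k, k ≠ i → k ≠ x j → val m a (Function.update x j i) k = val m a x k := by
    intro k h1 h2
    rw [val_update hj]; simp [h1.symm, h2.symm]
  constructor
  · unfold nash
    have m1 : i ∈ range n := mem_range.2 hi
    have m2 : x j ∈ (range n).erase i := mem_erase.2 ⟨hne.symm, mem_range.2 hxj⟩
    rw [← mul_prod_erase _ _ m1, ← mul_prod_erase _ _ m2,
      ← mul_prod_erase (range n) (fun k => val m a (Function.update x j i) k ^ η k) m1,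
      ← mul_prod_erase _ (fun k => val m a (Function.update x j i) k ^ η k) m2]
    rw [hi', hh', ← mul_assoc, ← mul_assoc]
    have : ∏ k ∈ ((range n).erase i).erase (x j), val m a (Function.update x j i) k ^ η k =
        ∏ k ∈ ((range n).erase i).erase (x j), val m a x k ^ η k :=
      prod_congr rfl fun k hk => by
        rw [ho k (ne_of_mem_erase (mem_of_mem_erase hk)) (ne_of_mem_erase hk)]
    rw [this]
    exact mul_le_mul_of_nonneg_right h2
      (prod_nonneg fun k _ => Real.rpow_nonneg (val_nonneg ha k) _)
  · intro k hk
    by_cases hki : k = i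
    · subst hki; rw [hi']; have := hpos k hk; have := ha j hj; linarith
    · by_cases hkh : k = x j
      · subst hkh; rw [hh']; exact h1
      · rw [ho k hki hkh]; exact hpos k hk

/-- One round of a local search: nothing changes if no pair (agent, good) in `R` has positive
`key`; otherwise the good of a pair of maximum `key` moves to the agent, who gets the mark `f`. -/
def IsStep (n m : ℕ) (R : ℕ → ℕ → Prop) (key : ℕ → ℕ → ℝ) (f : ℕ) (x F x' F' : ℕ → ℕ) : Prop :=
  ((∀ i < n, ∀ j < m, R i j → key i j ≤ 0) ∧ x' = x ∧ F' = F) ∨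
  ∃ i < n, ∃ j < m, R i j ∧ 0 < key i j ∧ (∀ i' < n, ∀ j' < m, R i' j' → key i' j' ≤ key i j) ∧
    x' = Function.update x j i ∧ F' = Function.update F i f

/-- Moves to agents of smaller weight. -/
def downR (η : ℕ → ℝ) (x : ℕ → ℕ) (i j : ℕ) : Prop := η i < η (x j)

/-- Gain of a move to an agent of smaller weight. -/
def downKey (m : ℕ) (η a : ℕ → ℝ) (x : ℕ → ℕ) (i j : ℕ) : ℝ :=
  level m η a x (x j) - a j / η i - level m η a x i

/-- Moves from unmarked agents to agents of at least the same weight. -/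
def upR (η : ℕ → ℝ) (x F : ℕ → ℕ) (i j : ℕ) : Prop := ¬ η i < η (x j) ∧ F (x j) < 1

/-- Gain of a move to an agent of at least the same weight. -/
def upKey (m : ℕ) (η a : ℕ → ℝ) (x : ℕ → ℕ) (i j : ℕ) : ℝ :=
  level m η a x (x j) - a j / η (x j) - level m η a x i

/-- Every owner is an agent and every agent has a bundle of positive value. -/
structure Good (n m : ℕ) (a : ℕ → ℝ) (x : ℕ → ℕ) : Prop where
  lt : ∀ j < m, x j < n
  pos : ∀ i < n, 0 < val m a x i

theorem Good.update (hη : ∀ i < n, 0 < η i) (ha : ∀ j < m, 0 ≤ a j) (hx : Good n m a x)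
    {i j : ℕ} (hi : i < n) (hj : j < m)
    (h : level m η a x i + a j / min (η i) (η (x j)) < level m η a x (x j)) :
    Good n m a (Function.update x j i) ∧
      nash n m η a x ≤ nash n m η a (Function.update x j i) := by
  obtain ⟨h1, h2⟩ := nash_le_nash_update hη ha hx.lt hx.pos hi hj h
  refine ⟨⟨fun l hl => ?_, h2⟩, h1⟩
  by_cases hlj : l = j
  · subst hlj; simpa using hi
  · rw [Function.update_of_ne hlj]; exact hx.lt l hl

/-- No good should move to an agent of smaller weight. -/
def DownStable (n m : ℕ) (η a : ℕ → ℝ) (x : ℕ → ℕ) : Prop :=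
  ∀ i < n, ∀ j < m, η i < η (x j) → level m η a x (x j) ≤ level m η a x i + a j / η i

/-- The number of agents of smaller weight than the owner, summed over all goods. -/
def downPotential (n m : ℕ) (η : ℕ → ℝ) (x : ℕ → ℕ) : ℕ :=
  ∑ j ∈ range m, #{i ∈ range n | η i < η (x j)}

theorem downPotential_le : downPotential n m η x ≤ m * n := by
  calc downPotential n m η x ≤ ∑ _j ∈ range m, n :=
        sum_le_sum fun j _ => (card_filter_le _ _).trans (by simp)
    _ = m * n := by simp

/-- Every agent lighter than `i` is lighter than the old owner, and `i` itself is lighter than the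
old owner only. -/
theorem downPotential_update {i j : ℕ} (hi : i < n) (hj : j < m) (h : η i < η (x j)) :
    downPotential n m η (Function.update x j i) < downPotential n m η x := by
  refine sum_lt_sum (fun l _ => ?_) ⟨j, mem_range.2 hj, ?_⟩
  · by_cases hlj : l = j
    · subst hlj
      rw [Function.update_self]
      exact card_le_card fun k hk => by
        simp only [mem_filter] at hk ⊢
        exact ⟨hk.1, hk.2.trans h⟩
    · rw [Function.update_of_ne hlj]
  · rw [Function.update_self]
    refine card_lt_card ⟨fun k hk => ?_, fun hs => ?_⟩
    · simp only [mem_filter] at hk ⊢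
      exact ⟨hk.1, hk.2.trans h⟩
    · have := hs (mem_filter.2 ⟨mem_range.2 hi, h⟩)
      simp at this

/-- The situation after `t` rounds of moves to agents of smaller weight, starting from `x₀`. -/
structure DownInv (n m : ℕ) (η a : ℕ → ℝ) (x₀ : ℕ → ℕ) (t : ℕ) (x : ℕ → ℕ) : Prop where
  good : Good n m a x
  le : nash n m η a x₀ ≤ nash n m η a x
  or : DownStable n m η a x ∨ downPotential n m η x + t ≤ m * n

theorem Good.downInv (h : Good n m a x) : DownInv n m η a x 0 x :=
  ⟨h, le_rfl, .inr (by simpa using downPotential_le)⟩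

/-- An idle round certifies stability, after which no move can occur; any other round pays for
itself with a drop of the potential. -/
theorem DownInv.step (hη : ∀ i < n, 0 < η i) (ha : ∀ j < m, 0 ≤ a j) {x₀ F x' F' : ℕ → ℕ} {t f : ℕ}
    (h : DownInv n m η a x₀ t x)
    (hstep : IsStep n m (downR η x) (downKey m η a x) f x F x' F') :
    DownInv n m η a x₀ (t + 1) x' := by
  obtain ⟨h1, h2, h3⟩ := h
  rcases hstep with ⟨hs, rfl, _⟩ | ⟨i, hi, j, hj, hR, hk, _, rfl, _⟩
  · refine ⟨h1, h2, .inl fun i hi j hj hij => ?_⟩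
    have := hs i hi j hj hij
    unfold downKey at this
    linarith
  · have hlt : level m η a x i + a j / min (η i) (η (x j)) < level m η a x (x j) := by
      rw [min_eq_left (le_of_lt hR)]
      unfold downKey at hk
      linarith
    obtain ⟨g1, g2⟩ := h1.update hη ha hi hj hlt
    refine ⟨g1, h2.trans g2, .inr ?_⟩
    rcases h3 with h3 | h3
    · have := h3 i hi j hj hR
      rw [min_eq_left (le_of_lt hR)] at hlt
      linarith
    · have := downPotential_update hi hj hR
      omega

/-- After `m * n` rounds of moves to agents of smaller weight, none is left. -/
theorem DownInv.stable {x₀ : ℕ → ℕ} (h : DownInv n m η a x₀ (m * n) x) : DownStable n m η a x := by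
  rcases h.or with h3 | h3
  · exact h3
  · intro i hi j hj hij
    exfalso
    have := downPotential_update (x := x) hi hj hij
    omega

/-- The invariant of the moves to agents of at least the same weight, with marked agents `F`. -/
structure UpInv (n m : ℕ) (η a : ℕ → ℝ) (x F : ℕ → ℕ) : Prop where
  good : Good n m a x
  down : ∀ i < n, ∀ j < m, F (x j) < 1 → η i < η (x j) →
    level m η a x (x j) ≤ level m η a x i + a j / η i
  marked : ∀ i < n, ¬ F i < 1 → ∃ j < m, x j = i ∧
    ∀ k < n, level m η a x i ≤ level m η a x k + a j / min (η k) (η i)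

/-- Only the donor `x j` falls and only the receiver `i` rises. The donor's new level still exceeds
the old level of `i`, and maximality compares every other admissible move to `i` with this level.
The moved good is the witness for the newly marked receiver. -/
theorem UpInv.update (hη : ∀ i < n, 0 < η i) (ha : ∀ j < m, 0 ≤ a j) {F : ℕ → ℕ}
    (hx : UpInv n m η a x F) {i j : ℕ} (hi : i < n) (hj : j < m) (hR : upR η x F i j)
    (hk : 0 < upKey m η a x i j)
    (hmax : ∀ i' < n, ∀ j' < m, upR η x F i' j' → upKey m η a x i' j' ≤ upKey m η a x i j) :
    UpInv n m η a (Function.update x j i) (Function.update F i 1) ∧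
      nash n m η a x ≤ nash n m η a (Function.update x j i) := by
  obtain ⟨hw, hF⟩ := hR
  have hw := not_lt.1 hw
  have hh : x j < n := hx.good.lt j hj
  have hηi := hη i hi
  have hηh := hη _ hh
  unfold upKey at hk
  have haj := ha j hj
  have hne : i ≠ x j := by
    rintro h
    have : 0 ≤ a j / η (x j) := div_nonneg haj hηh.le
    rw [← h] at hk this
    linarith
  obtain ⟨g1, g2⟩ := hx.good.update hη ha hi hj (by rw [min_eq_right hw]; linarith)
  refine ⟨⟨g1, ?_, ?_⟩, g2⟩
  all_goals
    have Li : level m η a (Function.update x j i) i = level m η a x i + a j / η i := by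
      unfold level; rw [val_update hj, if_pos rfl, if_neg hne.symm, sub_zero, add_div]
    have Lh : level m η a (Function.update x j i) (x j) =
        level m η a x (x j) - a j / η (x j) := by
      unfold level; rw [val_update hj, if_pos rfl, if_neg hne, add_zero, sub_div]
    have Lo : ∀ k, k ≠ i → k ≠ x j →
        level m η a (Function.update x j i) k = level m η a x k := by
      intro k h1 h2
      unfold level; rw [val_update hj, if_neg h1.symm, if_neg h2.symm, sub_zero, add_zero]
    have Lge : ∀ k, k ≠ x j → k < n →
        level m η a x k ≤ level m η a (Function.update x j i) k := by
      intro k h2 hkn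
      by_cases h1 : k = i
      · subst h1; rw [Li]; have := div_nonneg haj hηi.le; linarith
      · rw [Lo k h1 h2]
    -- For the fixed good `j`, maximality makes `i` lowest in level among the agents at least as
    -- heavy as the donor.
    have hlow : ∀ k < n, η (x j) ≤ η k → level m η a x i ≤ level m η a x k := by
      intro k hkn hk'
      have := hmax k hkn j hj ⟨not_lt.2 hk', hF⟩
      unfold upKey at this
      linarith
  · intro k hkn l hl hFl hkl
    by_cases hlj : l = j
    · subst hlj
      simp at hFl
    · rw [Function.update_of_ne hlj] at hFl hkl ⊢
      have hxl : x l < n := hx.good.lt l hl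
      have hxli : x l ≠ i := by rintro h; rw [h, Function.update_self] at hFl; omega
      rw [Function.update_of_ne hxli] at hFl
      have hle : level m η a (Function.update x j i) (x l) ≤ level m η a x (x l) := by
        by_cases h : x l = x j
        · rw [h, Lh]; have := div_nonneg haj hηh.le; linarith
        · rw [Lo _ hxli h]
      -- Only the donor has fallen. If `i` is lighter than the owner of `l`, the old bound for `i`
      -- passes to the donor, which is still above `i`. Otherwise `(i, l)` competed with `(i, j)`,
      -- and maximality bounds it by the donor's new level.
      by_cases hkh : k = x j
      · subst hkh
        rw [Lh]
        have hal := ha l hl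
        by_cases hil : η i < η (x l)
        · have h1 := hx.down i hi l hl hFl hil
          have h2 : a l / η i ≤ a l / η (x j) := div_le_div_of_nonneg_left hal hηh hw
          linarith
        · have h1 := hmax i hi l hl ⟨hil, hFl⟩
          unfold upKey at h1
          have h2 : a l / η (x l) ≤ a l / η (x j) := div_le_div_of_nonneg_left hal hηh hkl.le
          linarith
      · have h1 := hx.down k hkn l hl hFl hkl
        have h2 := Lge k hkh hkn
        linarith
  · intro i2 hi2 hF2
    by_cases h2i : i2 = i
    · subst h2i
      refine ⟨j, hj, Function.update_self .., fun k hkn => ?_⟩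
      rw [Li]
      by_cases hki : k = i2
      · subst hki; rw [Li]
        have : 0 ≤ a j / min (η k) (η k) := by rw [min_self]; exact div_nonneg haj hηi.le
        linarith
      by_cases hkh : k = x j
      · subst hkh
        rw [Lh, min_eq_left hw]
        have : a j / η i2 ≤ a j / η (x j) := div_le_div_of_nonneg_left haj hηh hw
        linarith
      rw [Lo k hki hkh]
      have hηk := hη k hkn
      by_cases hkw : η (x j) ≤ η k
      · have h1 := hlow k hkn hkw
        have h2 : a j / η i2 ≤ a j / min (η k) (η i2) :=
          div_le_div_of_nonneg_left haj (lt_min hηk hηi) (min_le_right _ _)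
        linarith
      -- An agent lighter than the donor was within one good `j` of the donor's old level, and that
      -- level dominates the receiver's new one.
      · have hkw := not_le.1 hkw
        have h1 := hx.down k hkn j hj hF hkw
        rw [min_eq_left (hkw.le.trans hw)]
        have h2 : a j / η i2 ≤ a j / η (x j) := div_le_div_of_nonneg_left haj hηh hw
        linarith
    · rw [Function.update_of_ne h2i] at hF2
      obtain ⟨l, hl, hl', hl2⟩ := hx.marked i2 hi2 hF2
      -- The donor is unmarked, so a marked agent keeps its witness good.
      have h2h : i2 ≠ x j := by rintro rfl; exact hF2 hF
      refine ⟨l, hl, ?_, fun k hkn => ?_⟩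
      · rw [Function.update_of_ne]
        · exact hl'
        · rintro rfl; exact h2h hl'.symm
      · rw [Lo i2 h2i h2h]
        by_cases hkh : k = x j
        · subst hkh
          rw [Lh]
          have h1 := hl2 i hi
          have h2 : a l / min (η i) (η i2) ≤ a l / min (η (x j)) (η i2) :=
            div_le_div_of_nonneg_left (ha l hl) (lt_min hηh (hη _ hi2)) (min_le_min_right _ hw)
          linarith
        · have h1 := hl2 k hkn
          have h2 := Lge k hkh hkn
          linarith

/-- The good `j` leaves an unmarked agent for a marked one, and marking `i` can only remove further
goods from the set. -/
theorem card_unmarked_update {F : ℕ → ℕ} {i j : ℕ} (hj : j < m) (hF : F (x j) < 1) :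
    #{l ∈ range m | Function.update F i 1 (Function.update x j i l) < 1} <
      #{l ∈ range m | F (x l) < 1} := by
  refine card_lt_card ⟨fun l hl => ?_, fun hs => ?_⟩
  · simp only [mem_filter] at hl ⊢
    refine ⟨hl.1, ?_⟩
    have h2 := hl.2
    by_cases hlj : l = j
    · subst hlj; simp at h2
    · rw [Function.update_of_ne hlj] at h2
      by_cases hli : x l = i
      · rw [hli] at h2; simp at h2
      · rwa [Function.update_of_ne hli] at h2
  · have := hs (mem_filter.2 ⟨mem_range.2 hj, hF⟩)
    simp at this

theorem exists_good_of_pos {i : ℕ} (h : 0 < val m a x i) : ∃ j < m, x j = i := by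
  by_contra hc
  push Not at hc
  have : val m a x i = 0 := sum_eq_zero fun j hj => if_neg (hc j (mem_range.1 hj))
  linarith

/-- The situation after `t` rounds of moves to agents of at least the same weight, starting from
`x₀`. -/
structure UpRounds (n m : ℕ) (η a : ℕ → ℝ) (x₀ : ℕ → ℕ) (t : ℕ) (x F : ℕ → ℕ) : Prop where
  inv : UpInv n m η a x F
  le : nash n m η a x₀ ≤ nash n m η a x
  or : (∀ i < n, ∀ j < m, upR η x F i j → upKey m η a x i j ≤ 0) ∨
    #{l ∈ range m | F (x l) < 1} + t ≤ m

theorem DownStable.upRounds (hd : DownStable n m η a x) (h : Good n m a x) {F : ℕ → ℕ}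
    (hF : ∀ i < n, F i = 0) : UpRounds n m η a x 0 x F := by
  refine ⟨⟨h, fun i hi j hj _ hij => hd i hi j hj hij, fun i hi h => ?_⟩, le_rfl, .inr ?_⟩
  · exact absurd (hF i hi) (by omega)
  · simpa using card_filter_le (range m) _

theorem UpRounds.step (hη : ∀ i < n, 0 < η i) (ha : ∀ j < m, 0 ≤ a j) {x₀ F x' F' : ℕ → ℕ} {t : ℕ}
    (h : UpRounds n m η a x₀ t x F)
    (hstep : IsStep n m (upR η x F) (upKey m η a x) 1 x F x' F') :
    UpRounds n m η a x₀ (t + 1) x' F' := by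
  obtain ⟨h1, h2, h3⟩ := h
  rcases hstep with ⟨hs, rfl, rfl⟩ | ⟨i, hi, j, hj, hR, hk, hmax, rfl, rfl⟩
  · exact ⟨h1, h2, .inl hs⟩
  · obtain ⟨g1, g2⟩ := h1.update hη ha hi hj hR hk hmax
    refine ⟨g1, h2.trans g2, .inr ?_⟩
    rcases h3 with h3 | h3
    · exact absurd (h3 i hi j hj hR) (not_le.2 hk)
    · have := card_unmarked_update (x := x) (F := F) (i := i) hj hR.2
      omega

/-- After `m` rounds the allocation is envy-free up to one good. -/
theorem UpRounds.wwef1 {x₀ F : ℕ → ℕ} (h : UpRounds n m η a x₀ m x F) :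
    ∀ i < n, ∀ h < n, ∃ j < m, x j = h ∧
      level m η a x h - a j / min (η i) (η h) ≤ level m η a x i := by
  obtain ⟨h1, h2, h3⟩ := h
  have h4 : ∀ i < n, ∀ j < m, upR η x F i j → upKey m η a x i j ≤ 0 := by
    rcases h3 with h3 | h3
    · exact h3
    · intro i hi j hj hR
      have hz : #{l ∈ range m | F (x l) < 1} = 0 := by omega
      have := (filter_eq_empty_iff.1 (card_eq_zero.1 hz)) (mem_range.2 hj)
      exact absurd hR.2 this
  intro i hi h hh
  -- For an unmarked owner every good is a witness, and positive value guarantees that there is one.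
  -- A marked owner carries its witness in the invariant.
  by_cases hF : F h < 1
  · obtain ⟨j, hj, rfl⟩ := exists_good_of_pos (h1.good.pos h hh)
    refine ⟨j, hj, rfl, ?_⟩
    by_cases hw : η i < η (x j)
    · have := h1.down i hi j hj hF hw
      rw [min_eq_left hw.le]
      linarith
    · have := h4 i hi j hj ⟨hw, hF⟩
      unfold upKey at this
      rw [min_eq_right (not_lt.1 hw)]
      linarith
  · obtain ⟨j, hj, hjh, hj2⟩ := h1.marked h hh hF
    refine ⟨j, hj, hjh, ?_⟩
    have := hj2 i hi
    linarith

end NashWelfare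

namespace NashWelfare

open Finset

/-! ## The dynamic program over value classes -/

/-- The goods `j < m` are divided into classes `cl j ≤ p`; those of class `κ` have value `L κ`, and
these values grow by more than a factor `1 + δ`. -/
structure IsClassing (m : ℕ) (δ : ℝ) (r : ℕ → ℝ) (cl : ℕ → ℕ) (L : ℕ → ℝ) (p : ℕ) : Prop where
  le : p ≤ m
  zero : L 0 = 0
  ratio : ∀ κ < p, (1 + δ) * L κ < L (κ + 1)
  cl_le : ∀ j < m, cl j ≤ p
  eq : ∀ j < m, r j = L (cl j)

open Classical in
/-- The number of goods of class `κ` in `S`. -/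
def cnt (m : ℕ) (cl : ℕ → ℕ) (S : ℕ → Prop) (κ : ℕ) : ℕ :=
  ∑ j ∈ range m, if S j ∧ cl j = κ then 1 else 0

open Classical in
/-- The total value of the goods in `S`. -/
def vol (m : ℕ) (r : ℕ → ℝ) (S : ℕ → Prop) : ℝ := ∑ j ∈ range m, if S j then r j else 0

/-- The total value of the goods in `S` of class at most `b`. -/
def low (m : ℕ) (cl : ℕ → ℕ) (r : ℕ → ℝ) (b : ℕ) (S : ℕ → Prop) : ℝ :=
  vol m r fun j => S j ∧ cl j ≤ b

theorem sum_eq_sum_add {M : Type*} [AddCommMonoid M] {f g : ℕ → M} {m j : ℕ} {c : M} (hj : j < m)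
    (hne : ∀ i, i ≠ j → f i = g i) (h : f j = g j + c) :
    ∑ i ∈ range m, f i = ∑ i ∈ range m, g i + c := by
  rw [← add_sum_erase _ f (mem_range.2 hj), ← add_sum_erase _ g (mem_range.2 hj), h,
    sum_congr rfl fun i hi => hne i (ne_of_mem_erase hi)]
  abel

/-! ### Counts and volumes of sets of goods -/

section

variable {m : ℕ} {δ : ℝ} {r : ℕ → ℝ} {cl : ℕ → ℕ} {L : ℕ → ℝ} {p : ℕ} {S T : ℕ → Prop} {b : ℕ}

theorem cnt_mono {κ : ℕ} (h : ∀ j < m, cl j = κ → S j → T j) : cnt m cl S κ ≤ cnt m cl T κ :=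
  sum_le_sum fun j hj => by
    have := h j (mem_range.1 hj)
    split_ifs <;> first | omega | (exfalso; tauto)

theorem cnt_le (κ : ℕ) : cnt m cl S κ ≤ m := by
  calc cnt m cl S κ ≤ ∑ _j ∈ range m, 1 := sum_le_sum fun j _ => by split_ifs <;> omega
    _ = m := by simp

theorem exists_of_cnt_ne_zero {κ : ℕ} (h : cnt m cl S κ ≠ 0) : ∃ j < m, S j ∧ cl j = κ := by
  by_contra hc
  push Not at hc
  exact h (sum_eq_zero fun j hj => if_neg fun h' => hc j (mem_range.1 hj) h'.1 h'.2)

theorem vol_mono (hr : ∀ j < m, 0 ≤ r j) (h : ∀ j < m, S j → T j) : vol m r S ≤ vol m r T :=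
  sum_le_sum fun j hj => by
    have h1 := h j (mem_range.1 hj)
    have h2 := hr j (mem_range.1 hj)
    split_ifs <;> first | linarith | (exfalso; tauto)

theorem vol_congr (h : ∀ j < m, (S j ↔ T j)) : vol m r S = vol m r T :=
  sum_congr rfl fun j hj => by
    have := h j (mem_range.1 hj)
    split_ifs <;> first | rfl | (exfalso; tauto)

theorem vol_nonneg (hr : ∀ j < m, 0 ≤ r j) : 0 ≤ vol m r S :=
  sum_nonneg fun j hj => by
    have h2 := hr j (mem_range.1 hj)
    split_ifs <;> linarith

theorem vol_add_vol (Q : ℕ → Prop) :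
    vol m r (fun j => S j ∧ Q j) + vol m r (fun j => S j ∧ ¬ Q j) = vol m r S := by
  unfold vol
  rw [← sum_add_distrib]
  refine sum_congr rfl fun j _ => ?_
  by_cases hS : S j <;> by_cases hQ : Q j <;> simp [hS, hQ]

/-- Volumes restricted to a union of classes are determined by the class counts. -/
theorem vol_class_congr (hr : ∀ j < m, r j = L (cl j)) (Q : ℕ → Prop)
    (h : ∀ κ, Q κ → cnt m cl S κ = cnt m cl T κ) :
    vol m r (fun j => S j ∧ Q (cl j)) = vol m r (fun j => T j ∧ Q (cl j)) := by
  classical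
  have key : ∀ S : ℕ → Prop, vol m r (fun j => S j ∧ Q (cl j)) =
      ∑ κ ∈ (range m).image cl, if Q κ then (cnt m cl S κ : ℝ) * L κ else 0 := by
    intro S
    have e : ∀ κ, (if Q κ then (cnt m cl S κ : ℝ) * L κ else 0) =
        ∑ j ∈ range m, if cl j = κ then (if S j ∧ Q κ then L κ else 0) else 0 := by
      intro κ
      by_cases hQ : Q κ
      · rw [if_pos hQ]
        unfold cnt
        push_cast
        rw [sum_mul]
        refine sum_congr rfl fun j _ => ?_
        by_cases h1 : cl j = κ <;> by_cases h2 : S j <;> simp [h1, h2, hQ]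
      · rw [if_neg hQ]
        symm
        exact sum_eq_zero fun j _ => by simp [hQ]
    simp_rw [e]
    rw [sum_comm]
    refine sum_congr rfl fun j hj => ?_
    rw [sum_ite_eq, if_pos (mem_image_of_mem _ hj), hr j (mem_range.1 hj)]
    split_ifs <;> rfl
  rw [key, key]
  refine sum_congr rfl fun κ _ => ?_
  split_ifs with hQ
  · rw [h κ hQ]
  · rfl

end

/-! ### Greedy filling of a partial assignment up to a state -/

section

variable (m : ℕ) (r : ℕ → ℝ) (cl : ℕ → ℕ) (b : ℕ) (U : ℝ) (D : ℕ → ℕ)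

/-- The goods assigned by `Y` (value `0` means unassigned). -/
def used (Y : ℕ → ℕ) (j : ℕ) : Prop := Y j ≠ 0

/-- The partial assignment `Y` matches a state: the goods in use of class at most `b` have total
value at most `U`, and `D (κ + 1 - b)` goods of class `κ > b` are in use. -/
def Matches (Y : ℕ → ℕ) : Prop :=
  low m cl r b (used Y) ≤ U ∧
    ∀ κ, b < κ → κ ≤ m → cnt m cl (used Y) κ = D (κ + 1 - b)

/-- Good `j` is added to `Y` when filling up to a state. -/
def Takes (Y : ℕ → ℕ) (j : ℕ) : Prop :=
  Y j = 0 ∧ (if b < cl j then cnt m cl (used Y) (cl j) < D (cl j + 1 - b)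
    else low m cl r b (used Y) + r j ≤ U)

open Classical in
/-- Scan the goods, and give those that still fit into the state to the agent with label `l`. -/
def fill (l : ℕ) (Y : ℕ → ℕ) : ℕ → ℕ → ℕ
  | 0 => Y
  | J + 1 => if Takes m r cl b U D (fill l Y J) J then Function.update (fill l Y J) J l
      else fill l Y J

variable {m r cl b U D} {l : ℕ} {Y : ℕ → ℕ} {L : ℕ → ℝ}

theorem cnt_update {j : ℕ} (hj : j < m) (hY : Y j = 0) (hl : l ≠ 0) (κ : ℕ) :
    cnt m cl (used (Function.update Y j l)) κ =
      cnt m cl (used Y) κ + if cl j = κ then 1 else 0 :=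
  sum_eq_sum_add hj (fun i hi => by unfold used; rw [Function.update_of_ne hi])
    (by simp [used, hY, hl])

theorem vol_update {j : ℕ} (hj : j < m) (hY : Y j = 0) (hl : l ≠ 0) (Q : ℕ → Prop)
    [Decidable (Q j)] :
    vol m r (fun i => used (Function.update Y j l) i ∧ Q i) =
      vol m r (fun i => used Y i ∧ Q i) + if Q j then r j else 0 :=
  sum_eq_sum_add hj (fun i hi => by
    have e : used (Function.update Y j l) i ↔ used Y i := by simp [used, hi]
    split_ifs <;> first | rfl | (exfalso; tauto)) (by simp [used, hY, hl])

theorem low_update {j : ℕ} (hj : j < m) (hY : Y j = 0) (hl : l ≠ 0) :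
    low m cl r b (used (Function.update Y j l)) =
      low m cl r b (used Y) + if cl j ≤ b then r j else 0 :=
  vol_update hj hY hl fun i => cl i ≤ b

theorem fill_of_ne {J j : ℕ} (h : Y j ≠ 0) : fill m r cl b U D l Y J j = Y j := by
  induction J with
  | zero => rfl
  | succ J ih =>
    unfold fill
    split_ifs with hT
    · by_cases hj : j = J
      · subst hj
        exact absurd (ih.symm.trans hT.1) h
      · rw [Function.update_of_ne hj, ih]
    · exact ih

theorem fill_of_le {J j : ℕ} (h : J ≤ j) : fill m r cl b U D l Y J j = Y j := by
  induction J with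
  | zero => rfl
  | succ J ih =>
    unfold fill
    split_ifs with hT
    · rw [Function.update_of_ne (by omega), ih (by omega)]
    · exact ih (by omega)

theorem fill_eq_or (J j : ℕ) : fill m r cl b U D l Y J j = Y j ∨
    (Y j = 0 ∧ fill m r cl b U D l Y J j = l) := by
  by_cases h : Y j = 0
  · induction J with
    | zero => exact .inl rfl
    | succ J ih =>
      unfold fill
      split_ifs with hT
      · by_cases hj : j = J
        · subst hj; exact .inr ⟨h, Function.update_self ..⟩
        · rw [Function.update_of_ne hj]; exact ih
      · exact ih
  · exact .inl (fill_of_ne h)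

/-- Filling up to a state with larger counts and volume reaches it, up to the value of a single
small good. -/
theorem fill_matches (hl : l ≠ 0) {ρ : ℝ}
    (hρ : ∀ j < m, cl j ≤ b → r j ≤ ρ) (hr : ∀ j < m, 0 ≤ r j)
    (h1 : ∀ κ, b < κ → κ ≤ m → cnt m cl (used Y) κ ≤ D (κ + 1 - b))
    (h2 : ∀ κ, b < κ → κ ≤ m → D (κ + 1 - b) ≤ cnt m cl (fun _ => True) κ)
    (h3 : low m cl r b (used Y) ≤ U) :
    Matches m r cl b U D (fill m r cl b U D l Y m) ∧
      (low m cl r b (fun _ => True) ≤ low m cl r b (used (fill m r cl b U D l Y m)) ∨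
        U - ρ < low m cl r b (used (fill m r cl b U D l Y m))) := by
  -- Each class above `b` is either full or exhausted among the goods scanned, and the small goods
  -- are either exhausted or within `ρ` of the bound. The first unassigned small good that is
  -- refused certifies the last alternative, which persists since the volume only grows.
  have key : ∀ J ≤ m,
      (∀ κ, b < κ → κ ≤ m → cnt m cl (used (fill m r cl b U D l Y J)) κ ≤ D (κ + 1 - b)) ∧
      (∀ κ, b < κ → κ ≤ m → cnt m cl (used (fill m r cl b U D l Y J)) κ = D (κ + 1 - b) ∨
        ∀ j < J, cl j = κ → used (fill m r cl b U D l Y J) j) ∧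
      low m cl r b (used (fill m r cl b U D l Y J)) ≤ U ∧
      ((∀ j < J, cl j ≤ b → used (fill m r cl b U D l Y J) j) ∨
        U - ρ < low m cl r b (used (fill m r cl b U D l Y J))) := by
    intro J hJ
    induction J with
    | zero => exact ⟨h1, fun κ _ _ => .inr (by simp), h3, .inl (by simp)⟩
    | succ J ih =>
      obtain ⟨i1, i2, i3, i4⟩ := ih (by omega)
      have hJm : J < m := hJ
      rw [fill]
      split_ifs with hT
      · set Z := fill m r cl b U D l Y J with hZ
        obtain ⟨hZ0, hT⟩ := hT
        have hus : ∀ j, used Z j → used (Function.update Z J l) j := by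
          intro j hj
          by_cases h : j = J
          · subst h; simpa [used] using hl
          · simpa [used, h] using hj
        have hJu : used (Function.update Z J l) J := by simpa [used] using hl
        have hc := fun κ => cnt_update (cl := cl) hJm hZ0 hl κ
        have hw := low_update (cl := cl) (r := r) (b := b) hJm hZ0 hl
        refine ⟨fun κ hb hκ => ?_, fun κ hb hκ => ?_, ?_, ?_⟩
        · rw [hc]
          split_ifs with h
          · subst h
            rw [if_pos hb] at hT
            omega
          · exact i1 κ hb hκ
        · rw [hc]
          split_ifs with h
          · subst h
            rw [if_pos hb] at hT
            rcases i2 _ hb hκ with h | h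
            · omega
            · right
              intro j hj hjκ
              rcases Nat.lt_succ_iff_lt_or_eq.1 hj with h' | h'
              · exact hus j (h j h' hjκ)
              · rwa [h']
          · rcases i2 _ hb hκ with h' | h'
            · left; simpa using h'
            · right
              intro j hj hjκ
              rcases Nat.lt_succ_iff_lt_or_eq.1 hj with h'' | h''
              · exact hus j (h' j h'' hjκ)
              · subst h''; exact absurd hjκ h
        · rw [hw]
          split_ifs with h
          · rwa [if_neg (by omega)] at hT
          · simpa using i3
        · rcases i4 with h | h
          · left
            intro j hj hjb
            rcases Nat.lt_succ_iff_lt_or_eq.1 hj with h' | h'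
            · exact hus j (h j h' hjb)
            · rwa [h']
          · right
            rw [hw]
            have : 0 ≤ if cl J ≤ b then r J else 0 := by
              split_ifs
              exacts [hr J hJm, le_rfl]
            linarith
      · set Z := fill m r cl b U D l Y J with hZ
        unfold Takes at hT
        refine ⟨i1, fun κ hb hκ => ?_, i3, ?_⟩
        · rcases i2 κ hb hκ with h | h
          · exact .inl h
          · by_cases hJκ : cl J = κ
            · by_cases hJ0 : Z J = 0
              · left
                subst hJκ
                have := i1 _ hb hκ
                rw [if_pos hb] at hT
                have := not_and.1 hT hJ0
                omega
              · right
                intro j hj hjκ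
                rcases Nat.lt_succ_iff_lt_or_eq.1 hj with h' | h'
                · exact h j h' hjκ
                · rw [h']; exact hJ0
            · right
              intro j hj hjκ
              rcases Nat.lt_succ_iff_lt_or_eq.1 hj with h' | h'
              · exact h j h' hjκ
              · subst h'; exact absurd hjκ hJκ
        · rcases i4 with h | h
          · by_cases hJb : cl J ≤ b
            · by_cases hJ0 : Z J = 0
              · right
                rw [if_neg (by omega)] at hT
                have h5 := not_and.1 hT hJ0
                have h6 := hρ J hJm hJb
                linarith
              · left
                intro j hj hjκ
                rcases Nat.lt_succ_iff_lt_or_eq.1 hj with h' | h'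
                · exact h j h' hjκ
                · rw [h']; exact hJ0
            · left
              intro j hj hjκ
              rcases Nat.lt_succ_iff_lt_or_eq.1 hj with h' | h'
              · exact h j h' hjκ
              · subst h'; exact absurd hjκ hJb
          · exact .inr h
  obtain ⟨i1, i2, i3, i4⟩ := key m le_rfl
  refine ⟨⟨i3, fun κ hb hκ => ?_⟩, ?_⟩
  · rcases i2 κ hb hκ with h | h
    · exact h
    -- An exhausted class has contributed all its goods, and the state asks for no more than exist.
    · refine le_antisymm (i1 κ hb hκ) ((h2 κ hb hκ).trans ?_)
      exact cnt_mono fun j hj hjκ _ => h j hj hjκ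
  · rcases i4 with h | h
    · left
      exact vol_mono hr fun j hj hj' => ⟨h j hj hj'.2, hj'.2⟩
    · exact .inr h

end

/-- The value given out while filling. -/
def own (m : ℕ) (r : ℕ → ℝ) (Y Z : ℕ → ℕ) : ℝ := vol m r fun j => used Z j ∧ ¬ used Y j

theorem own_eq {m : ℕ} {r : ℕ → ℝ} {Y Z : ℕ → ℕ} (h : ∀ j < m, used Y j → used Z j) :
    own m r Y Z = vol m r (used Z) - vol m r (used Y) := by
  have h1 := vol_add_vol (m := m) (r := r) (S := used Z) (used Y)
  have h2 : vol m r (fun j => used Z j ∧ used Y j) = vol m r (used Y) :=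
    vol_congr fun j hj => ⟨fun h => h.2, fun h' => ⟨h j hj h', h'⟩⟩
  unfold own
  linarith

/-- Digits of numbers in base `B`. -/
def digit (B s d : ℕ) : ℕ := s / B ^ d % B

theorem exists_digits {B : ℕ} (hB : 0 < B) (t : ℕ) (e : ℕ → ℕ) (he : ∀ d, e d < B)
    (he0 : ∀ d, t ≤ d → e d = 0) : ∃ s < B ^ t, ∀ d, digit B s d = e d := by
  induction t generalizing e with
  | zero => exact ⟨0, by simp, fun d => by simp [digit, he0 d]⟩
  | succ t ih =>
    obtain ⟨s, hs, hd⟩ := ih (fun d => e (d + 1)) (fun d => he _) (fun d hd => he0 _ (by omega))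
    refine ⟨e 0 + B * s, ?_, fun d => ?_⟩
    · have h0 := he 0
      have : s + 1 ≤ B ^ t := hs
      calc e 0 + B * s < B + B * s := by omega
        _ = B * (s + 1) := by ring
        _ ≤ B * B ^ t := Nat.mul_le_mul_left _ this
        _ = B ^ (t + 1) := by ring
    · cases d with
      | zero => simp [digit, Nat.mod_eq_of_lt (he 0)]
      | succ d =>
        have := hd d
        unfold digit at this ⊢
        rw [pow_succ', ← Nat.div_div_eq_div_mul, Nat.add_mul_div_left _ _ hB,
          Nat.div_eq_of_lt (he 0), zero_add, this]

/-! ### Geometric growth of the class values and the approximation guarantee -/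

section

variable {m : ℕ} {δ : ℝ} {r : ℕ → ℝ} {cl : ℕ → ℕ} {L : ℕ → ℝ} {p : ℕ}

theorem IsClassing.nonneg (h : IsClassing m δ r cl L p) (hδ : 0 < δ) :
    ∀ κ ≤ p, 0 ≤ L κ ∧ (0 < κ → 0 < L κ) := by
  intro κ hκ
  induction κ with
  | zero => simp [h.zero]
  | succ κ ih =>
    have h1 := (ih (by omega)).1
    have h2 := h.ratio κ hκ
    have : 0 < L (κ + 1) := lt_of_le_of_lt (by positivity) h2
    exact ⟨this.le, fun _ => this⟩

theorem IsClassing.pow_le (h : IsClassing m δ r cl L p) (hδ : 0 < δ) {κ i : ℕ} (hi : κ + i ≤ p) :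
    (1 + δ) ^ i * L κ ≤ L (κ + i) := by
  induction i with
  | zero => simp
  | succ i ih =>
    have h1 := ih (by omega)
    have h2 := h.ratio (κ + i) (by omega)
    calc (1 + δ) ^ (i + 1) * L κ = (1 + δ) * ((1 + δ) ^ i * L κ) := by ring
      _ ≤ (1 + δ) * L (κ + i) := by gcongr
      _ ≤ L (κ + (i + 1)) := h2.le

theorem IsClassing.mono (h : IsClassing m δ r cl L p) (hδ : 0 < δ) {κ κ' : ℕ} (hκ : κ ≤ κ')
    (hp : κ' ≤ p) : L κ ≤ L κ' := by
  obtain ⟨i, rfl⟩ := Nat.exists_eq_add_of_le hκ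
  have h1 := h.pow_le hδ hp
  have h2 := (h.nonneg hδ κ (by omega)).1
  have h3 : (1 : ℝ) ≤ (1 + δ) ^ i := one_le_pow₀ (by linarith)
  nlinarith

/-- The sum of the values of the classes `1, …, b`. -/
def classSum (L : ℕ → ℝ) (b : ℕ) : ℝ := ∑ κ ∈ range b, L (κ + 1)

/-- The class values are dominated by a geometric series ending in `L b`. This is what makes the
accumulated rounding error small compared with the bundle. -/
theorem IsClassing.classSum_le (h : IsClassing m δ r cl L p) {b : ℕ} (hb : b ≤ p) :
    δ * classSum L b ≤ (1 + δ) * L b := by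
  induction b with
  | zero => simp [classSum, h.zero]
  | succ b ih =>
    have h1 := ih (by omega)
    have h2 := h.ratio b hb
    unfold classSum at h1 ⊢
    rw [sum_range_succ]
    nlinarith

theorem IsClassing.classSum_le_mul (h : IsClassing m δ r cl L p) (hδ : 0 < δ) {b : ℕ}
    (hb : b ≤ p) : classSum L b ≤ b * L b := by
  unfold classSum
  calc ∑ κ ∈ range b, L (κ + 1) ≤ ∑ _κ ∈ range b, L b :=
        sum_le_sum fun κ hκ => h.mono hδ (by have := mem_range.1 hκ; omega) hb
    _ = b * L b := by simp

/-- `classSum` is the error budget of the volume digit, one unit `L κ` for each possible threshold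
`κ`. Raising the threshold to `b'` frees a unit that pays for one rounding to a multiple of `L b'`.
-/
theorem IsClassing.classSum_add_le (h : IsClassing m δ r cl L p) (hδ : 0 < δ) {b b' : ℕ}
    (hb : b < b') (hb' : b' ≤ p) : classSum L b + L b' ≤ classSum L b' := by
  obtain ⟨c, rfl⟩ : ∃ c, b' = c + 1 := ⟨b' - 1, by omega⟩
  unfold classSum
  rw [sum_range_succ]
  have := sum_le_sum_of_subset_of_nonneg (range_mono (show b ≤ c by omega))
    (f := fun κ => L (κ + 1)) fun κ hκ _ =>
      (h.nonneg hδ _ (by have := mem_range.1 hκ; omega)).1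
  linarith

theorem low_le_mul (h : IsClassing m δ r cl L p) (hδ : 0 < δ) {b : ℕ} (hb : b ≤ p)
    (S : ℕ → Prop) : low m cl r b S ≤ m * L b := by
  unfold low vol
  have h0 := (h.nonneg hδ b hb).1
  calc _ ≤ ∑ _j ∈ range m, L b := sum_le_sum fun j hj => by
        split_ifs with hS
        · rw [h.eq j (mem_range.1 hj)]
          exact h.mono hδ hS.2 hb
        · exact h0
    _ = m * L b := by simp

/-- The table computed by the dynamic program: `Y k s` assigns goods to the first `k` agents so
that state `s` is matched, and `obj k s` is its objective value, or `0` if there is no entry. -/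
structure IsTable (n m : ℕ) (η' : ℕ → ℝ) (lab : ℕ → ℕ) (r : ℕ → ℝ) (cl : ℕ → ℕ) (L : ℕ → ℝ)
    (B N : ℕ) (obj : ℕ → ℕ → ℝ) (Y : ℕ → ℕ → ℕ → ℕ) : Prop where
  init : obj 0 0 = 1
  matched : ∀ k ≤ n, ∀ s < N, 0 < obj k s →
    Matches m r cl (digit B s 0) (digit B s 1 * L (digit B s 0)) (digit B s) (Y k s)
  step : ∀ k < n, ∀ s < N, ∀ s' < N, 0 < obj k s → ∀ Z : ℕ → ℕ,
    Z = fill m r cl (digit B s' 0) (digit B s' 1 * L (digit B s' 0)) (digit B s') (lab k)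
      (Y k s) m →
    Matches m r cl (digit B s' 0) (digit B s' 1 * L (digit B s' 0)) (digit B s') Z →
    0 < own m r (Y k s) Z → obj k s * own m r (Y k s) Z ^ η' k ≤ obj (k + 1) s'

/-- The bundle values in volume notation. -/
theorem vol_lt_succ (o : ℕ → ℕ) (k : ℕ) :
    vol m r (fun j => o j < k + 1) = vol m r (fun j => o j < k) + val m r o k := by
  classical
  rw [← vol_add_vol (S := fun j => o j < k + 1) (fun j => o j < k)]
  congr 1
  · exact vol_congr fun j _ => by omega
  · exact sum_congr rfl fun j _ => by split_ifs <;> first | rfl | (exfalso; omega)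

open Classical in
/-- The classes treated as small by an agent with bundle value `w`. -/
def smallClass (δ : ℝ) (L : ℕ → ℝ) (p : ℕ) (w : ℝ) : ℕ :=
  Nat.findGreatest (fun κ => L κ < δ ^ 2 * w) p

theorem smallClass_le (w : ℝ) : smallClass δ L p w ≤ p := Nat.findGreatest_le _

/-- Class `0` has value `0` and always qualifies, so the greatest class found does satisfy the
bound. -/
theorem smallClass_lt (hδ : 0 < δ) (h0 : L 0 = 0) {w : ℝ} (hw : 0 < w) :
    L (smallClass δ L p w) < δ ^ 2 * w := by
  classical
  exact Nat.findGreatest_spec (P := fun κ => L κ < δ ^ 2 * w) (Nat.zero_le _)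
    (by rw [h0]; positivity)

theorem le_of_smallClass_lt {w : ℝ} {κ : ℕ} (h : smallClass δ L p w < κ) (hp : κ ≤ p) :
    δ ^ 2 * w ≤ L κ := by
  classical
  exact not_lt.1 (Nat.findGreatest_is_greatest (P := fun κ => L κ < δ ^ 2 * w) h hp)

theorem smallClass_mono (hδ : 0 < δ) (h0 : L 0 = 0) {w w' : ℝ} (hw : 0 < w) (hww : w ≤ w') :
    smallClass δ L p w ≤ smallClass δ L p w' := by
  classical
  exact Nat.le_findGreatest (P := fun κ => L κ < δ ^ 2 * w') (smallClass_le _)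
    (lt_of_lt_of_le (smallClass_lt hδ h0 hw) (by gcongr))

/-- Rounding up to a multiple of `ℓ`. -/
theorem exists_mul_ge {ℓ y : ℝ} (hℓ : 0 < ℓ) (hy : 0 ≤ y) : ∃ z : ℕ, y ≤ z * ℓ ∧ z * ℓ ≤ y + ℓ := by
  refine ⟨⌈y / ℓ⌉₊, ?_, ?_⟩
  · rw [← div_le_iff₀ hℓ]; exact Nat.le_ceil _
  · have := (Nat.ceil_lt_add_one (div_nonneg hy hℓ.le)).le
    rw [← le_div_iff₀ hℓ, add_div, div_self hℓ.ne']
    exact this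

/-- The volume digit of the next state. -/
theorem exists_volume (h : IsClassing m δ r cl L p) (hδ : 0 < δ) {b b' : ℕ} (hbb : b ≤ b')
    (hb' : b' ≤ p) {S T : ℕ → Prop} (hST : ∀ j < m, S j → T j) {z : ℕ}
    (h2 : z * L b ≤ low m cl r b S + classSum L b) :
    ∃ z' : ℕ, z' < 2 * m + 1 ∧ low m cl r b' T ≤ z' * L b' ∧
      z' * L b' ≤ low m cl r b' T + classSum L b' ∧
      z * L b + (low m cl r b' S - low m cl r b S) ≤ z' * L b' := by
  have hr : ∀ j < m, 0 ≤ r j := fun j hj => by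
    rw [h.eq j hj]; exact (h.nonneg hδ _ (h.cl_le j hj)).1
  have hmono : low m cl r b' S ≤ low m cl r b' T :=
    vol_mono hr fun j hj hj' => ⟨hST j hj hj'.1, hj'.2⟩
  -- The unit `L 0` is `0`, but the goods of class `0` are worthless, so the volume digit `0` is
  -- exact.
  rcases Nat.eq_zero_or_pos b' with rfl | hpos
  · obtain rfl : b = 0 := by omega
    have e : ∀ S, low m cl r 0 S = 0 := fun S => by
      have h1 := low_le_mul h hδ (Nat.zero_le p) S
      rw [h.zero, mul_zero] at h1
      exact le_antisymm h1 (vol_nonneg hr)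
    exact ⟨0, by omega, by simp [e], by simp [e, classSum], by simp [e, h.zero]⟩
  · have hL := (h.nonneg hδ b' hb').2 hpos
    suffices H : ∃ z' : ℕ, low m cl r b' T ≤ z' * L b' ∧
        z' * L b' ≤ low m cl r b' T + classSum L b' ∧
        z * L b + (low m cl r b' S - low m cl r b S) ≤ z' * L b' by
      obtain ⟨z', h3, h4, h5⟩ := H
      refine ⟨z', ?_, h3, h4, h5⟩
      -- At most `m` units of volume and at most `m` units of budget: this explains the base `2 * m
      -- + 1` of the digits.
      have h6 := low_le_mul h hδ hb' T
      have h7 := h.classSum_le_mul hδ hb'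
      have h8 : (b' : ℝ) ≤ m := by exact_mod_cast hb'.trans h.le
      have h9 : (z' : ℝ) * L b' ≤ (2 * m) * L b' := by nlinarith
      have h10 := le_of_mul_le_mul_right h9 hL
      have : z' ≤ 2 * m := by exact_mod_cast h10
      omega
    -- With the same threshold, the old bound is kept if it still suffices; otherwise the true
    -- volume is rounded afresh, so errors do not add up over the agents. With a higher threshold,
    -- the inherited error is at most `classSum L b` and the unit freed at `b'` pays for the new
    -- rounding.
    rcases hbb.eq_or_lt with rfl | hlt
    · by_cases hle : low m cl r b T ≤ z * L b
      · exact ⟨z, hle, by linarith, by linarith⟩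
      · obtain ⟨z', h3, h4⟩ := exists_mul_ge hL (vol_nonneg (S := fun j => T j ∧ cl j ≤ b) hr)
        refine ⟨z', h3, h4.trans ?_, ?_⟩
        · have : L b ≤ classSum L b := by
            have := h.classSum_add_le hδ (b := b - 1) (b' := b) (by omega) hb'
            have h0 : 0 ≤ classSum L (b - 1) := sum_nonneg fun κ hκ =>
              (h.nonneg hδ _ (by have := mem_range.1 hκ; omega)).1
            linarith
          unfold low
          linarith
        · unfold low at *
          linarith
    · obtain ⟨z', h3, h4⟩ := exists_mul_ge hL (y := max (low m cl r b' T)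
        (z * L b + (low m cl r b' S - low m cl r b S))) (le_max_of_le_left (vol_nonneg hr))
      refine ⟨z', (le_max_left _ _).trans h3, h4.trans ?_, (le_max_right _ _).trans h3⟩
      have h5 := h.classSum_add_le hδ hlt hb'
      have h6 : max (low m cl r b' T) (z * L b + (low m cl r b' S - low m cl r b S)) ≤
          low m cl r b' T + classSum L b := by
        refine max_le ?_ (by linarith)
        have : 0 ≤ classSum L b := sum_nonneg fun κ hκ =>
          (h.nonneg hδ _ (by have := mem_range.1 hκ; omega)).1
        linarith
      linarith

set_option maxHeartbeats 2000000 in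
/-- The table contains an assignment that is almost as good as any assignment with increasing
bundle values. -/
theorem IsTable.exists_ge {n : ℕ} {η' : ℕ → ℝ} {lab : ℕ → ℕ} {B N K : ℕ} {obj : ℕ → ℕ → ℝ}
    {Y : ℕ → ℕ → ℕ → ℕ} (ht : IsTable n m η' lab r cl L B N obj Y)
    (h : IsClassing m δ r cl L p) (hδ : 0 < δ) (hδ1 : δ < 1 / 2) (hlab : ∀ k, lab k ≠ 0)
    (hη : ∀ k < n, 0 < η' k) (hB : B = 2 * m + 1) (hN : N = B ^ (2 + 2 * K))
    (hK : K = m ∨ 1 < (1 + δ) ^ K * δ) (o : ℕ → ℕ)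
    (hpos : ∀ k < n, 0 < val m r o k)
    (hmono : ∀ i k, i ≤ k → k < n → val m r o i ≤ val m r o k) :
    ∃ s < N, ∏ k ∈ range n, ((1 - 2 * δ) * val m r o k) ^ η' k ≤ obj n s := by
  have hr : ∀ j < m, 0 ≤ r j := fun j hj => by
    rw [h.eq j hj]; exact (h.nonneg hδ _ (h.cl_le j hj)).1
  have hclm : ∀ j < m, cl j ≤ m := fun j hj => (h.cl_le j hj).trans h.le
  have hB0 : 0 < B := by omega
  let bb : ℕ → ℕ := fun k => if k = 0 then 0 else smallClass δ L p (val m r o (k - 1))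
  have hbp : ∀ k, bb k ≤ p := fun k => by
    simp only [bb]; split
    exacts [Nat.zero_le _, smallClass_le _]
  -- The state copies the counts of `o` above the threshold exactly but controls only an upper bound
  -- for the volume below it. The stored assignment may use quite different small goods; only the
  -- value given out at each step enters the objective.
  have key : ∀ k ≤ n, ∃ s < N, digit B s 0 = bb k ∧
      (∀ κ, bb k < κ → κ ≤ m → digit B s (κ + 1 - bb k) = cnt m cl (fun j => o j < k) κ) ∧
      digit B s 1 * L (bb k) ≤ low m cl r (bb k) (fun j => o j < k) + classSum L (bb k) ∧
      ∏ i ∈ range k, ((1 - 2 * δ) * val m r o i) ^ η' i ≤ obj k s := by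
    intro k hk
    induction k with
    | zero =>
      refine ⟨0, by rw [hN]; positivity, by simp [bb, digit], fun κ _ _ => ?_, ?_, ?_⟩
      · simp [digit, cnt]
      · simp only [digit, Nat.zero_div, Nat.zero_mod, Nat.cast_zero, zero_mul]
        exact add_nonneg (vol_nonneg hr) (by simp [bb, classSum])
      · simp [ht.init]
    | succ k ih =>
      obtain ⟨s, hs, d0, dc, dz, dobj⟩ := ih (by omega)
      have hkn : k < n := hk
      set w := val m r o k with hw
      have hwpos : 0 < w := hpos k hkn
      set b := bb k with hb
      have hb' : bb (k + 1) = smallClass δ L p w := by simp [bb, hw]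
      set b' := bb (k + 1) with hb'def
      have hbb : b ≤ b' := by
        rw [hb', hb]
        by_cases hk0 : k = 0
        · simp [bb, hk0]
        · simp only [bb, hk0, if_false]
          exact smallClass_mono hδ h.zero (hpos _ (by omega)) (hmono _ _ (by omega) hkn)
      have hLb' : L b' < δ ^ 2 * w := by rw [hb']; exact smallClass_lt hδ h.zero hwpos
      have hST : ∀ j < m, o j < k → o j < k + 1 := fun j _ hj => by omega
      obtain ⟨z', hz', v1, v2, v3⟩ := exists_volume h hδ hbb (hbp (k + 1)) hST dz
      -- the digits of the next state
      obtain ⟨s', hs', hdig⟩ := exists_digits hB0 (2 + 2 * K)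
        (fun d => if d = 0 then b' else if d = 1 then z' else
          cnt m cl (fun j => o j < k + 1) (b' + d - 1))
        (fun d => by
          have h1 := hbp (k + 1)
          have h2 := h.le
          have h3 := cnt_le (m := m) (cl := cl) (S := fun j => o j < k + 1) (b' + d - 1)
          split_ifs <;> omega)
        -- Digits beyond the available ones must vanish. If `K = m` there is no class that high.
        -- Otherwise a good there would be worth more than `((1 + δ) ^ K * δ) ^ 2 * w`-type growth
        -- allows: its value exceeds `w`, although its owner comes no later than `k` and has a
        -- bundle worth at most `w`.
        (fun d hd => by
          rw [if_neg (by omega), if_neg (by omega)]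
          by_contra hne
          obtain ⟨j, hjm, hjo, hjc⟩ := exists_of_cnt_ne_zero hne
          have hclp := h.cl_le j hjm
          rcases hK with hK | hK
          · have := h.le
            omega
          · have h1 : r j ≤ w := by
              refine le_trans ?_ (hmono (o j) k (by omega) hkn)
              unfold val
              have := single_le_sum (s := range m) (f := fun i => if o i = o j then r i else 0)
                (fun i hi => by
                  split
                  exacts [hr i (mem_range.1 hi), le_rfl]) (mem_range.2 hjm)
              simpa using this
            rw [h.eq j hjm] at h1
            have h2 : δ ^ 2 * w ≤ L (b' + 1) :=
              le_of_smallClass_lt (by rw [← hb']; omega) (by omega)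
            have h3 := h.pow_le hδ (κ := b' + 1) (i := K + K) (by omega)
            have h4 := h.mono hδ (κ := b' + 1 + (K + K)) (κ' := cl j) (by omega) hclp
            have h5 : (1 + δ) ^ (K + K) * (δ ^ 2 * w) ≤ (1 + δ) ^ (K + K) * L (b' + 1) := by gcongr
            have h6 : (1 + δ) ^ (K + K) * (δ ^ 2 * w) = ((1 + δ) ^ K * δ) ^ 2 * w := by
              rw [pow_add]; ring
            have h7 : 1 < ((1 + δ) ^ K * δ) ^ 2 := one_lt_pow₀ hK (by norm_num)
            nlinarith)
      have e0 : digit B s' 0 = b' := by simp [hdig]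
      have e1 : digit B s' 1 = z' := by simp [hdig]
      have ec : ∀ κ, b' < κ → digit B s' (κ + 1 - b') = cnt m cl (fun j => o j < k + 1) κ := by
        intro κ hκ
        rw [hdig, if_neg (by omega), if_neg (by omega)]
        congr 1
        omega
      have h2δ : 0 < 1 - 2 * δ := by linarith
      have hobj : 0 < obj k s := lt_of_lt_of_le (prod_pos fun i hi =>
        Real.rpow_pos_of_pos (mul_pos h2δ (hpos i (by have := mem_range.1 hi; omega))) _) dobj
      have hM := ht.matched k (by omega) s hs hobj
      rw [d0] at hM
      obtain ⟨m1, m2⟩ := hM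
      have hcY : ∀ κ, b < κ → cnt m cl (used (Y k s)) κ = cnt m cl (fun j => o j < k) κ := by
        intro κ hκ
        by_cases hκm : κ ≤ m
        · rw [m2 κ hκ hκm, dc κ hκ hκm]
        · have : ∀ S, cnt m cl S κ = 0 := fun S => by
            by_contra hne
            obtain ⟨j, hjm, _, hjc⟩ := exists_of_cnt_ne_zero hne
            have := hclm j hjm
            omega
          rw [this, this]
      have low_split : ∀ S : ℕ → Prop, low m cl r b' S =
          low m cl r b S + vol m r (fun j => S j ∧ (b < cl j ∧ cl j ≤ b')) := by
        intro S
        unfold low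
        rw [← vol_add_vol (S := fun j => S j ∧ cl j ≤ b') (fun j => cl j ≤ b)]
        congr 1
        · exact vol_congr fun j _ => by constructor <;> intro h <;> simp_all; omega
        · exact vol_congr fun j _ => by constructor <;> intro h <;> simp_all
      have vol_split : ∀ S : ℕ → Prop, vol m r S =
          low m cl r b' S + vol m r (fun j => S j ∧ ¬ cl j ≤ b') := fun S => (vol_add_vol _).symm
      -- The classes between the old and the new threshold have equal counts in both assignments, so
      -- they join the small volume without new error.
      have hlowY : low m cl r b' (used (Y k s)) ≤
          z' * L b' ∧ low m cl r b' (used (Y k s)) ≤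
          low m cl r b' (fun j => o j < k) + classSum L b := by
        have hmid := vol_class_congr (m := m) (r := r) (cl := cl) h.eq
          (fun κ => b < κ ∧ κ ≤ b') (fun κ hκ => hcY κ hκ.1)
        have l1 := low_split (used (Y k s))
        have l2 := low_split (fun j => o j < k)
        constructor <;> linarith
      set Z := fill m r cl b' (z' * L b') (digit B s') (lab k) (Y k s) m with hZ
      obtain ⟨f1, f2⟩ := fill_matches (m := m) (r := r) (cl := cl) (b := b') (U := z' * L b')
        (D := digit B s') (l := lab k) (Y := Y k s) (hlab k) (ρ := L b')
        (fun j hj hjb => by rw [h.eq j hj]; exact h.mono hδ hjb (hbp (k + 1))) hr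
        (fun κ hκ hκm => by
          rw [ec κ hκ, hcY κ (by omega)]
          exact cnt_mono fun j hj _ => hST j hj)
        (fun κ hκ hκm => by
          rw [ec κ hκ]
          exact cnt_mono fun j _ _ _ => trivial)
        hlowY.1
      have hcZ : ∀ κ, ¬ κ ≤ b' → cnt m cl (used Z) κ = cnt m cl (fun j => o j < k + 1) κ := by
        intro κ hκ
        by_cases hκm : κ ≤ m
        · rw [f1.2 κ (by omega) hκm, ec κ (by omega)]
        · have : ∀ S, cnt m cl S κ = 0 := fun S => by
            by_contra hne
            obtain ⟨j, hjm, _, hjc⟩ := exists_of_cnt_ne_zero hne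
            have := hclm j hjm
            omega
          rw [this, this]
      -- The value given out is the volume after filling minus the volume before. Classes above `b'`
      -- agree with `o` and contribute exactly. Among the small goods, the excess already in use
      -- costs at most `classSum L b ≤ (1 + δ) * δ * w`, and greedy filling misses at most `L b' < δ
      -- ^ 2 * w`.
      have hown : (1 - 2 * δ) * w ≤ own m r (Y k s) Z := by
        rw [own_eq (fun j _ hj => by unfold used at hj ⊢; rw [hZ, fill_of_ne hj]; exact hj)]
        have g1 := vol_split (used Z)
        have g2 := vol_split (used (Y k s))
        have g3 := vol_split (fun j => o j < k + 1)
        have g4 := vol_split (fun j => o j < k)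
        have g5 := vol_class_congr (m := m) (r := r) (cl := cl) h.eq (fun κ => ¬ κ ≤ b') hcZ
        have g6 := vol_class_congr (m := m) (r := r) (cl := cl) h.eq (fun κ => ¬ κ ≤ b')
          (fun κ hκ => hcY κ (by omega))
        have g7 := vol_lt_succ (m := m) (r := r) o k
        have g8 : low m cl r b' (fun j => o j < k + 1) - L b' ≤ low m cl r b' (used Z) := by
          rcases f2 with f2 | f2
          · have : low m cl r b' (fun j => o j < k + 1) ≤ low m cl r b' (fun _ => True) :=
              vol_mono hr fun j _ hj => ⟨trivial, hj.2⟩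
            have := (h.nonneg hδ b' (hbp (k + 1))).1
            linarith
          · linarith
        have g9 := h.classSum_le (hbp k)
        have g10 := h.mono hδ hbb (hbp (k + 1))
        have g11 : classSum L b ≤ (1 + δ) * δ * w := by
          have : δ * classSum L b ≤ δ * ((1 + δ) * δ * w) := by
            calc δ * classSum L b ≤ (1 + δ) * L b := g9
              _ ≤ (1 + δ) * (δ ^ 2 * w) := by gcongr; linarith
              _ = δ * ((1 + δ) * δ * w) := by ring
          exact le_of_mul_le_mul_left this hδ
        have g12 : (1 + δ) * δ * w + δ ^ 2 * w ≤ 2 * δ * w := by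
          have : 0 ≤ δ * (1 - 2 * δ) * w := by positivity
          nlinarith
        linarith
      refine ⟨s', by rw [hN]; exact hs', e0, fun κ hκ _ => ec κ hκ, by rw [e1]; exact v2, ?_⟩
      have hownpos : 0 < own m r (Y k s) Z := lt_of_lt_of_le (by positivity) hown
      have hstep := ht.step k hkn s hs s' (by rw [hN]; exact hs') hobj Z
        (by rw [e0, e1]) (by rw [e0, e1]; exact f1) hownpos
      rw [prod_range_succ]
      refine le_trans ?_ hstep
      have := hη k hkn
      gcongr
  obtain ⟨s, hs, _, _, _, h5⟩ := key n le_rfl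
  exact ⟨s, hs, h5⟩

end

end NashWelfare

namespace NashWelfare

open Finset RealRAM

/-! ## The program for the local search

Integer arrays: `0` constants (`n`, `m`, the number of states, `m + 2`, the base of the digits),
`1` owners, `4` marks, `10`–`13` counters, `20`, `21` the best pair found. Real arrays: `1` weights,
`2` values of the goods, `5` values of the bundles, `9` the best key found. -/

/-- Compute the values of the bundles. -/
def bundleValues : Stmt :=
  .seq (.loop 10 0 (.setReal 5 (ivar 10) (.ofInt (.const 0))))
    (.loop 11 1 (.setReal 5 (.get 1 (ivar 11)) (.get 5 (.get 1 (ivar 11)) + .get 2 (ivar 11))))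

/-- Find a pair (agent, good) satisfying a test with maximum positive key. -/
def search (test : Test) (key : RealExp) : Stmt :=
  .seq (.setReal 9 (.const 0) (.ofInt (.const 0)))
    (.loop 10 0 (.loop 11 1 (.ite (.and test (.ltReal (rvar 9) key))
      (.seq (.setReal 9 (.const 0) key)
        (.seq (.setInt 20 (.const 0) (ivar 10)) (.setInt 21 (.const 0) (ivar 11)))) .nop)))

/-- Move the good found to the agent found, and mark the agent. -/
def move (f : ℕ) : Stmt :=
  .ite (.ltReal (.ofInt (.const 0)) (rvar 9))
    (.seq (.setInt 1 (ivar 21) (ivar 20)) (.setInt 4 (ivar 20) (.const f))) .nop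

/-- One round of local search. -/
def localStep (test : Test) (key : RealExp) (f : ℕ) : Stmt :=
  .seq bundleValues (.seq (search test key) (move f))

theorem int_setInt_self (s : Mem) (k i a : ℕ) :
    (s.setInt k i a).int k = Function.update (s.int k) i a := by
  ext l; simp [Function.update_apply]

theorem int_setInt_of_ne (s : Mem) {k k' : ℕ} (h : k' ≠ k) (i a : ℕ) :
    (s.setInt k i a).int k' = s.int k' := by
  ext l; simp [h]

theorem real_setReal_of_ne (s : Mem) {k k' : ℕ} (h : k' ≠ k) (i : ℕ) (a : ℝ) :
    (s.setReal k i a).real k' = s.real k' := by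
  ext l; simp [h]

theorem bundleValues_spec (s : Mem) (i : ℕ) (hi : i < s.int 0 0) :
    (bundleValues.run s).real 5 i = val (s.int 0 1) (s.real 2) (s.int 1) i := by
  have h1 : ∀ i < s.int 0 0, ((Stmt.loop 10 0
      (.setReal 5 (ivar 10) (.ofInt (.const 0)))).run s).real 5 i = 0 := by
    refine Stmt.loop_inv (fun k t => ∀ i < k, t.real 5 i = 0) (by simp) ?_
    intro k hk t ht _ _ hinv i hi
    simp only [Stmt.run, IntExp.eval_ivar, RealExp.eval_ofInt, IntExp.eval_const, Nat.cast_zero,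
      Mem.setInt_real, Mem.setReal_real, ht, true_and]
    split_ifs with h
    · rfl
    · exact hinv i (by omega)
  set t := (Stmt.loop 10 0 (.setReal 5 (ivar 10) (.ofInt (.const 0)))).run s with ht
  have f0 : t.int 0 = s.int 0 := Stmt.run_int _ 0 (by decide) s
  have f1 : t.int 1 = s.int 1 := Stmt.run_int _ 1 (by decide) s
  have f2 : t.real 2 = s.real 2 := Stmt.run_real _ 2 (by decide) s
  have h2 : ∀ i < s.int 0 0, ((Stmt.loop 11 1 (.setReal 5 (.get 1 (ivar 11))
      (.get 5 (.get 1 (ivar 11)) + .get 2 (ivar 11)))).run t).real 5 i =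
      val (t.int 0 1) (s.real 2) (s.int 1) i := by
    refine Stmt.loop_inv (fun J u => ∀ i < s.int 0 0, u.real 5 i = val J (s.real 2) (s.int 1) i)
      ?_ ?_
    · intro i hi
      rw [Mem.setInt_real, h1 i hi]
      simp [val]
    · intro J hJ u hu fi fr hinv i hi
      have g1 : u.int 1 = s.int 1 := (fi 1 (by decide)).trans f1
      have g2 : u.real 2 = s.real 2 := (fr 2 (by decide)).trans f2
      have hv : val (J + 1) (s.real 2) (s.int 1) i = val J (s.real 2) (s.int 1) i +
          if s.int 1 J = i then s.real 2 J else 0 := sum_range_succ _ _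
      rw [hv, ← hinv i hi]
      simp only [Stmt.run, IntExp.eval_ivar, RealExp.eval_get, IntExp.eval_get,
        RealExp.eval_add, Mem.setInt_real, Mem.setReal_real, hu, g1, g2, true_and]
      by_cases h : s.int 1 J = i
      · subst h; simp
      · rw [if_neg (Ne.symm h), if_neg h, add_zero]
  rw [f0] at h2
  exact h2 i hi

/-- A test and a key agree with mathematical descriptions in all memories that agree with `s` on
the arrays relevant for the local search. -/
def Describes (s : Mem) (test : Test) (key : RealExp) (R : ℕ → ℕ → Prop) (K : ℕ → ℕ → ℝ) : Prop :=
  ∀ (t : Mem) (i j : ℕ), (∀ k ∈ [0, 1, 4], t.int k = s.int k) →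
    (∀ k ∈ [1, 2, 5], t.real k = s.real k) → t.int 10 0 = i → t.int 11 0 = j →
    i < s.int 0 0 → j < s.int 0 1 → ((test.holds t ↔ R i j) ∧ key.eval t = K i j)

/-- The running maximum starts at `0`, so a final `0` certifies that no admissible pair has positive
key. -/
theorem search_spec (s : Mem) (test : Test) (key : RealExp) {R : ℕ → ℕ → Prop} {K : ℕ → ℕ → ℝ}
    (hd : Describes s test key R K) :
    (∀ i < s.int 0 0, ∀ j < s.int 0 1, R i j → K i j ≤ ((search test key).run s).real 9 0) ∧
    (((search test key).run s).real 9 0 = 0 ∨ 0 < ((search test key).run s).real 9 0 ∧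
      ((search test key).run s).int 20 0 < s.int 0 0 ∧
      ((search test key).run s).int 21 0 < s.int 0 1 ∧
      R (((search test key).run s).int 20 0) (((search test key).run s).int 21 0) ∧
      K (((search test key).run s).int 20 0) (((search test key).run s).int 21 0) =
        ((search test key).run s).real 9 0) := by
  -- The pairs already compared are those lexicographically before `(I, J)`.
  let Inv : ℕ → ℕ → Mem → Prop := fun I J t =>
    (∀ i < s.int 0 0, ∀ j < s.int 0 1, (i < I ∨ i = I ∧ j < J) → R i j → K i j ≤ t.real 9 0) ∧
    (t.real 9 0 = 0 ∨ 0 < t.real 9 0 ∧ t.int 20 0 < s.int 0 0 ∧ t.int 21 0 < s.int 0 1 ∧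
      R (t.int 20 0) (t.int 21 0) ∧ K (t.int 20 0) (t.int 21 0) = t.real 9 0)
  set s1 := (Stmt.setReal 9 (.const 0) (.ofInt (.const 0))).run s with hs1
  have r1 : ∀ k, k ≠ 9 → s1.real k = s.real k := fun k hk => real_setReal_of_ne _ hk _ _
  have i1 : s1.int = s.int := rfl
  have h := Stmt.loop_inv (k := 10) (c := 0) (s := s1)
    (p := .loop 11 1 (.ite (.and test (.ltReal (rvar 9) key))
      (.seq (.setReal 9 (.const 0) key)
        (.seq (.setInt 20 (.const 0) (ivar 10)) (.setInt 21 (.const 0) (ivar 11)))) .nop))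
    (fun I t => Inv I 0 t) ?_ ?_
  · rw [i1] at h
    refine ⟨fun i hi j hj hR => h.1 i hi j hj (.inl hi) hR, h.2⟩
  · refine ⟨fun i _ j _ h => by omega, .inl ?_⟩
    simp [hs1, Stmt.run]
  · intro I hI t ht fi fr hinv
    rw [i1] at hI
    have c1 : t.int 0 = s.int 0 := fi 0 (by simp [Stmt.modInt])
    have h' := Stmt.loop_inv (k := 11) (c := 1) (s := t)
      (p := .ite (.and test (.ltReal (rvar 9) key))
      (.seq (.setReal 9 (.const 0) key)
        (.seq (.setInt 20 (.const 0) (ivar 10)) (.setInt 21 (.const 0) (ivar 11)))) .nop)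
      (fun J u => Inv I J u) ?_ ?_
    · rw [c1] at h'
      refine ⟨fun i hi j hj hij hR => ?_, ?_⟩
      · simp only [Mem.setInt_real]
        exact h'.1 i hi j hj (by omega) hR
      · simpa using h'.2
    · refine ⟨fun i hi j hj hij hR => ?_, ?_⟩
      · exact hinv.1 i hi j hj hij hR
      · simpa using hinv.2
    · intro J hJ u hu fi' fr' hinv'
      rw [c1] at hJ
      have e10 : u.int 10 0 = I := by rw [fi' 10 (by simp [Stmt.modInt]), ht]
      obtain ⟨d1, d2⟩ := hd u I J
        (by
          intro k hk
          have : k ∉ [10, 11, 20, 21] := by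
            simp only [List.mem_cons, List.not_mem_nil, or_false] at hk
            rcases hk with rfl | rfl | rfl <;> decide
          simp only [List.mem_cons, List.not_mem_nil, or_false, not_or] at this
          rw [fi' k (by simp [Stmt.modInt, this]), fi k (by simp [Stmt.modInt, this]), i1])
        (by
          intro k hk
          have : k ≠ 9 := by
            simp only [List.mem_cons, List.not_mem_nil, or_false] at hk
            rcases hk with rfl | rfl | rfl <;> decide
          rw [fr' k (by simpa [Stmt.modReal] using this), fr k (by simpa [Stmt.modReal] using this),
            r1 k this]) e10 hu hI hJ
      simp only [Stmt.run]
      split_ifs with hc <;>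
        rw [Test.holds_and, Test.holds_ltReal, RealExp.eval_rvar, d1, d2] at hc
      · have b0 : 0 < K I J := by
          rcases hinv'.2 with h | h
          · rw [← h]; exact hc.2
          · exact h.1.trans hc.2
        refine ⟨fun i hi j hj hij hR => ?_, .inr ?_⟩
        · simp [d2]
          by_cases hnew : i = I ∧ j = J
          · rw [hnew.1, hnew.2]
          · exact (hinv'.1 i hi j hj (by omega) hR).trans hc.2.le
        · simp [b0, d2, e10, hu, hI, hJ, hc.1]
      · refine ⟨fun i hi j hj hij hR => ?_, ?_⟩
        · simp only [Mem.setInt_real]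
          by_cases hnew : i = I ∧ j = J
          · rw [hnew.1, hnew.2] at hR ⊢
            exact not_lt.1 fun h => hc ⟨hR, h⟩
          · exact hinv'.1 i hi j hj (by omega) hR
        · simpa using hinv'.2

theorem localStep_spec (s : Mem) (test : Test) (key : RealExp) (f : ℕ) {R : ℕ → ℕ → Prop}
    {K : ℕ → ℕ → ℝ} (hd : Describes (bundleValues.run s) test key R K) :
    IsStep (s.int 0 0) (s.int 0 1) R K f (s.int 1) (s.int 4)
      (((localStep test key f).run s).int 1) (((localStep test key f).run s).int 4) := by
  set t := bundleValues.run s with ht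
  have g0 : t.int 0 = s.int 0 := Stmt.run_int _ 0 (by decide) s
  have g1 : t.int 1 = s.int 1 := Stmt.run_int _ 1 (by decide) s
  have g4 : t.int 4 = s.int 4 := Stmt.run_int _ 4 (by decide) s
  obtain ⟨h1, h2⟩ := search_spec t test key hd
  set u := (search test key).run t with hu
  have k1 : u.int 1 = s.int 1 := by
    rw [← g1]; exact Stmt.run_int _ 1 (by simp [search, Stmt.modInt]) t
  have k4 : u.int 4 = s.int 4 := by
    rw [← g4]; exact Stmt.run_int _ 4 (by simp [search, Stmt.modInt]) t
  have hrun : (localStep test key f).run s = (move f).run u := rfl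
  rw [hrun]
  rw [g0] at h1 h2
  simp only [move, Stmt.run, Test.holds_ltReal, RealExp.eval_ofInt, IntExp.eval_const,
    Nat.cast_zero, RealExp.eval_rvar, IntExp.eval_ivar]
  split_ifs with hc
  · right
    rcases h2 with h2 | ⟨_, h3, h4, h5, h6⟩
    · rw [h2] at hc; exact absurd hc (lt_irrefl _)
    · refine ⟨_, h3, _, h4, h5, h6 ▸ hc, fun i hi j hj hR => h6 ▸ h1 i hi j hj hR, ?_, ?_⟩
      · rw [int_setInt_of_ne _ (by decide), int_setInt_self, k1]
      · rw [int_setInt_self, int_setInt_of_ne _ (by decide), int_setInt_of_ne _ (by decide), k4]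
  · left
    have h0 : u.real 9 0 = 0 := by
      rcases h2 with h2 | h2
      · exact h2
      · exact absurd h2.1 hc
    rw [h0] at h1
    exact ⟨h1, k1, k4⟩

/-- Moves to agents of smaller weight. -/
def downStep : Stmt :=
  localStep (.ltReal (.get 1 (ivar 10)) (.get 1 (.get 1 (ivar 11))))
    (.get 5 (.get 1 (ivar 11)) / .get 1 (.get 1 (ivar 11)) - .get 2 (ivar 11) / .get 1 (ivar 10) -
      .get 5 (ivar 10) / .get 1 (ivar 10)) 0

/-- Moves from unmarked agents to agents of at least the same weight. -/
def upStep : Stmt :=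
  localStep (.and (.not (.ltReal (.get 1 (ivar 10)) (.get 1 (.get 1 (ivar 11)))))
      (.ltInt (.get 4 (.get 1 (ivar 11))) (.const 1)))
    (.get 5 (.get 1 (ivar 11)) / .get 1 (.get 1 (ivar 11)) -
      .get 2 (ivar 11) / .get 1 (.get 1 (ivar 11)) - .get 5 (ivar 10) / .get 1 (ivar 10)) 1

theorem downStep_spec (s : Mem) (hx : ∀ j < s.int 0 1, s.int 1 j < s.int 0 0) :
    IsStep (s.int 0 0) (s.int 0 1) (downR (s.real 1) (s.int 1))
      (downKey (s.int 0 1) (s.real 1) (s.real 2) (s.int 1)) 0 (s.int 1) (s.int 4)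
      ((downStep.run s).int 1) ((downStep.run s).int 4) := by
  refine localStep_spec s _ _ _ ?_
  intro t i j hi hr h10 h11 hin hjm
  have c0 : (bundleValues.run s).int 0 = s.int 0 := Stmt.run_int _ 0 (by decide) s
  have c1 : (bundleValues.run s).int 1 = s.int 1 := Stmt.run_int _ 1 (by decide) s
  have d1 : (bundleValues.run s).real 1 = s.real 1 := Stmt.run_real _ 1 (by decide) s
  have d2 : (bundleValues.run s).real 2 = s.real 2 := Stmt.run_real _ 2 (by decide) s
  have e1 := (hi 1 (by simp)).trans c1
  have e2 := (hr 1 (by simp)).trans d1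
  have e3 := (hr 2 (by simp)).trans d2
  have e4 := hr 5 (by simp)
  rw [c0] at hin hjm
  constructor
  · simp [downR, e1, e2, h10, h11]
  · simp [downKey, level, e1, e2, e3, e4, h10, h11, bundleValues_spec s _ (hx j hjm),
      bundleValues_spec s _ hin]

theorem upStep_spec (s : Mem) (hx : ∀ j < s.int 0 1, s.int 1 j < s.int 0 0) :
    IsStep (s.int 0 0) (s.int 0 1) (upR (s.real 1) (s.int 1) (s.int 4))
      (upKey (s.int 0 1) (s.real 1) (s.real 2) (s.int 1)) 1 (s.int 1) (s.int 4)
      ((upStep.run s).int 1) ((upStep.run s).int 4) := by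
  refine localStep_spec s _ _ _ ?_
  intro t i j hi hr h10 h11 hin hjm
  have c0 : (bundleValues.run s).int 0 = s.int 0 := Stmt.run_int _ 0 (by decide) s
  have c1 : (bundleValues.run s).int 1 = s.int 1 := Stmt.run_int _ 1 (by decide) s
  have c4 : (bundleValues.run s).int 4 = s.int 4 := Stmt.run_int _ 4 (by decide) s
  have d1 : (bundleValues.run s).real 1 = s.real 1 := Stmt.run_real _ 1 (by decide) s
  have d2 : (bundleValues.run s).real 2 = s.real 2 := Stmt.run_real _ 2 (by decide) s
  have e1 := (hi 1 (by simp)).trans c1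
  have e5 := (hi 4 (by simp)).trans c4
  have e2 := (hr 1 (by simp)).trans d1
  have e3 := (hr 2 (by simp)).trans d2
  have e4 := hr 5 (by simp)
  rw [c0] at hin hjm
  constructor
  · simp [upR, e1, e2, e5, h10, h11]
  · simp [upKey, level, e1, e2, e3, e4, h10, h11, bundleValues_spec s _ (hx j hjm),
      bundleValues_spec s _ hin]

/-- Local search, first towards smaller and then towards larger weights. -/
def repair : Stmt := .seq (.loop 12 1 (.loop 13 0 downStep)) (.loop 12 1 upStep)

/-- The nested loops give the `m * n` rounds that the potential allows, and `m` further rounds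
exhaust the goods of unmarked agents. The first phase writes only the mark `0`, so the second starts
without marked agents. -/
theorem repair_spec (s : Mem) {n m : ℕ} (hn : s.int 0 0 = n) (hm : s.int 0 1 = m)
    (hη : ∀ i < n, 0 < s.real 1 i) (ha : ∀ j < m, 0 ≤ s.real 2 j)
    (hx : Good n m (s.real 2) (s.int 1)) (hF : ∀ i < n, s.int 4 i = 0) :
    Good n m (s.real 2) ((repair.run s).int 1) ∧
    nash n m (s.real 1) (s.real 2) (s.int 1) ≤
      nash n m (s.real 1) (s.real 2) ((repair.run s).int 1) ∧
    ∀ i < n, ∀ h < n, ∃ j < m, (repair.run s).int 1 j = h ∧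
      level m (s.real 1) (s.real 2) ((repair.run s).int 1) h -
        s.real 2 j / min (s.real 1 i) (s.real 1 h) ≤
        level m (s.real 1) (s.real 2) ((repair.run s).int 1) i := by
  let Inv : ℕ → Mem → Prop := fun T t =>
    DownInv n m (s.real 1) (s.real 2) (s.int 1) T (t.int 1) ∧ ∀ i < n, t.int 4 i = 0
  have hdown : Inv (m * n) ((Stmt.loop 12 1 (.loop 13 0 downStep)).run s) := by
    have := Stmt.loop_inv (k := 12) (c := 1) (s := s) (p := .loop 13 0 downStep)
      (fun I t => Inv (I * n) t) ?_ ?_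
    · rwa [hm] at this
    · simp only [zero_mul]
      exact ⟨hx.downInv, hF⟩
    · intro I hI t ht fi fr hinv
      have c0 : t.int 0 = s.int 0 := fi 0 (by decide)
      have h' := Stmt.loop_inv (k := 13) (c := 0) (s := t) (p := downStep)
        (fun J u => Inv (I * n + J) u) ?_ ?_
      · rw [c0, hn] at h'
        have e : (I + 1) * n = I * n + n := by ring
        rw [e]
        exact h'
      · exact hinv
      · intro J hJ u hu fi' fr' hinv'
        have g0 : u.int 0 = s.int 0 := (fi' 0 (by decide)).trans c0
        have g1 : u.real 1 = s.real 1 := (fr' 1 (by decide)).trans (fr 1 (by decide))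
        have g2 : u.real 2 = s.real 2 := (fr' 2 (by decide)).trans (fr 2 (by decide))
        have hs := downStep_spec u (by rw [g0, hn, hm]; exact hinv'.1.good.lt)
        rw [g0, hn, hm, g1, g2] at hs
        refine ⟨hinv'.1.step hη ha hs, fun i hi => ?_⟩
        rw [int_setInt_of_ne _ (by decide)]
        rcases hs with ⟨_, _, h⟩ | ⟨i', _, j', _, _, _, _, _, h⟩
        · rw [h]; exact hinv'.2 i hi
        · rw [h, Function.update_apply]
          split
          exacts [rfl, hinv'.2 i hi]
  set t := (Stmt.loop 12 1 (.loop 13 0 downStep)).run s with ht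
  have c0 : t.int 0 = s.int 0 := Stmt.run_int _ 0 (by decide) s
  have c1 : t.real 1 = s.real 1 := Stmt.run_real _ 1 (by decide) s
  have c2 : t.real 2 = s.real 2 := Stmt.run_real _ 2 (by decide) s
  have hup : UpRounds n m (s.real 1) (s.real 2) (t.int 1) m ((repair.run s).int 1)
      ((repair.run s).int 4) := by
    have := Stmt.loop_inv (k := 12) (c := 1) (s := t) (p := upStep)
      (fun T u => UpRounds n m (s.real 1) (s.real 2) (t.int 1) T (u.int 1) (u.int 4)) ?_ ?_
    · rwa [c0, hm] at this
    · exact hdown.1.stable.upRounds hdown.1.good hdown.2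
    · intro T hT u hu fi fr hinv
      have g0 : u.int 0 = s.int 0 := (fi 0 (by decide)).trans c0
      have g1 : u.real 1 = s.real 1 := (fr 1 (by decide)).trans c1
      have g2 : u.real 2 = s.real 2 := (fr 2 (by decide)).trans c2
      have hs := upStep_spec u (by rw [g0, hn, hm]; exact hinv.inv.good.lt)
      rw [g0, hn, hm, g1, g2] at hs
      exact hinv.step hη ha hs
  exact ⟨hup.inv.good, hdown.1.le.trans hup.le, hup.wwef1⟩

end NashWelfare

namespace NashWelfare

open Finset RealRAM

/-! ## The program for the dynamic program

Integer arrays: `2` agents by increasing weight, `3` classes of the goods, `6` table of partial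
assignments, `7` current assignment, `8` digits of the target state, `9` class counts of the current
assignment, `23`–`25` auxiliary variables. Real arrays: `3` class values, `4` rounded values of the
goods, `6` table of objective values, `7` volume of the small goods in use, `8` value given out. -/

/-- The number of states. -/
def stateCountE : IntExp := .get 0 (.const 2)

/-- The base of the digits. -/
def baseE : IntExp := .get 0 (.const 4)

/-- The last small class of the target state. -/
def smallE : IntExp := .get 8 (.const 0)

/-- The volume bound of the target state. -/
def volumeE : RealExp := .ofInt (.get 8 (.const 1)) * .get 3 smallE

/-- The class of the current good. -/
def classE : IntExp := .get 3 (ivar 13)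

/-- Index of the source entry in the table. -/
def sourceE : IntExp := ivar 10 * stateCountE + ivar 12

/-- Index of the target entry in the table. -/
def targetE : IntExp := (ivar 10 + .const 1) * stateCountE + ivar 11

/-- Number of goods. -/
def goodsE : IntExp := .get 0 (.const 1)

/-- Compute one digit. -/
def decodeDigit : Stmt :=
  .seq (.setInt 24 (.const 0) (.const 0))
    (.seq (.loop 13 2 (.ite (.not (.ltInt (ivar 23) ((ivar 24 + .const 1) * baseE)))
        (.setInt 24 (.const 0) (ivar 24 + .const 1)) .nop))
      (.seq (.setInt 8 (ivar 12) (ivar 23 - ivar 24 * baseE)) (.setInt 23 (.const 0) (ivar 24))))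

/-- Compute the digits of the target state. -/
def decode : Stmt := .seq (.setInt 23 (.const 0) (ivar 11)) (.loop 12 3 decodeDigit)

/-- Load one good of the source entry. -/
def loadStep : Stmt :=
  .seq (.setInt 7 (ivar 13) (.get 6 (sourceE * goodsE + ivar 13)))
    (.ite (.ltInt (.const 0) (.get 7 (ivar 13)))
      (.ite (.ltInt smallE classE) (.setInt 9 classE (.get 9 classE + .const 1))
        (.setReal 7 (.const 0) (rvar 7 + .get 4 (ivar 13)))) .nop)

/-- Load the source entry. -/
def load : Stmt :=
  .seq (.setReal 7 (.const 0) (.ofInt (.const 0))) (.seq (.setReal 8 (.const 0) (.ofInt (.const 0)))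
    (.seq (.loop 13 3 (.setInt 9 (ivar 13) (.const 0))) (.loop 13 1 loadStep)))

/-- Give the current good to the current agent. -/
def give : Stmt :=
  .seq (.setInt 7 (ivar 13) (.get 2 (ivar 10) + .const 1))
    (.setReal 8 (.const 0) (rvar 8 + .get 4 (ivar 13)))

/-- Decide about one good when filling up to the target state. -/
def fillStep : Stmt :=
  .ite (.ltInt (.get 7 (ivar 13)) (.const 1))
    (.ite (.ltInt smallE classE)
      (.ite (.ltInt (.get 9 classE) (.get 8 (classE + .const 1 - smallE)))
        (.seq (.setInt 9 classE (.get 9 classE + .const 1)) give) .nop)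
      (.ite (.not (.ltReal volumeE (rvar 7 + .get 4 (ivar 13))))
        (.seq (.setReal 7 (.const 0) (rvar 7 + .get 4 (ivar 13))) give) .nop)) .nop

/-- Check one class count. -/
def checkStep : Stmt :=
  .ite (.and (.ltInt smallE (ivar 13 + .const 1))
      (.not (.and (.not (.ltInt (.get 9 (ivar 13 + .const 1))
          (.get 8 (ivar 13 + .const 1 + .const 1 - smallE))))
        (.not (.ltInt (.get 8 (ivar 13 + .const 1 + .const 1 - smallE))
          (.get 9 (ivar 13 + .const 1)))))))
    (.setInt 25 (.const 0) (.const 0)) .nop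

/-- Check whether the target state is matched. -/
def check : Stmt :=
  .seq (.setInt 25 (.const 0) (.const 1))
    (.seq (.ite (.ltReal volumeE (rvar 7)) (.setInt 25 (.const 0) (.const 0)) .nop)
      (.loop 13 1 checkStep))

/-- The objective value of the candidate. -/
def candidateE : RealExp := .get 6 sourceE * .pow (rvar 8) (.get 1 (.get 2 (ivar 10)))

/-- Store the candidate if it matches the target state and improves the table. -/
def store : Stmt :=
  .ite (.and (.ltInt (.const 0) (ivar 25)) (.ltReal (.get 6 targetE) candidateE))
    (.seq (.setReal 6 targetE candidateE)
      (.loop 13 1 (.setInt 6 (targetE * goodsE + ivar 13) (.get 7 (ivar 13))))) .nop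

/-- Extend one table entry to one target state. -/
def extend : Stmt :=
  .ite (.ltReal (.ofInt (.const 0)) (.get 6 sourceE))
    (.seq load (.seq (.loop 13 1 fillStep) (.seq check store))) .nop

/-- The dynamic program. -/
def dynamicProgram : Stmt :=
  .seq (.setReal 6 (.const 0) (.ofInt (.const 1)))
    (.loop 10 0 (.loop 11 2 (.seq decode (.loop 12 2 extend))))

/-- The data available to the dynamic program. -/
structure Env (n m N B : ℕ) (η L r : ℕ → ℝ) (ord cl : ℕ → ℕ) (t : Mem) : Prop where
  agents : t.int 0 0 = n
  goods : t.int 0 1 = m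
  states : t.int 0 2 = N
  digits : t.int 0 3 = m + 2
  base : t.int 0 4 = B
  order : t.int 2 = ord
  class_eq : t.int 3 = cl
  weight : t.real 1 = η
  lead : t.real 3 = L
  rounded : t.real 4 = r

/-! ### Decoding states and loading table entries -/

section

variable {n m N B : ℕ} {η L r : ℕ → ℝ} {ord cl : ℕ → ℕ}

theorem Env.frame {s t : Mem} (h : Env n m N B η L r ord cl s) (h0 : t.int 0 = s.int 0)
    (h2 : t.int 2 = s.int 2) (h3 : t.int 3 = s.int 3) (r1 : t.real 1 = s.real 1)
    (r3 : t.real 3 = s.real 3) (r4 : t.real 4 = s.real 4) : Env n m N B η L r ord cl t := by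
  obtain ⟨a1, a2, a3, a4, a5, a6, a7, a8, a9, a10⟩ := h
  constructor <;> simp only [h0, h2, h3, r1, r3, r4] <;> assumption

theorem Env.run {s : Mem} (h : Env n m N B η L r ord cl s) (p : Stmt) (h0 : 0 ∉ p.modInt)
    (h2 : 2 ∉ p.modInt) (h3 : 3 ∉ p.modInt) (r1 : 1 ∉ p.modReal) (r3 : 3 ∉ p.modReal)
    (r4 : 4 ∉ p.modReal) : Env n m N B η L r ord cl (p.run s) :=
  h.frame (p.run_int 0 h0 s) (p.run_int 2 h2 s) (p.run_int 3 h3 s) (p.run_real 1 r1 s)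
    (p.run_real 3 r3 s) (p.run_real 4 r4 s)

/-- Integer division is not an operation of the machine. The quotient is counted up while its
successor times `B` still fits, and `N` rounds are enough because the number is below `N`. -/
theorem decodeDigit_spec {t : Mem} (E : Env n m N B η L r ord cl t) (hB : 0 < B)
    (hx : t.int 23 0 < N) :
    ((decodeDigit.run t).int 23 0 = t.int 23 0 / B) ∧
    ∀ d, (decodeDigit.run t).int 8 d =
      if d = t.int 12 0 then t.int 23 0 % B else t.int 8 d := by
  set x := t.int 23 0 with hxdef
  set t1 := (Stmt.setInt 24 (.const 0) (.const 0)).run t with ht1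
  have e1 : ∀ k, k ≠ 24 → t1.int k = t.int k := fun k hk => int_setInt_of_ne _ hk _ _
  set t2 := (Stmt.loop 13 2 (.ite (.not (.ltInt (ivar 23) ((ivar 24 + .const 1) * baseE)))
        (.setInt 24 (.const 0) (ivar 24 + .const 1)) .nop)).run t1 with ht2
  have e2 : ∀ k, k ≠ 24 → k ≠ 13 → t2.int k = t.int k := fun k hk hk' => by
    rw [ht2, Stmt.run_int _ k (by simp [Stmt.modInt, hk, hk']), e1 k hk]
  have h24 : t2.int 24 0 = min N (x / B) := by
    have := Stmt.loop_inv (k := 13) (c := 2) (s := t1)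
      (p := .ite (.not (.ltInt (ivar 23) ((ivar 24 + .const 1) * baseE)))
        (.setInt 24 (.const 0) (ivar 24 + .const 1)) .nop)
      (fun q u => u.int 24 0 = min q (x / B)) ?_ ?_
    · rwa [e1 0 (by decide), E.states] at this
    · simp [ht1, Stmt.run]
    · intro q _ u _ fi _ hinv
      have g0 : u.int 0 4 = B := by
        rw [fi 0 (by decide), e1 0 (by decide), E.base]
      have g23 : u.int 23 0 = x := by
        rw [fi 23 (by decide), e1 23 (by decide)]
      simp only [Stmt.run, Test.holds_not, Test.holds_ltInt, IntExp.eval_ivar, IntExp.eval_mul,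
        IntExp.eval_add, IntExp.eval_const, baseE, IntExp.eval_get, g0, g23,
        not_lt]
      have hdiv := Nat.le_div_iff_mul_le hB (x := u.int 24 0 + 1) (y := x)
      split_ifs with hc
      · have := hdiv.2 hc
        simp
        omega
      · have : ¬ u.int 24 0 + 1 ≤ x / B := fun h => hc (hdiv.1 h)
        simp
        omega
  have h24' : t2.int 24 0 = x / B := by
    rw [h24]
    have := Nat.div_le_self x B
    omega
  have hrun : decodeDigit.run t = (Stmt.seq (.setInt 8 (ivar 12) (ivar 23 - ivar 24 * baseE))
      (.setInt 23 (.const 0) (ivar 24))).run t2 := rfl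
  have c0 : t2.int 0 4 = B := by rw [e2 0 (by decide) (by decide), E.base]
  have c12 : t2.int 12 = t.int 12 := e2 12 (by decide) (by decide)
  have c23 : t2.int 23 0 = x := by rw [e2 23 (by decide) (by decide)]
  have c8 : t2.int 8 = t.int 8 := e2 8 (by decide) (by decide)
  rw [hrun]
  refine ⟨by simp [Stmt.run, h24'], fun d => ?_⟩
  simp [Stmt.run, baseE, c0, c12, c23, c8, h24']
  have : x - x / B * B = x % B := by
    have := Nat.div_add_mod x B
    rw [mul_comm] at this
    omega
  rw [this]

theorem decode_spec {t : Mem} (E : Env n m N B η L r ord cl t) (hB : 0 < B)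
    (hx : t.int 11 0 < N) : ∀ d < m + 2, (decode.run t).int 8 d = digit B (t.int 11 0) d := by
  set x := t.int 11 0 with hxdef
  set t1 := (Stmt.setInt 23 (.const 0) (ivar 11)).run t with ht1
  have E1 : Env n m N B η L r ord cl t1 := E.run _ (by decide) (by decide) (by decide) (by decide)
    (by decide) (by decide)
  have := Stmt.loop_inv (k := 12) (c := 3) (s := t1) (p := decodeDigit)
    (fun D u => u.int 23 0 = x / B ^ D ∧ ∀ d < D, u.int 8 d = digit B x d) ?_ ?_
  · rw [E1.digits] at this
    exact this.2
  · simp [ht1, Stmt.run, hxdef]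
  · intro D _ u hu fi fr hinv
    have Eu : Env n m N B η L r ord cl u := E1.frame (fi _ (by decide)) (fi _ (by decide))
      (fi _ (by decide)) (fr _ (by decide)) (fr _ (by decide)) (fr _ (by decide))
    have hle : x / B ^ D ≤ x := Nat.div_le_self _ _
    obtain ⟨h1, h2⟩ := decodeDigit_spec Eu hB (by rw [hinv.1]; omega)
    constructor
    · simp [h1, hinv.1, pow_succ, Nat.div_div_eq_div_mul]
    · intro d hd
      rw [int_setInt_of_ne _ (by decide), h2, hu, hinv.1]
      split_ifs with h
      · subst h; rfl
      · exact hinv.2 d (by omega)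

/-- Entries of an assignment beyond the last good are irrelevant. -/
def mask (m : ℕ) (Y : ℕ → ℕ) (j : ℕ) : ℕ := if j < m then Y j else 0

/-- The row of the table at position `q`. -/
def row (m : ℕ) (t : Mem) (q : ℕ) : ℕ → ℕ := mask m fun j => t.int 6 (q * m + j)

/-- The threshold `int 8 0` belongs to the target state, so counts and small volume of the source
row are recomputed for it instead of being read off the source state. -/
theorem load_spec {t : Mem} (E : Env n m N B η L r ord cl t) {q : ℕ}
    (hq : t.int 10 0 * N + t.int 12 0 = q) :
    (∀ j < m, (load.run t).int 7 j = row m t q j) ∧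
    (∀ κ, t.int 8 0 < κ → κ ≤ m → (load.run t).int 9 κ = cnt m cl (used (row m t q)) κ) ∧
    (load.run t).real 7 0 = low m cl r (t.int 8 0) (used (row m t q)) ∧
    (load.run t).real 8 0 = 0 := by
  set t1 := (Stmt.seq (.setReal 7 (.const 0) (.ofInt (.const 0)))
    (.setReal 8 (.const 0) (.ofInt (.const 0)))).run t with ht1
  set t2 := (Stmt.loop 13 3 (.setInt 9 (ivar 13) (.const 0))).run t1 with ht2
  have a7 : t2.real 7 0 = 0 := by
    rw [ht2, Stmt.run_real _ 7 (by decide)]; simp [ht1, Stmt.run]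
  have a8 : t2.real 8 0 = 0 := by
    rw [ht2, Stmt.run_real _ 8 (by decide)]; simp [ht1, Stmt.run]
  have a9 : ∀ κ < m + 2, t2.int 9 κ = 0 := by
    have := Stmt.loop_inv (k := 13) (c := 3) (s := t1) (p := .setInt 9 (ivar 13) (.const 0))
      (fun J u => ∀ κ < J, u.int 9 κ = 0) (by simp) ?_
    · have e : t1.int 0 3 = m + 2 := E.digits
      rwa [e] at this
    · intro J _ u hu _ _ hinv κ hκ
      simp only [Stmt.run, IntExp.eval_ivar, IntExp.eval_const, hu, Mem.setInt_int]
      simp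
      intro h
      exact hinv κ (by omega)
  have ei : ∀ k, k ≠ 9 → k ≠ 13 → t2.int k = t.int k := fun k h1 h2 => by
    rw [ht2, Stmt.run_int _ k (by simp [Stmt.modInt, h1, h2])]; rfl
  have er : ∀ k, k ≠ 7 → k ≠ 8 → t2.real k = t.real k := fun k h1 h2 => by
    rw [ht2, Stmt.run_real _ k (by simp [Stmt.modReal]), ht1,
      Stmt.run_real _ k (by simp [Stmt.modReal, h1, h2])]
  have E2 : Env n m N B η L r ord cl t2 := E.frame (ei _ (by decide) (by decide))
    (ei _ (by decide) (by decide)) (ei _ (by decide) (by decide)) (er _ (by decide) (by decide))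
    (er _ (by decide) (by decide)) (er _ (by decide) (by decide))
  have hrun : load.run t = (Stmt.loop 13 1 loadStep).run t2 := rfl
  rw [hrun]
  have := Stmt.loop_inv (k := 13) (c := 1) (s := t2) (p := loadStep)
    (fun J u => (∀ j < J, u.int 7 j = row m t q j) ∧
      (∀ κ, t.int 8 0 < κ → κ ≤ m → u.int 9 κ = cnt J cl (used (row m t q)) κ) ∧
      u.real 7 0 = low J cl r (t.int 8 0) (used (row m t q)) ∧ u.real 8 0 = 0) ?_ ?_
  · rwa [E2.goods] at this
  · refine ⟨by simp, fun κ _ hκ => ?_, ?_, by simp [a8]⟩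
    · simpa [cnt] using a9 κ (by omega)
    · simp [low, vol, a7]
  · intro J hJ u hu fi fr ⟨i1, i2, i3, i4⟩
    rw [E2.goods] at hJ
    have Eu : Env n m N B η L r ord cl u := E2.frame (fi _ (by decide)) (fi _ (by decide))
      (fi _ (by decide)) (fr _ (by decide)) (fr _ (by decide)) (fr _ (by decide))
    have g6 : u.int 6 = t.int 6 := (fi 6 (by decide)).trans (ei _ (by decide) (by decide))
    have g8 : u.int 8 = t.int 8 := (fi 8 (by decide)).trans (ei _ (by decide) (by decide))
    have g10 : u.int 10 = t.int 10 := (fi 10 (by decide)).trans (ei _ (by decide) (by decide))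
    have g12 : u.int 12 = t.int 12 := (fi 12 (by decide)).trans (ei _ (by decide) (by decide))
    have hrow : row m t q J = t.int 6 (q * m + J) := by simp [row, mask, hJ]
    have hcnt : ∀ κ, cnt (J + 1) cl (used (row m t q)) κ = cnt J cl (used (row m t q)) κ +
        if row m t q J ≠ 0 ∧ cl J = κ then 1 else 0 := fun κ => by
      unfold cnt
      rw [sum_range_succ]
      congr
    have hlow : low (J + 1) cl r (t.int 8 0) (used (row m t q)) =
        low J cl r (t.int 8 0) (used (row m t q)) +
        if row m t q J ≠ 0 ∧ cl J ≤ t.int 8 0 then r J else 0 := by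
      unfold low vol
      rw [sum_range_succ]
      congr
    have hval : u.int 6 ((u.int 10 0 * N + u.int 12 0) * m + J) = row m t q J := by
      rw [g6, g10, g12, hq, hrow]
    have hrow_zero : ∀ {x : ℕ}, ¬ x = 0 → 0 < x := fun h => Nat.pos_of_ne_zero h
    have hset : ∀ j, (loadStep.run u).int 7 j = if j = J then row m t q J else u.int 7 j := by
      intro j
      by_cases h1 : row m t q J = 0
      · simp [loadStep, Stmt.run, sourceE, goodsE, stateCountE, hu, Eu.states, Eu.goods, hval, h1]
      · by_cases h2 : t.int 8 0 < cl J <;>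
          simp [loadStep, Stmt.run, sourceE, goodsE, stateCountE, classE, smallE, hu, Eu.states,
            Eu.goods, hval, Eu.class_eq, g8, h1, h2, hrow_zero]
    refine ⟨fun j hj => ?_, ?_, ?_, ?_⟩
    · rw [int_setInt_of_ne _ (by decide), hset]
      split_ifs with h
      · rw [h]
      · exact i1 j (by omega)
    · intro κ hκ hκm
      rw [int_setInt_of_ne _ (by decide), hcnt, ← i2 κ hκ hκm]
      by_cases h1 : row m t q J = 0
      · simp [loadStep, Stmt.run, sourceE, goodsE, stateCountE, hu, Eu.states, Eu.goods, hval, h1]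
      · by_cases h2 : t.int 8 0 < cl J
        · by_cases h3 : κ = cl J <;>
            simp [loadStep, Stmt.run, sourceE, goodsE, stateCountE, classE, smallE, hu, Eu.states,
              Eu.goods, hval, Eu.class_eq, g8, h1, h2, h3, eq_comm, hrow_zero]
        · have h3 : cl J ≠ κ := by omega
          simp [loadStep, Stmt.run, sourceE, goodsE, stateCountE, classE, smallE, hu, Eu.states,
            Eu.goods, hval, Eu.class_eq, g8, h1, h2, h3, hrow_zero]
    · rw [Mem.setInt_real, hlow, ← i3]
      by_cases h1 : row m t q J = 0
      · simp [loadStep, Stmt.run, sourceE, goodsE, stateCountE, hu, Eu.states, Eu.goods, hval, h1]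
      · by_cases h2 : t.int 8 0 < cl J <;>
          simp [loadStep, Stmt.run, sourceE, goodsE, stateCountE, classE, smallE, hu, Eu.states,
            Eu.goods, hval, Eu.class_eq, Eu.rounded, g8, h1, h2, not_le.2, not_lt.1, hrow_zero]
    · rw [Mem.setInt_real, Stmt.run_real loadStep 8 (by decide), i4]

end

end NashWelfare

/-! ### One transition: filling, checking and storing -/

namespace NashWelfare

open Finset RealRAM

section

variable {n m N B : ℕ} {η L r : ℕ → ℝ} {ord cl : ℕ → ℕ}

theorem own_update {Y Z : ℕ → ℕ} {j l : ℕ} (hj : j < m) (hZ : Z j = 0) (hY : Y j = 0) (hl : l ≠ 0) :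
    own m r Y (Function.update Z j l) = own m r Y Z + r j := by
  classical
  unfold own
  rw [vol_update hj hZ hl fun i => ¬ used Y i, if_pos (by simp [used, hY])]

theorem own_self (Y : ℕ → ℕ) : own m r Y Y = 0 := by
  unfold own vol
  exact Finset.sum_eq_zero fun j _ => if_neg fun h => h.2 h.1

theorem fillStep_of_takes {u : Mem} (E : Env n m N B η L r ord cl u) {J : ℕ} (hJ : u.int 13 0 = J)
    (h0 : u.int 7 J = 0) (h : if u.int 8 0 < cl J then
      u.int 9 (cl J) < u.int 8 (cl J + 1 - u.int 8 0) else
      u.real 7 0 + r J ≤ u.int 8 1 * L (u.int 8 0)) :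
    (∀ j, (fillStep.run u).int 7 j = if j = J then ord (u.int 10 0) + 1 else u.int 7 j) ∧
    (∀ κ, u.int 8 0 < κ → (fillStep.run u).int 9 κ = u.int 9 κ + if cl J = κ then 1 else 0) ∧
    (fillStep.run u).real 7 0 = u.real 7 0 + (if cl J ≤ u.int 8 0 then r J else 0) ∧
    (fillStep.run u).real 8 0 = u.real 8 0 + r J := by
  by_cases h2 : u.int 8 0 < cl J
  · rw [if_pos h2] at h
    have h3 := not_le.2 h2
    refine ⟨fun j => ?_, fun κ hκ => ?_, ?_, ?_⟩
    · simp [fillStep, give, Stmt.run, classE, smallE, hJ, E.class_eq, E.order, h0, h2, h]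
    · by_cases h4 : κ = cl J <;>
        simp [fillStep, give, Stmt.run, classE, smallE, hJ, E.class_eq, E.order, h0, h2, h, h4,
          eq_comm]
    · simp [fillStep, give, Stmt.run, classE, smallE, hJ, E.class_eq, E.order, h0, h2, h, h3]
    · simp [fillStep, give, Stmt.run, classE, smallE, hJ, E.class_eq, E.order, E.rounded, h0, h2, h]
  · rw [if_neg h2] at h
    have h3 := not_lt.1 h2
    have h4 := not_lt.2 h
    refine ⟨fun j => ?_, fun κ hκ => ?_, ?_, ?_⟩
    · simp [fillStep, give, Stmt.run, classE, smallE, volumeE, hJ, E.class_eq, E.order, E.rounded,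
        E.lead, h0, h2, h4]
    · have h5 : cl J ≠ κ := by omega
      simp [fillStep, give, Stmt.run, classE, smallE, volumeE, hJ, E.class_eq, E.order, E.rounded,
        E.lead, h0, h2, h4, h5]
    · simp [fillStep, give, Stmt.run, classE, smallE, volumeE, hJ, E.class_eq, E.order, E.rounded,
        E.lead, h0, h2, h4, h3]
    · simp [fillStep, give, Stmt.run, classE, smallE, volumeE, hJ, E.class_eq, E.order, E.rounded,
        E.lead, h0, h2, h4]

theorem fillStep_of_not_takes {u : Mem} (E : Env n m N B η L r ord cl u) {J : ℕ}
    (hJ : u.int 13 0 = J)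
    (h : ¬ (u.int 7 J = 0 ∧ if u.int 8 0 < cl J then
      u.int 9 (cl J) < u.int 8 (cl J + 1 - u.int 8 0) else
      u.real 7 0 + r J ≤ u.int 8 1 * L (u.int 8 0))) : fillStep.run u = u := by
  by_cases h0 : u.int 7 J = 0
  · have h := not_and.1 h h0
    by_cases h2 : u.int 8 0 < cl J
    · rw [if_pos h2] at h
      simp [fillStep, Stmt.run, classE, smallE, hJ, E.class_eq, h0, h2, h]
    · rw [if_neg h2] at h
      have h4 := not_le.1 h
      simp [fillStep, Stmt.run, classE, smallE, volumeE, hJ, E.class_eq, E.rounded,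
        E.lead, h0, h2, h4]
  · simp [fillStep, Stmt.run, hJ, h0]

/-- The memory updates counts, small volume and value given out incrementally. Counts at or below
the threshold are not maintained, since `Takes` never looks at them. -/
theorem fillLoop_spec {t : Mem} (E : Env n m N B η L r ord cl t) (hcl : ∀ j < m, cl j ≤ m)
    {Y : ℕ → ℕ} (h7 : ∀ j < m, t.int 7 j = Y j)
    (h9 : ∀ κ, t.int 8 0 < κ → κ ≤ m → t.int 9 κ = cnt m cl (used Y) κ)
    (hr7 : t.real 7 0 = low m cl r (t.int 8 0) (used Y)) (hr8 : t.real 8 0 = 0) {Z : ℕ → ℕ}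
    (hZ : Z = fill m r cl (t.int 8 0) (t.int 8 1 * L (t.int 8 0)) (t.int 8)
      (ord (t.int 10 0) + 1) Y m) :
    (∀ j < m, ((Stmt.loop 13 1 fillStep).run t).int 7 j = Z j) ∧
    (∀ κ, t.int 8 0 < κ → κ ≤ m →
      ((Stmt.loop 13 1 fillStep).run t).int 9 κ = cnt m cl (used Z) κ) ∧
    ((Stmt.loop 13 1 fillStep).run t).real 7 0 = low m cl r (t.int 8 0) (used Z) ∧
    ((Stmt.loop 13 1 fillStep).run t).real 8 0 = own m r Y Z := by
  let T : ℕ → ℕ → ℕ := fill m r cl (t.int 8 0) (t.int 8 1 * L (t.int 8 0)) (t.int 8)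
      (ord (t.int 10 0) + 1) Y
  have := Stmt.loop_inv (k := 13) (c := 1) (s := t) (p := fillStep)
    (fun J u => (∀ j < m, u.int 7 j = T J j) ∧
      (∀ κ, t.int 8 0 < κ → κ ≤ m → u.int 9 κ = cnt m cl (used (T J)) κ) ∧
      u.real 7 0 = low m cl r (t.int 8 0) (used (T J)) ∧ u.real 8 0 = own m r Y (T J)) ?_ ?_
  · rw [E.goods] at this
    rw [hZ]
    exact this
  · exact ⟨h7, h9, hr7, by rw [Mem.setInt_real, hr8]; exact (own_self Y).symm⟩
  · intro J hJ u hu fi fr ⟨i1, i2, i3, i4⟩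
    rw [E.goods] at hJ
    have Eu : Env n m N B η L r ord cl u := E.frame (fi _ (by decide)) (fi _ (by decide))
      (fi _ (by decide)) (fr _ (by decide)) (fr _ (by decide)) (fr _ (by decide))
    have g8 : u.int 8 = t.int 8 := fi 8 (by decide)
    have g10 : u.int 10 = t.int 10 := fi 10 (by decide)
    have hiff : Takes m r cl (t.int 8 0) (t.int 8 1 * L (t.int 8 0)) (t.int 8) (T J) J ↔
        (u.int 7 J = 0 ∧ if u.int 8 0 < cl J then
          u.int 9 (cl J) < u.int 8 (cl J + 1 - u.int 8 0) else
          u.real 7 0 + r J ≤ u.int 8 1 * L (u.int 8 0)) := by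
      unfold Takes
      rw [g8, i1 J hJ, i3]
      by_cases h2 : t.int 8 0 < cl J
      · rw [if_pos h2, if_pos h2, i2 _ h2 (hcl J hJ)]
      · rw [if_neg h2, if_neg h2]
    by_cases hc : Takes m r cl (t.int 8 0) (t.int 8 1 * L (t.int 8 0)) (t.int 8) (T J) J
    · have hT : T (J + 1) = Function.update (T J) J (ord (t.int 10 0) + 1) := by
        simp only [T, fill]
        exact if_pos hc
      obtain ⟨a1, a2⟩ := hiff.1 hc
      obtain ⟨f1, f2, f3, f4⟩ := fillStep_of_takes Eu hu a1 a2
      rw [g8] at f2 f3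
      rw [g10] at f1
      have hTJ : T J J = 0 := hc.1
      have hYJ : Y J = 0 := by
        by_contra h
        exact h ((fill_of_ne h).symm.trans hTJ)
      have hl := Nat.succ_ne_zero (ord (t.int 10 0))
      rw [hT]
      refine ⟨fun j hj => ?_, fun κ hκ hκm => ?_, ?_, ?_⟩
      · rw [int_setInt_of_ne _ (by decide), f1, Function.update_apply, i1 j hj]
      · rw [int_setInt_of_ne _ (by decide), f2 κ hκ, i2 κ hκ hκm, cnt_update hJ hTJ hl]
      · rw [Mem.setInt_real, f3, i3, low_update hJ hTJ hl]
      · rw [Mem.setInt_real, f4, i4, own_update hJ hTJ hYJ hl]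
    · have hT : T (J + 1) = T J := by
        simp only [T, fill]
        exact if_neg hc
      rw [fillStep_of_not_takes Eu hu (fun h => hc (hiff.2 h)), hT]
      refine ⟨fun j hj => ?_, fun κ hκ hκm => ?_, i3, i4⟩
      · rw [int_setInt_of_ne _ (by decide), i1 j hj]
      · rw [int_setInt_of_ne _ (by decide), i2 κ hκ hκm]

/-- Round `J` tests class `J + 1`; class `0` is never above the threshold, so nothing is missed. -/
theorem check_spec {t : Mem} (E : Env n m N B η L r ord cl t) :
    0 < (check.run t).int 25 0 ↔ t.real 7 0 ≤ t.int 8 1 * L (t.int 8 0) ∧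
      ∀ κ, t.int 8 0 < κ → κ ≤ m → t.int 9 κ = t.int 8 (κ + 1 - t.int 8 0) := by
  set t1 := (Stmt.seq (.setInt 25 (.const 0) (.const 1))
    (.ite (.ltReal volumeE (rvar 7)) (.setInt 25 (.const 0) (.const 0)) .nop)).run t with ht1
  have hrun : check.run t = (Stmt.loop 13 1 checkStep).run t1 := rfl
  have e : ∀ k, k ≠ 25 → t1.int k = t.int k := fun k hk => by
    rw [ht1, Stmt.run_int _ k (by simp [Stmt.modInt, hk])]
  have h25 : 0 < t1.int 25 0 ↔ t.real 7 0 ≤ t.int 8 1 * L (t.int 8 0) := by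
    rw [← not_lt]
    by_cases h : (t.int 8 1 : ℝ) * L (t.int 8 0) < t.real 7 0 <;>
      simp [ht1, Stmt.run, volumeE, smallE, E.lead, h]
  rw [hrun]
  have := Stmt.loop_inv (k := 13) (c := 1) (s := t1) (p := checkStep)
    (fun J u => 0 < u.int 25 0 ↔ t.real 7 0 ≤ t.int 8 1 * L (t.int 8 0) ∧
      ∀ κ, t.int 8 0 < κ → κ ≤ J → t.int 9 κ = t.int 8 (κ + 1 - t.int 8 0)) ?_ ?_
  · rwa [e 0 (by decide), E.goods] at this
  · rw [int_setInt_of_ne _ (by decide), h25]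
    constructor
    · exact fun h => ⟨h, fun κ h1 h2 => by omega⟩
    · exact fun h => h.1
  · intro J _ u hu fi _ hinv
    have g8 : u.int 8 = t.int 8 := (fi 8 (by decide)).trans (e 8 (by decide))
    have g9 : u.int 9 = t.int 9 := (fi 9 (by decide)).trans (e 9 (by decide))
    by_cases hc : t.int 8 0 < J + 1 ∧ t.int 9 (J + 1) ≠ t.int 8 (J + 1 + 1 - t.int 8 0)
    · have h0 : (checkStep.run u).int 25 0 = 0 := by
        have : t.int 9 (J + 1) < t.int 8 (J + 1 + 1 - t.int 8 0) ∨
            ¬ t.int 9 (J + 1) ≤ t.int 8 (J + 1 + 1 - t.int 8 0) := by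
          have := hc.2; omega
        rcases this with h | h <;> simp [checkStep, Stmt.run, smallE, hu, g8, g9, hc.1, h]
      rw [int_setInt_of_ne _ (by decide), h0]
      constructor
      · intro h; omega
      · intro h; exact absurd (h.2 (J + 1) hc.1 le_rfl) hc.2
    · have h0 : checkStep.run u = u := by
        by_cases h1 : t.int 8 0 < J + 1
        · have h2 : t.int 9 (J + 1) = t.int 8 (J + 1 + 1 - t.int 8 0) := by
            by_contra h; exact hc ⟨h1, h⟩
          simp [checkStep, Stmt.run, smallE, hu, g8, g9, h2]
        · simp [checkStep, Stmt.run, smallE, hu, g8, h1]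
      rw [h0, int_setInt_of_ne _ (by decide), hinv]
      constructor
      · refine fun h => ⟨h.1, fun κ h1 h2 => ?_⟩
        rcases Nat.le_succ_iff.1 h2 with h3 | h3
        · exact h.2 κ h1 h3
        · subst h3
          by_contra h4
          exact hc ⟨h1, h4⟩
      · exact fun h => ⟨h.1, fun κ h1 h2 => h.2 κ h1 (by omega)⟩

/-- Only `m + 2` digits are decoded. The largest index consulted is `m + 1`, for class `m` and
threshold `0`. -/
theorem fill_congr {b l : ℕ} {U : ℝ} {D D' : ℕ → ℕ} {Y : ℕ → ℕ} (hcl : ∀ j < m, cl j ≤ m)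
    (hD : ∀ d < m + 2, D d = D' d) {J : ℕ} (hJ : J ≤ m) :
    fill m r cl b U D l Y J = fill m r cl b U D' l Y J := by
  induction J with
  | zero => rfl
  | succ J ih =>
    have e : ∀ Z, (Takes m r cl b U D Z J ↔ Takes m r cl b U D' Z J) := by
      intro Z
      unfold Takes
      rw [hD _ (by have := hcl J hJ; omega)]
    by_cases hc : Takes m r cl b U D (fill m r cl b U D' l Y J) J
    · rw [fill, fill, ih (by omega), if_pos hc, if_pos ((e _).1 hc)]
    · rw [fill, fill, ih (by omega), if_neg hc, if_neg fun h => hc ((e _).2 h)]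

theorem matches_congr {b : ℕ} {U : ℝ} {D D' : ℕ → ℕ} {Y : ℕ → ℕ}
    (hD : ∀ d < m + 2, D d = D' d) : Matches m r cl b U D Y ↔ Matches m r cl b U D' Y := by
  unfold Matches
  refine and_congr_right fun _ => forall_congr' fun κ => forall_congr' fun hb =>
    forall_congr' fun hκ => ?_
  rw [hD _ (by omega)]

/-- Row-major addresses do not collide. This serves the layers of the table, its rows of goods, and
the input. -/
theorem mul_add_inj {m p p' j j' : ℕ} (hj : j < m) (hj' : j' < m) (h : p * m + j = p' * m + j') :
    p = p' ∧ j = j' := by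
  have hm : 0 < m := by omega
  have h1 : (p * m + j) / m = p := by
    rw [mul_comm, Nat.mul_add_div hm, Nat.div_eq_of_lt hj, add_zero]
  have h2 : (p' * m + j') / m = p' := by
    rw [mul_comm, Nat.mul_add_div hm, Nat.div_eq_of_lt hj', add_zero]
  have : p = p' := by rw [← h1, ← h2, h]
  subst this
  exact ⟨rfl, by omega⟩

theorem store_spec {t : Mem} (E : Env n m N B η L r ord cl t) {k q q' : ℕ}
    (hk : t.int 10 0 = k) (hq : k * N + t.int 12 0 = q)
    (hq' : (k + 1) * N + t.int 11 0 = q') {o : ℝ}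
    (ho : o = t.real 6 q * if 0 < t.real 8 0 then t.real 8 0 ^ η (ord k) else 0) :
    ((¬ (0 < t.int 25 0 ∧ t.real 6 q' < o)) ∧ store.run t = t) ∨
    ((0 < t.int 25 0 ∧ t.real 6 q' < o) ∧
      (∀ p, (store.run t).real 6 p = if p = q' then o else t.real 6 p) ∧
      ∀ p, row m (store.run t) p = if p = q' then mask m (t.int 7) else row m t p) := by
  have hcand : candidateE.eval t = o := by
    simp [candidateE, sourceE, stateCountE, E.states, E.order, E.weight, hk, hq, ho]
  have htar : targetE.eval t = q' := by simp [targetE, stateCountE, E.states, hk, hq']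
  by_cases hc : 0 < t.int 25 0 ∧ t.real 6 q' < o
  · right
    refine ⟨hc, ?_⟩
    set t1 := t.setReal 6 q' o with ht1
    have hrun : store.run t = (Stmt.loop 13 1 (.setInt 6 (targetE * goodsE + ivar 13)
        (.get 7 (ivar 13)))).run t1 := by
      have hif : (Test.and (.ltInt (.const 0) (ivar 25))
          (.ltReal (.get 6 targetE) candidateE)).holds t := by
        simp [hcand, htar, hc.1, hc.2]
      simp only [store, Stmt.run, hif, if_true, hcand, htar, ht1]
    have E1 : Env n m N B η L r ord cl t1 := E.frame rfl rfl rfl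
      (real_setReal_of_ne _ (by decide) _ _) (real_setReal_of_ne _ (by decide) _ _)
      (real_setReal_of_ne _ (by decide) _ _)
    rw [hrun]
    constructor
    · intro p
      rw [Stmt.run_real _ 6 (by decide)]
      simp [ht1]
    · have hinv := Stmt.loop_inv (k := 13) (c := 1) (s := t1)
        (p := .setInt 6 (targetE * goodsE + ivar 13) (.get 7 (ivar 13)))
        (fun J u => ∀ p, ∀ j < m, u.int 6 (p * m + j) =
          if p = q' ∧ j < J then t.int 7 j else t.int 6 (p * m + j)) ?_ ?_
      · rw [E1.goods] at hinv
        intro p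
        ext j
        unfold row mask
        by_cases hj : j < m
        · simp only [hj, if_true]
          rw [hinv p j hj]
          by_cases hp : p = q' <;> simp [hp, hj]
        · by_cases hp : p = q' <;> simp [hp, hj]
      · intro p j _
        rw [int_setInt_of_ne _ (by decide), if_neg (by omega)]
        rfl
      · intro J hJ u hu fi _ hinv p j hj
        rw [E1.goods] at hJ
        have g0 : u.int 0 = t.int 0 := fi 0 (by decide)
        have g7 : u.int 7 = t.int 7 := fi 7 (by decide)
        have g10 : u.int 10 = t.int 10 := fi 10 (by decide)
        have g11 : u.int 11 = t.int 11 := fi 11 (by decide)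
        rw [int_setInt_of_ne _ (by decide)]
        simp only [Stmt.run, Mem.setInt_int, IntExp.eval_add, IntExp.eval_mul, targetE, goodsE,
          stateCountE, IntExp.eval_get, IntExp.eval_ivar, IntExp.eval_const, g0, g7, g10, g11,
          E.states, E.goods, hk, hu, hq', true_and]
        rw [hinv p j hj]
        by_cases h : p * m + j = q' * m + J
        · obtain ⟨rfl, rfl⟩ := mul_add_inj hj hJ h
          simp
        · rw [if_neg h]
          by_cases hp : p = q'
          · have hjJ : j ≠ J := by rintro rfl; exact h (by rw [hp])
            have : (j < J + 1) ↔ j < J := by omega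
            simp only [this]
          · simp [hp]
  · left
    refine ⟨hc, ?_⟩
    have hif : ¬ (Test.and (.ltInt (.const 0) (ivar 25))
        (.ltReal (.get 6 targetE) candidateE)).holds t := by
      simpa [hcand, htar] using hc
    simp only [store, Stmt.run, hif, if_false]

/-- The assignment obtained by extending `Y` to state `s` for the agent with label `l`. -/
def extension (m B : ℕ) (L r : ℕ → ℝ) (cl : ℕ → ℕ) (l s : ℕ) (Y : ℕ → ℕ) : ℕ → ℕ :=
  fill m r cl (digit B s 0) (digit B s 1 * L (digit B s 0)) (digit B s) l Y m

/-- The partial assignment `Y` matches state `s`. -/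
def MatchesState (m B : ℕ) (L r : ℕ → ℝ) (cl : ℕ → ℕ) (s : ℕ) (Y : ℕ → ℕ) : Prop :=
  Matches m r cl (digit B s 0) (digit B s 1 * L (digit B s 0)) (digit B s) Y

/-- Locality of the write, monotonicity of the entry, dominance over the candidate, and provenance
of a new entry are the facts that the table invariant needs. -/
theorem extend_spec {t : Mem} (E : Env n m N B η L r ord cl t) (hcl : ∀ j < m, cl j ≤ m)
    {k s s' q q' : ℕ} (hk : t.int 10 0 = k) (hs : t.int 12 0 = s) (hs' : t.int 11 0 = s')
    (hq : k * N + s = q) (hq' : (k + 1) * N + s' = q')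
    (hd : ∀ d < m + 2, t.int 8 d = digit B s' d) (hnn : ∀ p, 0 ≤ t.real 6 p) {Z : ℕ → ℕ}
    (hZ : Z = extension m B L r cl (ord k + 1) s' (row m t q)) :
    (∀ p, p ≠ q' → (extend.run t).real 6 p = t.real 6 p ∧
      row m (extend.run t) p = row m t p) ∧
    t.real 6 q' ≤ (extend.run t).real 6 q' ∧
    (0 < t.real 6 q → MatchesState m B L r cl s' Z → 0 < own m r (row m t q) Z →
      t.real 6 q * own m r (row m t q) Z ^ η (ord k) ≤ (extend.run t).real 6 q') ∧
    (((extend.run t).real 6 q' = t.real 6 q' ∧ row m (extend.run t) q' = row m t q') ∨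
      (0 < t.real 6 q ∧ MatchesState m B L r cl s' Z ∧ 0 < own m r (row m t q) Z ∧
        (extend.run t).real 6 q' = t.real 6 q * own m r (row m t q) Z ^ η (ord k) ∧
        row m (extend.run t) q' = Z)) := by
  have hsrc : sourceE.eval t = q := by simp [sourceE, stateCountE, E.states, hk, hs, hq]
  by_cases h0 : 0 < t.real 6 q
  swap
  · have hrun : extend.run t = t := by
      have hif : ¬ (Test.ltReal (.ofInt (.const 0)) (.get 6 sourceE)).holds t := by
        simpa [hsrc] using h0
      simp only [extend, Stmt.run, hif, if_false]
    rw [hrun]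
    exact ⟨fun _ _ => ⟨rfl, rfl⟩, le_rfl, fun h => absurd h h0, .inl ⟨rfl, rfl⟩⟩
  set t1 := load.run t with ht1
  set t2 := (Stmt.loop 13 1 fillStep).run t1 with ht2
  set t3 := check.run t2 with ht3
  have hrun : extend.run t = store.run t3 := by
    have hif : (Test.ltReal (.ofInt (.const 0)) (.get 6 sourceE)).holds t := by
      simpa [hsrc] using h0
    simp only [extend, Stmt.run, hif, if_true, ht1, ht2, ht3]
  have E1 : Env n m N B η L r ord cl t1 := E.run _ (by decide) (by decide) (by decide) (by decide)
    (by decide) (by decide)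
  have E2 : Env n m N B η L r ord cl t2 := E1.run _ (by decide) (by decide) (by decide) (by decide)
    (by decide) (by decide)
  have E3 : Env n m N B η L r ord cl t3 := E2.run _ (by decide) (by decide) (by decide) (by decide)
    (by decide) (by decide)
  obtain ⟨l1, l2, l3, l4⟩ := load_spec E (q := q) (by rw [hk, hs, hq])
  have a8 : t1.int 8 = t.int 8 := Stmt.run_int _ 8 (by decide) t
  have a10 : t1.int 10 = t.int 10 := Stmt.run_int _ 10 (by decide) t
  have hZ' : Z = fill m r cl (t1.int 8 0) (t1.int 8 1 * L (t1.int 8 0)) (t1.int 8)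
      (ord (t1.int 10 0) + 1) (row m t q) m := by
    rw [a8, a10, hk, hZ, extension, hd 0 (by omega), hd 1 (by omega)]
    exact fill_congr hcl (fun d hd' => (hd d hd').symm) le_rfl
  obtain ⟨f1, f2, f3, f4⟩ := fillLoop_spec E1 hcl l1 (by rw [a8]; exact l2) (by rw [a8]; exact l3)
    l4 hZ'
  have b8 : t2.int 8 = t.int 8 := (Stmt.run_int _ 8 (by decide) t1).trans a8
  have hck := check_spec E2
  have hmatch : 0 < t3.int 25 0 ↔ MatchesState m B L r cl s' Z := by
    rw [hck, b8]
    rw [a8] at f2 f3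
    unfold MatchesState
    rw [← hd 0 (by omega), ← hd 1 (by omega),
      ← matches_congr (D := t.int 8) (fun d hd' => hd d hd')]
    unfold Matches
    rw [f3]
    refine and_congr_right fun _ => forall_congr' fun κ => forall_congr' fun hb =>
      forall_congr' fun hκ => ?_
    rw [f2 κ hb hκ]
  have c10 : t3.int 10 0 = k := by
    rw [Stmt.run_int check 10 (by decide), Stmt.run_int _ 10 (by decide), a10, hk]
  have c12 : t3.int 12 0 = s := by
    rw [Stmt.run_int check 12 (by decide), Stmt.run_int _ 12 (by decide),
      Stmt.run_int load 12 (by decide), hs]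
  have c11 : t3.int 11 0 = s' := by
    rw [Stmt.run_int check 11 (by decide), Stmt.run_int _ 11 (by decide),
      Stmt.run_int load 11 (by decide), hs']
  have c6 : t3.real 6 = t.real 6 := by
    rw [Stmt.run_real check 6 (by decide), Stmt.run_real _ 6 (by decide),
      Stmt.run_real load 6 (by decide)]
  have ci6 : t3.int 6 = t.int 6 := by
    rw [Stmt.run_int check 6 (by decide), Stmt.run_int _ 6 (by decide),
      Stmt.run_int load 6 (by decide)]
  have crow : ∀ p, row m t3 p = row m t p := fun p => by unfold row; rw [ci6]
  have c8 : t3.real 8 0 = own m r (row m t q) Z := by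
    rw [Stmt.run_real check 8 (by decide), f4]
  have c7 : mask m (t3.int 7) = Z := by
    ext j
    unfold mask
    split_ifs with hj
    · rw [Stmt.run_int check 7 (by decide), f1 j hj]
    · rw [hZ, extension, fill_of_le (by omega)]
      simp [row, mask, hj]
  have hst := store_spec E3 (q := q) (q' := q') c10 (by rw [c12, hq]) (by rw [c11, hq']) rfl
  rw [hrun]
  rw [c6, c8, c7] at hst
  simp only [crow] at hst
  set w := own m r (row m t q) Z with hw
  rcases hst with ⟨hc, hs1⟩ | ⟨hc, hs1, hs2⟩
  · rw [hs1, c6]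
    refine ⟨fun p _ => ⟨rfl, crow p⟩, le_rfl, fun _ hM hpos => ?_, .inl ⟨rfl, crow q'⟩⟩
    rw [if_pos hpos] at hc
    exact not_lt.1 fun h => hc ⟨hmatch.2 hM, h⟩
  -- A power with nonpositive base counts as `0`, which never improves a nonnegative entry. Hence a
  -- stored candidate gives the agent positive value.
  · have hpos : 0 < w := by
      by_contra h
      rw [if_neg h, mul_zero] at hc
      exact absurd (hnn q') (not_le.2 hc.2)
    rw [if_pos hpos] at hs1 hc
    refine ⟨fun p hp => ⟨by rw [hs1, if_neg hp], by rw [hs2, if_neg hp]⟩, ?_, fun _ _ _ => ?_,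
      .inr ⟨h0, hmatch.1 hc.1, hpos, ?_, ?_⟩⟩
    · rw [hs1, if_pos rfl]; exact hc.2.le
    · rw [hs1, if_pos rfl]
    · rw [hs1, if_pos rfl]
    · rw [hs2, if_pos rfl]

end

end NashWelfare

/-! ### Correctness of the table -/

namespace NashWelfare

open Finset RealRAM

/-- The table in memory is correct, and the transitions `(k, s', s)` from state `s` of layer `k` to
state `s'` in `P` have been taken into account. -/
structure TableInv (m N B : ℕ) (η L r : ℕ → ℝ) (ord cl : ℕ → ℕ) (P : ℕ → ℕ → ℕ → Prop)
    (t : Mem) : Prop where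
  nonneg : ∀ p, 0 ≤ t.real 6 p
  init : t.real 6 0 = 1
  valid : ∀ k s, s < N → 0 < t.real 6 (k * N + s) →
    MatchesState m B L r cl s (row m t (k * N + s)) ∧
    t.real 6 (k * N + s) =
      ∏ i ∈ range k, val m r (row m t (k * N + s)) (ord i + 1) ^ η (ord i) ∧
    ∀ j < m, row m t (k * N + s) j ≠ 0 → ∃ i < k, row m t (k * N + s) j = ord i + 1
  step : ∀ k s' s, P k s' s → s < N → s' < N → 0 < t.real 6 (k * N + s) → ∀ Z,
    Z = extension m B L r cl (ord k + 1) s' (row m t (k * N + s)) →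
    MatchesState m B L r cl s' Z → 0 < own m r (row m t (k * N + s)) Z →
    t.real 6 (k * N + s) * own m r (row m t (k * N + s)) Z ^ η (ord k) ≤
      t.real 6 ((k + 1) * N + s')

section

variable {n m N B : ℕ} {η L r : ℕ → ℝ} {ord cl : ℕ → ℕ} {P Q : ℕ → ℕ → ℕ → Prop}

theorem TableInv.frame {s t : Mem} (h : TableInv m N B η L r ord cl P s) (hi : t.int 6 = s.int 6)
    (hr : t.real 6 = s.real 6) : TableInv m N B η L r ord cl P t := by
  have hrow : ∀ p, row m t p = row m s p := fun p => by unfold row; rw [hi]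
  obtain ⟨a, b, c, d⟩ := h
  constructor <;> simpa only [hr, hrow]

theorem TableInv.mono {t : Mem} (h : TableInv m N B η L r ord cl P t)
    (hQ : ∀ k s' s, s < N → s' < N → Q k s' s → P k s' s) : TableInv m N B η L r ord cl Q t :=
  ⟨h.nonneg, h.init, h.valid, fun k s' s hq hs hs' => h.step k s' s (hQ k s' s hs hs' hq) hs hs'⟩

theorem val_extension_of_ne {Y : ℕ → ℕ} {l l' s : ℕ} (h : l' ≠ l) (h0 : l' ≠ 0) :
    val m r (extension m B L r cl l s Y) l' = val m r Y l' := by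
  unfold val
  refine sum_congr rfl fun j _ => ?_
  rcases fill_eq_or (m := m) (r := r) (cl := cl) (b := digit B s 0)
    (U := digit B s 1 * L (digit B s 0)) (D := digit B s) (l := l) (Y := Y) m j with e | ⟨e, e'⟩
  · unfold extension; rw [e]
  · have e' : extension m B L r cl l s Y j = l := e'
    rw [e', e, if_neg h.symm, if_neg h0.symm]

theorem val_extension_self {Y : ℕ → ℕ} {l s : ℕ} (h0 : l ≠ 0) (h : ∀ j < m, Y j ≠ l) :
    val m r (extension m B L r cl l s Y) l = own m r Y (extension m B L r cl l s Y) := by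
  unfold val own vol
  refine sum_congr rfl fun j hj => ?_
  have hj := h j (mem_range.1 hj)
  rcases fill_eq_or (m := m) (r := r) (cl := cl) (b := digit B s 0)
    (U := digit B s 1 * L (digit B s 0)) (D := digit B s) (l := l) (Y := Y) m j with e | ⟨e, e'⟩
  · have e : extension m B L r cl l s Y j = Y j := e
    rw [if_neg (by rw [e]; exact hj), if_neg fun h => h.2 fun h' => h.1 (e.trans h')]
  · have e' : extension m B L r cl l s Y j = l := e'
    rw [if_pos e', if_pos ⟨e'.trans_ne h0, fun h => h e⟩]

/-- The write goes to layer `k + 1`, while all transitions recorded so far start in layers up to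
`k`. Their sources are unchanged and their targets can only grow, so the recorded inequalities
survive. -/
theorem TableInv.extend {t : Mem} (h : TableInv m N B η L r ord cl P t)
    (E : Env n m N B η L r ord cl t) (hcl : ∀ j < m, cl j ≤ m)
    (hord : ∀ i < n, ∀ i' < n, ord i = ord i' → i = i') {k s s' : ℕ} (hkn : k < n) (hsN : s < N)
    (hsN' : s' < N) (hk : t.int 10 0 = k) (hs : t.int 12 0 = s) (hs' : t.int 11 0 = s')
    (hd : ∀ d < m + 2, t.int 8 d = digit B s' d) (hP : ∀ k1 s1' s1, P k1 s1' s1 → k1 ≤ k) :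
    TableInv m N B η L r ord cl (fun k1 s1' s1 => P k1 s1' s1 ∨ k1 = k ∧ s1' = s' ∧ s1 = s)
      (extend.run t) := by
  obtain ⟨q, hq⟩ : ∃ q, q = k * N + s := ⟨_, rfl⟩
  obtain ⟨q', hq'⟩ : ∃ q', q' = (k + 1) * N + s' := ⟨_, rfl⟩
  obtain ⟨Z, hZ⟩ : ∃ Z, Z = extension m B L r cl (ord k + 1) s' (row m t q) := ⟨_, rfl⟩
  obtain ⟨x1, x2, x3, x4⟩ := extend_spec E hcl hk hs hs' hq.symm hq'.symm hd h.nonneg hZ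
  have hsrc : ∀ k1 s1, k1 ≤ k → s1 < N → k1 * N + s1 ≠ q' := fun k1 s1 h1 h2 h3 => by
    have := (mul_add_inj h2 hsN' (h3.trans hq')).1
    omega
  have hge : ∀ p, t.real 6 p ≤ (NashWelfare.extend.run t).real 6 p := fun p => by
    by_cases hp : p = q'
    · rw [hp]; exact x2
    · exact (x1 p hp).1.ge
  refine ⟨fun p => (h.nonneg p).trans (hge p), ?_, ?_, ?_⟩
  · rw [(x1 0 (by have := hsrc 0 0 (by omega) (by omega); simpa using this)).1, h.init]
  · intro k1 s1 h1 hpos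
    by_cases hp : k1 * N + s1 = q'
    · obtain ⟨rfl, rfl⟩ := mul_add_inj h1 hsN' (hp.trans hq')
      rw [hp] at hpos ⊢
      rcases x4 with ⟨e1, e2⟩ | ⟨y1, y2, y3, y4, y5⟩
      · rw [e1] at hpos
        rw [e1, e2]
        have := h.valid _ _ h1 (by rwa [← hq'])
        rwa [← hq'] at this
      · rw [y4, y5]
        obtain ⟨v1, v2, v3⟩ := h.valid k s hsN (by rwa [← hq])
        rw [← hq] at v1 v2 v3
        -- Labels in the source row come from earlier agents and `ord` is injective, so the newly
        -- labelled goods are the whole bundle of the current agent.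
        have hlab : ∀ j < m, row m t q j ≠ ord k + 1 := fun j hj e => by
          obtain ⟨i, hi, e'⟩ := v3 j hj (by omega)
          have := hord i (by omega) k hkn (by omega)
          omega
        refine ⟨y2, ?_, ?_⟩
        · rw [prod_range_succ, v2, hZ, val_extension_self (Nat.succ_ne_zero _) hlab]
          congr 1
          refine prod_congr rfl fun i hi => ?_
          rw [val_extension_of_ne _ (Nat.succ_ne_zero _)]
          intro e
          have := hord i (by have := mem_range.1 hi; omega) k hkn (by omega)
          have := mem_range.1 hi
          omega
        · intro j hj hne
          rcases fill_eq_or (m := m) (r := r) (cl := cl) (b := digit B s1 0)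
            (U := digit B s1 1 * L (digit B s1 0)) (D := digit B s1) (l := ord k + 1)
            (Y := row m t q) m j with e | ⟨-, e'⟩
          · have e : Z j = row m t q j := by rw [hZ]; exact e
            rw [e] at hne ⊢
            obtain ⟨i, hi, e'⟩ := v3 j hj hne
            exact ⟨i, by omega, e'⟩
          · exact ⟨k, by omega, by rw [hZ]; exact e'⟩
    · rw [(x1 _ hp).1] at hpos
      rw [(x1 _ hp).1, (x1 _ hp).2]
      exact h.valid _ _ h1 hpos
  · rintro k1 s1' s1 hc h1 h1' hpos Z' hZ' hM hown
    have hk1 : k1 ≤ k := by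
      rcases hc with hc | ⟨rfl, -⟩
      · exact hP _ _ _ hc
      · exact le_rfl
    have hne := hsrc k1 s1 hk1 h1
    rw [(x1 _ hne).1] at hpos ⊢
    rw [(x1 _ hne).2] at hZ' hown ⊢
    rcases hc with hc | ⟨rfl, rfl, rfl⟩
    · exact (h.step _ _ _ hc h1 h1' hpos Z' hZ' hM hown).trans (hge _)
    · rw [← hq']
      rw [← hq] at hpos hZ' hown ⊢
      have : Z' = Z := by rw [hZ', hZ]
      subst this
      exact x3 hpos hM hown

theorem dynamicProgram_inv {t : Mem} (E : Env n m N B η L r ord cl t) (hcl : ∀ j < m, cl j ≤ m)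
    (hord : ∀ i < n, ∀ i' < n, ord i = ord i' → i = i') (hB : 0 < B)
    (hi : ∀ p, t.int 6 p = 0) (hr : ∀ p, t.real 6 p = 0) :
    TableInv m N B η L r ord cl (fun k _ _ => k < n) (dynamicProgram.run t) := by
  set t1 := (Stmt.setReal 6 (.const 0) (.ofInt (.const 1))).run t with ht1
  have E1 : Env n m N B η L r ord cl t1 := E.run _ (by decide) (by decide) (by decide) (by decide)
    (by decide) (by decide)
  have hrun : dynamicProgram.run t =
    (Stmt.loop 10 0 (.loop 11 2 (.seq decode (.loop 12 2 extend)))).run t1 := rfl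
  have h1 : ∀ p, t1.real 6 p = if p = 0 then 1 else 0 := fun p => by
    simp [ht1, Stmt.run, hr]
  have hrow : ∀ p j, row m t1 p j = 0 := fun p j => by
    simp [row, mask, ht1, Stmt.run, hi]
  -- Initially the only entry is the empty assignment in state `0`, all of whose digits are `0`.
  have T1 : TableInv m N B η L r ord cl (fun k _ _ => k < 0) t1 := by
    refine ⟨fun p => ?_, by rw [h1, if_pos rfl], fun k s hs hp => ?_, by simp⟩
    · rw [h1]; split_ifs <;> norm_num
    · rw [h1] at hp
      have h0 : k * N + s = 0 := by
        by_contra h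
        rw [if_neg h] at hp
        exact lt_irrefl _ hp
      have hs0 : s = 0 := by omega
      have hk0 : k = 0 := by
        rcases Nat.eq_zero_of_add_eq_zero_right h0 |> Nat.mul_eq_zero.1 with h | h <;> omega
      subst hs0 hk0
      refine ⟨?_, by simp [h1], fun j _ h => absurd (hrow _ j) h⟩
      constructor
      · simp [low, vol, used, hrow, digit]
      · intro κ _ _
        simp [cnt, used, hrow, digit]
  rw [hrun]
  have := Stmt.loop_inv (k := 10) (c := 0) (s := t1)
    (p := .loop 11 2 (.seq decode (.loop 12 2 extend)))
    (fun k u => TableInv m N B η L r ord cl (fun k1 _ _ => k1 < k) u)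
    (T1.frame (int_setInt_of_ne _ (by decide) _ _) rfl) ?_
  · rwa [E1.agents] at this
  intro k hk u hu fi fr hinv
  rw [E1.agents] at hk
  have Eu : Env n m N B η L r ord cl u := E1.frame (fi _ (by decide)) (fi _ (by decide))
    (fi _ (by decide)) (fr _ (by decide)) (fr _ (by decide)) (fr _ (by decide))
  refine TableInv.frame ?_ (int_setInt_of_ne _ (by decide) _ _) rfl
  have := Stmt.loop_inv (k := 11) (c := 2) (s := u) (p := .seq decode (.loop 12 2 extend))
    (fun i v => TableInv m N B η L r ord cl (fun k1 s' _ => k1 < k ∨ k1 = k ∧ s' < i) v)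
    ((hinv.mono fun _ _ _ _ _ h => by simpa using h).frame
      (int_setInt_of_ne _ (by decide) _ _) rfl) ?_
  · rw [Eu.states] at this
    exact this.mono fun k1 s' s _ h h' => by omega
  intro i hi' v hv fi fr hinv
  rw [Eu.states] at hi'
  have Ev : Env n m N B η L r ord cl v := Eu.frame (fi _ (by decide)) (fi _ (by decide))
    (fi _ (by decide)) (fr _ (by decide)) (fr _ (by decide)) (fr _ (by decide))
  have hv10 : v.int 10 0 = k := by rw [fi 10 (by decide), hu]
  have hdec := decode_spec Ev hB (by rw [hv]; exact hi')
  have Ew : Env n m N B η L r ord cl (decode.run v) := Ev.run _ (by decide) (by decide)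
    (by decide) (by decide) (by decide) (by decide)
  have hw10 : (decode.run v).int 10 = v.int 10 := Stmt.run_int _ 10 (by decide) _
  have hw11 : (decode.run v).int 11 = v.int 11 := Stmt.run_int _ 11 (by decide) _
  refine TableInv.frame ?_ (int_setInt_of_ne _ (by decide) _ _) rfl
  have := Stmt.loop_inv (k := 12) (c := 2) (s := decode.run v) (p := extend)
    (fun l w => (∀ d < m + 2, w.int 8 d = digit B i d) ∧ TableInv m N B η L r ord cl
      (fun k1 s' s => k1 < k ∨ k1 = k ∧ (s' < i ∨ s' = i ∧ s < l)) w) ?_ ?_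
  · rw [Ew.states] at this
    exact this.2.mono fun k1 s' s _ h h' => by omega
  · refine ⟨fun d hd => ?_, (hinv.mono fun _ _ _ _ _ h => by omega).frame ?_ ?_⟩
    · rw [int_setInt_of_ne _ (by decide), hdec d hd, hv]
    · rw [int_setInt_of_ne _ (by decide), Stmt.run_int _ 6 (by decide)]
    · rw [Mem.setInt_real, Stmt.run_real _ 6 (by decide)]
  · intro l hl w hw fi fr ⟨hd, hinv⟩
    rw [Ew.states] at hl
    have Ex : Env n m N B η L r ord cl w := Ew.frame (fi _ (by decide)) (fi _ (by decide))
      (fi _ (by decide)) (fr _ (by decide)) (fr _ (by decide)) (fr _ (by decide))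
    refine ⟨fun d hd' => ?_, TableInv.frame ?_ (int_setInt_of_ne _ (by decide) _ _) rfl⟩
    · rw [int_setInt_of_ne _ (by decide), Stmt.run_int extend 8 (by decide), hd d hd']
    · refine (hinv.extend Ex hcl hord hk hl hi' ?_ hw ?_ hd ?_).mono ?_
      · rw [fi 10 (by decide), hw10, hv10]
      · rw [fi 11 (by decide), hw11, hv]
      · intro _ _ _ h; omega
      · intro k1 s' s _ _ h; omega

theorem TableInv.isTable {t : Mem} (h : TableInv m N B η L r ord cl (fun k _ _ => k < n) t) :
    IsTable n m (fun k => η (ord k)) (fun k => ord k + 1) r cl L B N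
      (fun k s => t.real 6 (k * N + s)) (fun k s => row m t (k * N + s)) where
  init := by simpa using h.init
  matched k _ s hs hp := (h.valid k s hs hp).1
  step k hk s hs s' hs' hp Z hZ := h.step k s' s hk hs hs' hp Z hZ

end

end NashWelfare

namespace NashWelfare

open Finset RealRAM

/-! ## Ordering the agents by weight -/

/-- Agent `i'` comes before agent `i`: by weight, ties broken by number. -/
def Before (η : ℕ → ℝ) (i' i : ℕ) : Prop := η i' < η i ∨ (¬ η i < η i' ∧ i' < i)

theorem Before.trans {η : ℕ → ℝ} {i j k : ℕ} (h : Before η i j) (h' : Before η j k) :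
    Before η i k := by
  rcases h with h | ⟨h, g⟩ <;> rcases h' with h' | ⟨h', g'⟩
  · exact .inl (h.trans h')
  · exact .inl (h.trans_le (not_lt.1 h'))
  · exact .inl ((not_lt.1 h).trans_lt h')
  · exact .inr ⟨not_lt.2 ((not_lt.1 h).trans (not_lt.1 h')), g.trans g'⟩

theorem not_before_self (η : ℕ → ℝ) (i : ℕ) : ¬ Before η i i := by
  rintro (h | ⟨-, h⟩) <;> exact lt_irrefl _ h

theorem before_total (η : ℕ → ℝ) {i j : ℕ} (h : i ≠ j) : Before η i j ∨ Before η j i := by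
  unfold Before
  rcases lt_trichotomy (η i) (η j) with h1 | h1 | h1
  · exact .inl (.inl h1)
  · rcases lt_or_gt_of_ne h with h2 | h2
    · exact .inl (.inr ⟨h1.le.not_gt, h2⟩)
    · exact .inr (.inr ⟨h1.ge.not_gt, h2⟩)
  · exact .inr (.inl h1)

open Classical in
/-- The number of agents among the first `J` that come before agent `i`. -/
def rank (η : ℕ → ℝ) (J i : ℕ) : ℕ := ∑ i' ∈ range J, if Before η i' i then 1 else 0

theorem rank_lt_rank {η : ℕ → ℝ} {n i' i : ℕ} (h : Before η i' i) (hi' : i' < n) :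
    rank η n i' < rank η n i := by
  refine sum_lt_sum (fun j _ => ?_) ⟨i', mem_range.2 hi', ?_⟩
  · by_cases hj : Before η j i'
    · rw [if_pos hj, if_pos (hj.trans h)]
    · rw [if_neg hj]; exact Nat.zero_le _
  · rw [if_neg (not_before_self η i'), if_pos h]; exact Nat.one_pos

theorem rank_lt {η : ℕ → ℝ} {n i : ℕ} (hi : i < n) : rank η n i < n := by
  calc rank η n i < ∑ _i' ∈ range n, 1 := by
        refine sum_lt_sum (fun j _ => by split_ifs <;> omega) ⟨i, mem_range.2 hi, ?_⟩
        rw [if_neg (not_before_self η i)]; exact Nat.one_pos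
    _ = n := by simp

theorem rank_injOn (η : ℕ → ℝ) (n : ℕ) : Set.InjOn (rank η n) (range n) := by
  intro i hi i' hi' h
  by_contra hne
  have hi := mem_range.1 (mem_coe.1 hi)
  have hi' := mem_range.1 (mem_coe.1 hi')
  rcases before_total η hne with h1 | h1
  · exact (rank_lt_rank h1 hi).ne h
  · exact (rank_lt_rank h1 hi').ne h.symm

/-- `ord` lists the first `n` agents by increasing weight. -/
structure IsOrder (n : ℕ) (η : ℕ → ℝ) (ord : ℕ → ℕ) : Prop where
  lt : ∀ k < n, ord k < n
  inj : ∀ i < n, ∀ k < n, ord i = ord k → i = k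
  mono : ∀ i k, i ≤ k → k < n → η (ord i) ≤ η (ord k)

/-- Ranks are distinct and below `n`, so every position receives exactly one agent. -/
theorem isOrder_of_rank {n : ℕ} {η : ℕ → ℝ} {ord : ℕ → ℕ} (h : ∀ i < n, ord (rank η n i) = i) :
    IsOrder n η ord := by
  have hs : ∀ k < n, ∃ i < n, rank η n i = k := by
    intro k hk
    have := surj_on_of_inj_on_of_card_le (s := range n) (t := range n) (fun i _ => rank η n i)
      (fun i hi => mem_range.2 (rank_lt (mem_range.1 hi)))
      (fun i i' hi hi' e => rank_injOn η n hi hi' e) le_rfl k (mem_range.2 hk)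
    obtain ⟨i, hi, e⟩ := this
    exact ⟨i, mem_range.1 hi, e.symm⟩
  refine ⟨fun k hk => ?_, fun k hk k' hk' e => ?_, fun k k' hkk hk' => ?_⟩
  · obtain ⟨i, hi, rfl⟩ := hs k hk
    rwa [h i hi]
  · obtain ⟨i, hi, rfl⟩ := hs k hk
    obtain ⟨i', hi', rfl⟩ := hs k' hk'
    rw [h i hi, h i' hi'] at e
    rw [e]
  · obtain ⟨i, hi, rfl⟩ := hs k (by omega)
    obtain ⟨i', hi', rfl⟩ := hs k' hk'
    rw [h i hi, h i' hi']
    by_contra hc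
    have := rank_lt_rank (η := η) (n := n) (.inl (not_le.1 hc)) hi'
    omega

theorem IsOrder.prod_comp {n : ℕ} {η : ℕ → ℝ} {ord : ℕ → ℕ} (h : IsOrder n η ord) (f : ℕ → ℝ) :
    ∏ k ∈ range n, f (ord k) = ∏ i ∈ range n, f i := by
  have hinj : Set.InjOn ord (range n) := fun i hi k hk e =>
    h.inj i (mem_range.1 (mem_coe.1 hi)) k (mem_range.1 (mem_coe.1 hk)) e
  have himg : (range n).image ord = range n := by
    refine eq_of_subset_of_card_le (image_subset_iff.2 fun k hk => mem_range.2
      (h.lt k (mem_range.1 hk))) ?_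
    rw [card_image_of_injOn hinj]
  conv_rhs => rw [← himg]
  rw [prod_image hinj]

/-- Compare two agents and count the one before the other. -/
def rankStep : Stmt :=
  .ite (.not (.and (.not (.ltReal (.get 1 (ivar 11)) (.get 1 (ivar 10))))
      (.not (.and (.not (.ltReal (.get 1 (ivar 10)) (.get 1 (ivar 11))))
        (.ltInt (ivar 11) (ivar 10))))))
    (.setInt 22 (.const 0) (ivar 22 + .const 1)) .nop

/-- Insert one agent into the list at the position given by its rank. -/
def orderStep : Stmt :=
  .seq (.setInt 22 (.const 0) (.const 0))
    (.seq (.loop 11 0 rankStep) (.setInt 2 (ivar 22) (ivar 10)))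

/-- List the agents by increasing weight in integer array `2`. -/
def order : Stmt :=
  .loop 10 0 orderStep

theorem order_spec {s : Mem} {n : ℕ} {η : ℕ → ℝ} (hn : s.int 0 0 = n) (hη : s.real 1 = η) :
    IsOrder n η ((order.run s).int 2) := by
  refine isOrder_of_rank ?_
  have := Stmt.loop_inv (k := 10) (c := 0) (s := s) (p := orderStep)
    (fun I u => ∀ i < I, u.int 2 (rank η n i) = i) (fun i hi => absurd hi (Nat.not_lt_zero _)) ?_
  · rwa [hn] at this
  intro I hI u hu fi fr hinv
  rw [hn] at hI
  set u1 := (Stmt.setInt 22 (.const 0) (.const 0)).run u with hu1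
  have e1 : ∀ k, k ≠ 22 → u1.int k = u.int k := fun k hk => int_setInt_of_ne _ hk _ _
  have h22 := Stmt.loop_inv (k := 11) (c := 0) (s := u1)
    (p := rankStep)
    (fun J v => v.int 22 0 = rank η J I) ?_ ?_
  rotate_left
  · simp [hu1, Stmt.run, rank]
  · intro J hJ v hv gi gr hinv
    have g10 : v.int 10 0 = I := by rw [gi 10 (by decide), e1 10 (by decide), hu]
    have g1 : v.real 1 = η := by rw [gr 1 (by decide), ← hη, ← fr 1 (by decide)]; rfl
    -- Tests have no disjunction, so `Before` is expressed by De Morgan's law.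
    have hb : (Test.not (.and (.not (.ltReal (.get 1 (ivar 11)) (.get 1 (ivar 10))))
        (.not (.and (.not (.ltReal (.get 1 (ivar 10)) (.get 1 (ivar 11))))
          (.ltInt (ivar 11) (ivar 10)))))).holds v ↔ Before η J I := by
      simp only [Test.holds_not, Test.holds_and, Test.holds_ltReal, Test.holds_ltInt,
        RealExp.eval_get, IntExp.eval_ivar, g1, g10, hv]
      unfold Before
      tauto
    rw [int_setInt_of_ne _ (by decide)]
    unfold rank at hinv ⊢
    rw [sum_range_succ, ← hinv]
    by_cases hc : Before η J I
    · simp only [rankStep, Stmt.run, if_pos (hb.2 hc), if_pos hc]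
      simp
    · simp only [rankStep, Stmt.run, if_neg (fun h => hc (hb.1 h)), if_neg hc, add_zero]
  have h0 : u1.int 0 0 = n := by rw [e1 0 (by decide), fi 0 (by decide), hn]
  rw [h0] at h22
  set u2 := (Stmt.loop 11 0 rankStep).run u1 with hu2
  have h10 : u2.int 10 0 = I := by
    rw [hu2, Stmt.run_int _ 10 (by decide), e1 10 (by decide), hu]
  have h2 : u2.int 2 = u.int 2 := by
    rw [hu2, Stmt.run_int _ 2 (by decide), e1 2 (by decide)]
  intro i hi
  rw [int_setInt_of_ne _ (by decide)]
  have hrun : (Stmt.setInt 2 (ivar 22) (ivar 10)).run u2 = u2.setInt 2 (rank η n I) I := by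
    simp [Stmt.run, h22, h10]
  change ((Stmt.setInt 2 (ivar 22) (ivar 10)).run u2).int 2 _ = _
  rw [hrun, Mem.setInt_int, h2]
  by_cases hiI : i = I
  · simp [hiI]
  · have hlt : i < I := by omega
    have : rank η n i ≠ rank η n I := fun h => hiI
      (rank_injOn η n (mem_coe.2 (mem_range.2 (by omega))) (mem_coe.2 (mem_range.2 hI)) h)
    rw [if_neg (by tauto)]
    exact hinv i hlt

/-! ## Selecting the best entry of the last layer -/

/-- Index of the current entry of the last layer. -/
def lastE : IntExp := .get 0 (.const 0) * stateCountE + ivar 12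

/-- Copy the best entry of the last layer of the table to integer array `1`. -/
def select : Stmt :=
  .seq (.setReal 12 (.const 0) (.ofInt (.const 0)))
    (.loop 12 2 (.ite (.ltReal (rvar 12) (.get 6 lastE))
      (.seq (.setReal 12 (.const 0) (.get 6 lastE))
        (.loop 13 1 (.setInt 1 (ivar 13) (.get 6 (lastE * goodsE + ivar 13) - .const 1)))) .nop))

section

variable {n m N B : ℕ} {η L r : ℕ → ℝ} {ord cl : ℕ → ℕ}

/-- Labels are agents plus one, so truncated subtraction hands the unassigned goods to agent `0`. -/
theorem select_spec {s : Mem} (E : Env n m N B η L r ord cl s) {s₀ : ℕ} (hs₀ : s₀ < N)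
    (hpos : 0 < s.real 6 (n * N + s₀)) :
    ∃ q < N, 0 < s.real 6 (n * N + q) ∧ s.real 6 (n * N + s₀) ≤ s.real 6 (n * N + q) ∧
      ∀ j < m, (select.run s).int 1 j = row m s (n * N + q) j - 1 := by
  set s1 := (Stmt.setReal 12 (.const 0) (.ofInt (.const 0))).run s with hs1
  have E1 : Env n m N B η L r ord cl s1 := E.run _ (by decide) (by decide) (by decide) (by decide)
    (by decide) (by decide)
  have hr6 : s1.real 6 = s.real 6 := real_setReal_of_ne _ (by decide) _ _
  have := Stmt.loop_inv (k := 12) (c := 2) (s := s1) (p := .ite (.ltReal (rvar 12) (.get 6 lastE))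
      (.seq (.setReal 12 (.const 0) (.get 6 lastE))
        (.loop 13 1 (.setInt 1 (ivar 13) (.get 6 (lastE * goodsE + ivar 13) - .const 1)))) .nop)
    (fun I u => 0 ≤ u.real 12 0 ∧ (∀ q < I, s.real 6 (n * N + q) ≤ u.real 12 0) ∧
      (u.real 12 0 = 0 ∨ ∃ q < I, u.real 12 0 = s.real 6 (n * N + q) ∧
        ∀ j < m, u.int 1 j = row m s (n * N + q) j - 1)) ?_ ?_
  · rw [E1.states] at this
    obtain ⟨-, i2, i3⟩ := this
    have h0 := i2 s₀ hs₀
    rcases i3 with h | ⟨q, hq, h, hrow⟩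
    · rw [h] at h0; linarith
    · rw [h] at h0
      exact ⟨q, hq, by linarith, h0, hrow⟩
  · simp [hs1, Stmt.run]
  · intro I hI u hu fi fr ⟨i1, i2, i3⟩
    rw [E1.states] at hI
    have Eu : Env n m N B η L r ord cl u := E1.frame (fi _ (by decide)) (fi _ (by decide))
      (fi _ (by decide)) (fr _ (by decide)) (fr _ (by decide)) (fr _ (by decide))
    have g6 : u.real 6 = s.real 6 := by rw [fr 6 (by decide), hr6]
    have gi6 : u.int 6 = s.int 6 := fi 6 (by decide)
    have hlast : ∀ v : Mem, v.int 0 = u.int 0 → v.int 12 0 = I → lastE.eval v = n * N + I := by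
      intro v h h'
      simp [lastE, stateCountE, h, h', Eu.agents, Eu.states]
    have hl := hlast u rfl hu
    by_cases hc : u.real 12 0 < s.real 6 (n * N + I)
    · set u1 := (Stmt.setReal 12 (.const 0) (.get 6 lastE)).run u with hu1
      have hrun : (Stmt.ite (.ltReal (rvar 12) (.get 6 lastE))
          (.seq (.setReal 12 (.const 0) (.get 6 lastE))
          (.loop 13 1 (.setInt 1 (ivar 13) (.get 6 (lastE * goodsE + ivar 13) - .const 1))))
          .nop).run u = (Stmt.loop 13 1
          (.setInt 1 (ivar 13) (.get 6 (lastE * goodsE + ivar 13) - .const 1))).run u1 := by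
        have : (Test.ltReal (rvar 12) (.get 6 lastE)).holds u := by simpa [hl, g6] using hc
        simp only [Stmt.run, if_pos this, hu1]
      have h12 : u1.real 12 0 = s.real 6 (n * N + I) := by simp [hu1, Stmt.run, hl, g6]
      have hcopy := Stmt.loop_inv (k := 13) (c := 1) (s := u1)
        (p := .setInt 1 (ivar 13) (.get 6 (lastE * goodsE + ivar 13) - .const 1))
        (fun J v => ∀ j < J, v.int 1 j = row m s (n * N + I) j - 1)
        (fun j hj => absurd hj (Nat.not_lt_zero _)) ?_
      · have hg : u1.int 0 1 = m := Eu.goods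
        rw [hg] at hcopy
        rw [hrun, Mem.setInt_real, Stmt.run_real _ 12 (by decide), h12]
        refine ⟨i1.trans hc.le, fun q hq => ?_, .inr ⟨I, by omega, rfl, ?_⟩⟩
        · rcases Nat.lt_succ_iff_lt_or_eq.1 hq with h | rfl
          · exact (i2 q h).trans hc.le
          · exact le_rfl
        · rw [int_setInt_of_ne _ (by decide)]
          exact hcopy
      · intro J hJ v hv hi _ hinv j hj
        have hg : u1.int 0 1 = m := Eu.goods
        rw [hg] at hJ
        have h0 : v.int 0 = u.int 0 := hi 0 (by decide)
        have h12 : v.int 12 0 = I := by rw [hi 12 (by decide)]; exact hu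
        have h6 : v.int 6 = s.int 6 := (hi 6 (by decide)).trans gi6
        rw [int_setInt_of_ne _ (by decide)]
        simp only [Stmt.run, Mem.setInt_int, IntExp.eval_ivar, IntExp.eval_sub, IntExp.eval_get,
          IntExp.eval_add, IntExp.eval_mul, IntExp.eval_const, hlast v h0 h12, goodsE, h0, Eu.goods,
          h6, hv, true_and]
        split_ifs with h
        · simp [row, mask, h, hJ]
        · exact hinv j (by omega)
    · have hrun : (Stmt.ite (.ltReal (rvar 12) (.get 6 lastE))
          (.seq (.setReal 12 (.const 0) (.get 6 lastE))
          (.loop 13 1 (.setInt 1 (ivar 13) (.get 6 (lastE * goodsE + ivar 13) - .const 1))))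
          .nop).run u = u := by
        have : ¬ (Test.ltReal (rvar 12) (.get 6 lastE)).holds u := by simpa [hl, g6] using hc
        simp only [Stmt.run, if_neg this]
      rw [hrun, Mem.setInt_real, int_setInt_of_ne _ (by decide)]
      refine ⟨i1, fun q hq => ?_, i3.imp id fun ⟨q, hq, h⟩ => ⟨q, by omega, h⟩⟩
      rcases Nat.lt_succ_iff_lt_or_eq.1 hq with h | rfl
      · exact i2 q h
      · exact not_lt.1 hc

end

end NashWelfare

namespace NashWelfare

open Finset RealRAM

/-! ## Rounding the values of the goods -/

/-- The classes found after `P` rounds of the rounding of the values `a`: there are `q` classes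
besides class `0`, and the class values are repeated if no goods are left. -/
structure ClassInv (m : ℕ) (δ : ℝ) (a : ℕ → ℝ) (P q : ℕ) (L r : ℕ → ℝ) (cl : ℕ → ℕ) : Prop where
  le : q ≤ P
  zero : L 0 = 0
  nonneg : 0 ≤ L q
  ratio : ∀ κ < q, (1 + δ) * L κ < L (κ + 1)
  last : L P = L q
  cl_le : ∀ j < m, cl j ≤ q
  eq : ∀ j < m, r j = L (cl j)
  round_le : ∀ j < m, r j ≤ a j
  le_round : ∀ j < m, a j ≤ (1 + δ) * r j ∨ cl j = q
  done : q < P → ∀ j < m, a j ≤ (1 + δ) * L q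
  card : q ≤ #{j ∈ range m | a j ≤ (1 + δ) * L q}

section

variable {m : ℕ} {δ : ℝ} {a : ℕ → ℝ} {P q : ℕ} {L r : ℕ → ℝ} {cl : ℕ → ℕ}

theorem ClassInv.stay (h : ClassInv m δ a P q L r cl) (hP : ∀ j < m, a j ≤ L P * (1 + δ)) :
    ClassInv m δ a (P + 1) q (Function.update L (P + 1) (L P)) r cl := by
  have hne : ∀ κ, κ ≤ q → Function.update L (P + 1) (L P) κ = L κ := fun κ hκ =>
    Function.update_of_ne (by have := h.le; omega) _ _
  refine ⟨h.le.trans (Nat.le_succ _), ?_, ?_, fun κ hκ => ?_, ?_, h.cl_le, fun j hj => ?_,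
    h.round_le, h.le_round, fun _ j hj => ?_, ?_⟩
  · rw [hne 0 (Nat.zero_le _), h.zero]
  · rw [hne q le_rfl]; exact h.nonneg
  · rw [hne κ hκ.le, hne (κ + 1) hκ]; exact h.ratio κ hκ
  · rw [hne q le_rfl, Function.update_self, h.last]
  · rw [hne _ (h.cl_le j hj), h.eq j hj]
  · rw [hne q le_rfl, ← h.last, mul_comm]; exact hP j hj
  · rw [hne q le_rfl]; exact h.card

/-- All goods worth at least `a j₀` join the new class provisionally, even those far above it; later
rounds lift them further. This is why `le_round` exempts the last class. -/
theorem ClassInv.next (h : ClassInv m δ a P q L r cl) (hδ : 0 < δ) {j₀ : ℕ} (hj₀ : j₀ < m)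
    (hcut : L P * (1 + δ) < a j₀) (hmin : ∀ j < m, L P * (1 + δ) < a j → a j₀ ≤ a j)
    {r' : ℕ → ℝ} {cl' : ℕ → ℕ} (hcl' : ∀ j < m, cl' j = if a j₀ ≤ a j then P + 1 else cl j)
    (hr' : ∀ j < m, r' j = if a j₀ ≤ a j then a j₀ else r j) :
    ClassInv m δ a (P + 1) (P + 1) (Function.update L (P + 1) (a j₀)) r' cl' := by
  have hq : q = P := by
    by_contra hne
    have := h.done (lt_of_le_of_ne h.le hne) j₀ hj₀
    rw [← h.last, mul_comm] at this
    linarith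
  subst hq
  have hne : ∀ κ, κ ≤ q → Function.update L (q + 1) (a j₀) κ = L κ := fun κ hκ =>
    Function.update_of_ne (by omega) _ _
  have hself : Function.update L (q + 1) (a j₀) (q + 1) = a j₀ := Function.update_self ..
  have hpos : 0 < a j₀ := by
    have := mul_nonneg h.nonneg (by linarith : 0 ≤ 1 + δ)
    linarith
  refine ⟨le_rfl, ?_, ?_, fun κ hκ => ?_, rfl, fun j hj => ?_, fun j hj => ?_, fun j hj => ?_,
    fun j hj => ?_, fun h => absurd h (lt_irrefl _), ?_⟩
  · rw [hne 0 (Nat.zero_le _), h.zero]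
  · rw [hself]; exact hpos.le
  · rcases Nat.lt_succ_iff_lt_or_eq.1 hκ with hκ | rfl
    · rw [hne κ hκ.le, hne (κ + 1) hκ]; exact h.ratio κ hκ
    · rw [hself, hne κ le_rfl, mul_comm]; exact hcut
  · rw [hcl' j hj]
    split_ifs
    · exact le_rfl
    · exact (h.cl_le j hj).trans (Nat.le_succ _)
  · rw [hcl' j hj, hr' j hj]
    split_ifs
    · exact hself.symm
    · rw [hne _ (h.cl_le j hj), h.eq j hj]
  · rw [hr' j hj]
    split_ifs with hc
    · exact hc
    · exact h.round_le j hj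
  · rw [hcl' j hj, hr' j hj]
    split_ifs with hc
    · exact .inr rfl
    · left
      rcases h.le_round j hj with h1 | h1
      · exact h1
      · rw [h.eq j hj, h1, mul_comm]
        exact not_lt.1 fun h2 => hc (hmin j hj h2)
  -- The leader `j₀` lies above the old cut and below the new one, so the set below the cut grows
  -- strictly.
  · rw [hself]
    refine (Nat.succ_le_succ h.card).trans (Nat.succ_le_of_lt (card_lt_card ?_))
    have hlt : L q ≤ a j₀ := by nlinarith [h.nonneg]
    refine ssubset_iff_of_subset (fun j hj => ?_) |>.2 ⟨j₀, ?_, ?_⟩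
    · rw [mem_filter] at hj ⊢
      refine ⟨hj.1, hj.2.trans ?_⟩
      exact mul_le_mul_of_nonneg_left hlt (by linarith)
    · rw [mem_filter]
      exact ⟨mem_range.2 hj₀, by nlinarith⟩
    · rw [mem_filter]
      intro hc
      have := hc.2
      rw [mul_comm] at this
      linarith

/-- With fewer than `m` classes, no good is left above the last cut. With `m` classes, `card` says
that all `m` goods lie below it. So the provisional last class is also rounded well. -/
theorem ClassInv.isClassing (h : ClassInv m δ a m q L r cl) :
    IsClassing m δ r cl L q ∧ ∀ j < m, r j ≤ a j ∧ a j ≤ (1 + δ) * r j := by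
  refine ⟨⟨h.le, h.zero, h.ratio, h.cl_le, h.eq⟩, fun j hj => ⟨h.round_le j hj, ?_⟩⟩
  rcases h.le_round j hj with h1 | h1
  · exact h1
  rw [h.eq j hj, h1]
  rcases h.le.lt_or_eq with h2 | h2
  · exact h.done h2 j hj
  · have h3 : {j ∈ range m | a j ≤ (1 + δ) * L q} = range m :=
      eq_of_subset_of_card_le (filter_subset _ _)
        (by rw [card_range]; exact h2.symm.le.trans h.card)
    exact filter_eq_self.1 h3 j (mem_range.2 hj)

end

/-- The value above which a good belongs to a new class. -/
def cutE : RealExp := .get 3 (ivar 10) * (.ofInt (.const 1) + rvar 13)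

/-- Find the smallest value above the cut. -/
def nextStep : Stmt :=
  .ite (.and (.ltReal cutE (.get 2 (ivar 11))) (.not (.and (.ltReal (.get 3 (ivar 10)) (rvar 11))
      (.not (.ltReal (.get 2 (ivar 11)) (rvar 11))))))
    (.setReal 11 (.const 0) (.get 2 (ivar 11))) .nop

/-- Put one good in the new class. -/
def assignStep : Stmt :=
  .ite (.and (.ltReal (.get 3 (ivar 10)) (rvar 11)) (.not (.ltReal (.get 2 (ivar 11)) (rvar 11))))
    (.seq (.setInt 3 (ivar 11) (ivar 10 + .const 1)) (.setReal 4 (ivar 11) (rvar 11))) .nop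

/-- Find one class. -/
def classStep : Stmt :=
  .seq (.setReal 11 (.const 0) (.get 3 (ivar 10)))
    (.seq (.loop 11 1 nextStep)
      (.seq (.setReal 3 (ivar 10 + .const 1) (rvar 11)) (.loop 11 1 assignStep)))

/-- Round the values of the goods: class values in real array `3`, rounded values in real array
`4`, classes in integer array `3`; real array `13` holds the accuracy `δ`. -/
def classes : Stmt := .loop 10 1 classStep

section

variable {m : ℕ} {δ : ℝ} {a : ℕ → ℝ}

/-- The value `L P` in the cell means that nothing has been found. This is unambiguous because every
value found exceeds the cut, hence `L P`. -/
theorem nextLoop_spec {s : Mem} {P : ℕ} (hm : s.int 0 1 = m) (hδ : s.real 13 0 = δ) (hδ0 : 0 < δ)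
    (ha : s.real 2 = a) (hP : s.int 10 0 = P) (h11 : s.real 11 0 = s.real 3 P)
    (hL : 0 ≤ s.real 3 P) :
    (((Stmt.loop 11 1 nextStep).run s).real 11 0 = s.real 3 P ∧
      ∀ j < m, a j ≤ s.real 3 P * (1 + δ)) ∨
    ∃ j₀ < m, ((Stmt.loop 11 1 nextStep).run s).real 11 0 = a j₀ ∧ s.real 3 P * (1 + δ) < a j₀ ∧
      ∀ j < m, s.real 3 P * (1 + δ) < a j → a j₀ ≤ a j := by
  have := Stmt.loop_inv (k := 11) (c := 1) (s := s) (p := nextStep)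
    (fun J u => (u.real 11 0 = s.real 3 P ∧ ∀ j < J, a j ≤ s.real 3 P * (1 + δ)) ∨
      ∃ j₀ < J, u.real 11 0 = a j₀ ∧ s.real 3 P * (1 + δ) < a j₀ ∧
        ∀ j < J, s.real 3 P * (1 + δ) < a j → a j₀ ≤ a j)
    (.inl ⟨h11, fun j hj => absurd hj (Nat.not_lt_zero _)⟩) ?_
  · rwa [hm] at this
  intro J hJ u hu fi fr hinv
  have g10 : u.int 10 0 = P := by rw [fi 10 (by decide), hP]
  have g2 : u.real 2 = a := by rw [fr 2 (by decide), ha]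
  have g3 : u.real 3 = s.real 3 := fr 3 (by decide)
  have g13 : u.real 13 0 = δ := by rw [fr 13 (by decide), hδ]
  rw [Mem.setInt_real]
  have hLcut : s.real 3 P ≤ s.real 3 P * (1 + δ) := by nlinarith
  have hcond : (Test.and (.ltReal cutE (.get 2 (ivar 11)))
      (.not (.and (.ltReal (.get 3 (ivar 10)) (rvar 11))
      (.not (.ltReal (.get 2 (ivar 11)) (rvar 11)))))).holds u ↔
      s.real 3 P * (1 + δ) < a J ∧ ¬ (s.real 3 P < u.real 11 0 ∧ ¬ a J < u.real 11 0) := by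
    simp [cutE, g10, g2, g3, g13, hu]
  have hrun : (nextStep.run u).real 11 0 =
      if s.real 3 P * (1 + δ) < a J ∧ ¬ (s.real 3 P < u.real 11 0 ∧ ¬ a J < u.real 11 0) then a J
      else u.real 11 0 := by
    unfold nextStep
    simp only [Stmt.run, hcond]
    split_ifs <;> simp [g2, hu]
  rw [hrun]
  rcases hinv with ⟨i1, i2⟩ | ⟨j₀, hj₀, i1, i2, i3⟩
  · rw [i1]
    by_cases hc : s.real 3 P * (1 + δ) < a J
    · right
      refine ⟨J, Nat.lt_succ_self _, if_pos ⟨hc, fun h => lt_irrefl _ h.1⟩, hc, fun j hj hj' => ?_⟩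
      rcases Nat.lt_succ_iff_lt_or_eq.1 hj with h | rfl
      · exact absurd (i2 j h) (not_le.2 hj')
      · exact le_rfl
    · left
      refine ⟨if_neg fun h => hc h.1, fun j hj => ?_⟩
      rcases Nat.lt_succ_iff_lt_or_eq.1 hj with h | rfl
      · exact i2 j h
      · exact not_lt.1 hc
  · right
    rw [i1]
    by_cases hc : s.real 3 P * (1 + δ) < a J ∧ a J < a j₀
    · refine ⟨J, Nat.lt_succ_self _, if_pos ⟨hc.1, fun h => h.2 hc.2⟩, hc.1, fun j hj hj' => ?_⟩
      rcases Nat.lt_succ_iff_lt_or_eq.1 hj with h | rfl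
      · exact hc.2.le.trans (i3 j h hj')
      · exact le_rfl
    · refine ⟨j₀, by omega, if_neg fun h => h.2 ⟨by linarith, fun h' => hc ⟨h.1, h'⟩⟩, i2,
        fun j hj hj' => ?_⟩
      rcases Nat.lt_succ_iff_lt_or_eq.1 hj with h | rfl
      · exact i3 j h hj'
      · exact not_lt.1 fun h => hc ⟨hj', h⟩

theorem assignLoop_spec {s : Mem} {P : ℕ} {x : ℝ} (hm : s.int 0 1 = m) (ha : s.real 2 = a)
    (hP : s.int 10 0 = P) (hx : s.real 11 0 = x) :
    (∀ j < m, ((Stmt.loop 11 1 assignStep).run s).int 3 j =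
      if s.real 3 P < x ∧ x ≤ a j then P + 1 else s.int 3 j) ∧
    ∀ j < m, ((Stmt.loop 11 1 assignStep).run s).real 4 j =
      if s.real 3 P < x ∧ x ≤ a j then x else s.real 4 j := by
  have := Stmt.loop_inv (k := 11) (c := 1) (s := s) (p := assignStep)
    (fun J u => (∀ j, u.int 3 j = if j < J ∧ s.real 3 P < x ∧ x ≤ a j then P + 1 else s.int 3 j) ∧
      ∀ j, u.real 4 j = if j < J ∧ s.real 3 P < x ∧ x ≤ a j then x else s.real 4 j)
    (by simp) ?_
  · rw [hm] at this
    exact ⟨fun j hj => by rw [this.1]; simp [hj], fun j hj => by rw [this.2]; simp [hj]⟩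
  intro J hJ u hu fi fr ⟨i1, i2⟩
  have g10 : u.int 10 0 = P := by rw [fi 10 (by decide), hP]
  have g2 : u.real 2 = a := by rw [fr 2 (by decide), ha]
  have g3 : u.real 3 = s.real 3 := fr 3 (by decide)
  have g11 : u.real 11 0 = x := by rw [fr 11 (by decide), hx]
  have hcond : (Test.and (.ltReal (.get 3 (ivar 10)) (rvar 11))
      (.not (.ltReal (.get 2 (ivar 11)) (rvar 11)))).holds u ↔ s.real 3 P < x ∧ x ≤ a J := by
    simp [g10, g2, g3, g11, hu]
  have hsucc : ∀ j, j < J + 1 ↔ j < J ∨ j = J := fun j => by omega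
  rw [Mem.setInt_real, int_setInt_of_ne _ (by decide)]
  unfold assignStep
  simp only [Stmt.run, hcond]
  by_cases hc : s.real 3 P < x ∧ x ≤ a J
  · simp only [if_pos hc]
    constructor
    · intro j
      by_cases hj : j = J
      · subst hj; simp [hu, g10, hc]
      · simp [hu, g10, i1, hj, hsucc]
    · intro j
      by_cases hj : j = J
      · subst hj; simp [hu, g11, hc]
      · simp [hu, g11, i2, hj, hsucc]
  · simp only [if_neg hc]
    constructor
    · intro j
      by_cases hj : j = J
      · subst hj; simp [i1, hc]
      · simp [i1, hj, hsucc]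
    · intro j
      by_cases hj : j = J
      · subst hj; simp [i2, hc]
      · simp [i2, hj, hsucc]

theorem classes_spec {s : Mem} (hm : s.int 0 1 = m) (hδ : s.real 13 0 = δ) (hδ0 : 0 < δ)
    (ha : s.real 2 = a) (ha0 : ∀ j < m, 0 ≤ a j) (h3 : ∀ κ, s.real 3 κ = 0)
    (h4 : ∀ j, s.real 4 j = 0) (hi3 : ∀ j, s.int 3 j = 0) :
    ∃ q, IsClassing m δ ((classes.run s).real 4) ((classes.run s).int 3)
        ((classes.run s).real 3) q ∧
      ∀ j < m, (classes.run s).real 4 j ≤ a j ∧ a j ≤ (1 + δ) * (classes.run s).real 4 j := by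
  have key := Stmt.loop_inv (k := 10) (c := 1) (s := s) (p := classStep)
    (fun P u => ∃ q, ClassInv m δ a P q (u.real 3) (u.real 4) (u.int 3)) ?_ ?_
  · rw [hm] at key
    obtain ⟨q, hq⟩ := key
    exact ⟨q, hq.isClassing⟩
  · refine ⟨0, le_rfl, ?_, ?_, by simp, rfl, fun j _ => ?_, fun j _ => ?_, fun j hj => ?_,
      fun j _ => .inr ?_, by simp, Nat.zero_le _⟩
    · rw [Mem.setInt_real, h3]
    · rw [Mem.setInt_real, h3]
    · rw [int_setInt_of_ne _ (by decide), hi3]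
    · rw [Mem.setInt_real, h3, h4]
    · rw [Mem.setInt_real, h4]; exact ha0 j hj
    · rw [int_setInt_of_ne _ (by decide), hi3]
  intro P hP u hu fi fr ⟨q, hq⟩
  rw [hm] at hP
  have hLP : 0 ≤ u.real 3 P := by rw [hq.last]; exact hq.nonneg
  set u1 := (Stmt.setReal 11 (.const 0) (.get 3 (ivar 10))).run u with hu1
  have hr1 : ∀ k, k ≠ 11 → u1.real k = u.real k := fun k hk => real_setReal_of_ne _ hk _ _
  have h1 := nextLoop_spec (s := u1) (m := m) (δ := δ) (a := a) (P := P)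
    ((congrFun (fi 0 (by decide)) 1).trans hm)
    (by rw [hr1 13 (by decide), fr 13 (by decide), hδ]) hδ0
    (by rw [hr1 2 (by decide), fr 2 (by decide), ha]) hu
    (by simp [hu1, Stmt.run, hu]) (by rwa [hr1 3 (by decide)])
  rw [hr1 3 (by decide)] at h1
  set u2 := (Stmt.loop 11 1 nextStep).run u1 with hu2
  have hi2 : ∀ k, k ≠ 11 → u2.int k = u.int k := fun k hk => by
    rw [hu2, Stmt.run_int _ k (by simp [Stmt.modInt, nextStep, hk])]; rfl
  have hr2 : ∀ k, k ≠ 11 → u2.real k = u.real k := fun k hk => by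
    rw [hu2, Stmt.run_real _ k (by simp [Stmt.modReal, nextStep, hk]), hr1 k hk]
  obtain ⟨x, hx⟩ : ∃ x, u2.real 11 0 = x := ⟨_, rfl⟩
  set u3 := (Stmt.setReal 3 (ivar 10 + .const 1) (rvar 11)).run u2 with hu3
  have hr3 : ∀ k, k ≠ 3 → u3.real k = u2.real k := fun k hk => real_setReal_of_ne _ hk _ _
  have hL3 : u3.real 3 = Function.update (u.real 3) (P + 1) x := by
    ext κ
    simp [hu3, Stmt.run, hi2, hr2, hx, hu, Function.update_apply]
  have hL3P : u3.real 3 P = u.real 3 P := by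
    rw [hL3, Function.update_of_ne (by omega)]
  have h2 := assignLoop_spec (s := u3) (m := m) (a := a) (P := P) (x := x)
    ((congrFun ((hi2 0 (by decide)).trans (fi 0 (by decide))) 1).trans hm)
    (by rw [hr3 2 (by decide), hr2 2 (by decide), fr 2 (by decide), ha])
    ((congrFun (hi2 10 (by decide)) 0).trans hu) (by rw [hr3 11 (by decide), hx])
  rw [hL3P, hr3 4 (by decide), hr2 4 (by decide), show u3.int 3 = u.int 3 from hi2 3 (by decide)]
    at h2
  have hL4 : ((Stmt.loop 11 1 assignStep).run u3).real 3 = u3.real 3 :=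
    Stmt.run_real _ 3 (by decide) _
  have hrun : classStep.run u = (Stmt.loop 11 1 assignStep).run u3 := rfl
  rw [hrun, Mem.setInt_real, int_setInt_of_ne _ (by decide), hL4, hL3]
  rw [hx] at h1
  rcases h1 with ⟨rfl, h1⟩ | ⟨j₀, hj₀, rfl, h1, h1'⟩
  · refine ⟨q, ?_⟩
    have hs := hq.stay h1
    have e1 : ∀ j < m, ((Stmt.loop 11 1 assignStep).run u3).int 3 j = u.int 3 j := fun j hj => by
      rw [h2.1 j hj, if_neg fun h => lt_irrefl _ h.1]
    have e2 : ∀ j < m, ((Stmt.loop 11 1 assignStep).run u3).real 4 j = u.real 4 j := fun j hj => by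
      rw [h2.2 j hj, if_neg fun h => lt_irrefl _ h.1]
    exact ⟨hs.le, hs.zero, hs.nonneg, hs.ratio, hs.last,
      fun j hj => by rw [e1 j hj]; exact hs.cl_le j hj,
      fun j hj => by rw [e1 j hj, e2 j hj]; exact hs.eq j hj,
      fun j hj => by rw [e2 j hj]; exact hs.round_le j hj,
      fun j hj => by rw [e1 j hj, e2 j hj]; exact hs.le_round j hj, hs.done, hs.card⟩
  · have hlt : u.real 3 P < a j₀ := by nlinarith
    refine ⟨P + 1, hq.next hδ0 hj₀ h1 h1' (fun j hj => ?_) fun j hj => ?_⟩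
    · rw [h2.1 j hj]; simp [hlt]
    · rw [h2.2 j hj]; simp [hlt]

end

/-! ## The number of states -/

/-- The base of the digits of the states. -/
def digitBaseE : IntExp := goodsE * .const 2 + .const 1

/-- Increase the number of digits unless it suffices. -/
def sizeStep : Stmt :=
  .ite (.not (.ltReal (.ofInt (.const 1)) (rvar 10 * rvar 13)))
    (.seq (.setReal 10 (.const 0) (rvar 10 * (.ofInt (.const 1) + rvar 13)))
      (.setInt 26 (.const 0) (ivar 26 * (digitBaseE * digitBaseE)))) .nop

/-- Compute the number of states. -/
def size : Stmt :=
  .seq (.setReal 10 (.const 0) (.ofInt (.const 1)))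
    (.seq (.setInt 26 (.const 0) (digitBaseE * digitBaseE)) (.loop 10 1 sizeStep))

/-- A logarithm could not be rounded to an integer, so `K` is found by repeated multiplication,
capped at `m`. The last test that failed to stop gives `(1 + δ) ^ (K - 1) * δ ≤ 1`, and Bernoulli
turns this into `(K - 1) * δ ^ 2 ≤ 1`. -/
theorem size_spec {s : Mem} {m B : ℕ} {δ : ℝ} (hm : s.int 0 1 = m) (hδ : s.real 13 0 = δ)
    (hδ0 : 0 < δ) (hB : B = 2 * m + 1) :
    ∃ K ≤ m, (size.run s).int 26 0 = B ^ (2 + 2 * K) ∧ (K = m ∨ 1 < (1 + δ) ^ K * δ) ∧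
      (K : ℝ) ≤ 1 + 1 / δ ^ 2 := by
  set s1 := (Stmt.setReal 10 (.const 0) (.ofInt (.const 1))).run s with hs1
  set s2 := (Stmt.setInt 26 (.const 0) (digitBaseE * digitBaseE)).run s1 with hs2
  have hi1 : s1.int = s.int := rfl
  have hi0 : s2.int 0 = s.int 0 := int_setInt_of_ne _ (by decide) _ _
  have hr13 : s2.real 13 = s.real 13 :=
    Stmt.run_real (.setReal 10 (.const 0) (.ofInt (.const 1))) 13 (by decide) s
  have hbase : ∀ u : Mem, u.int 0 = s.int 0 → digitBaseE.eval u = B := fun u h => by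
    simp [digitBaseE, goodsE, h, hm, hB, mul_comm]
  have := Stmt.loop_inv (k := 10) (c := 1) (s := s2) (p := sizeStep)
    (fun I u => ∃ K ≤ I, u.int 26 0 = B ^ (2 + 2 * K) ∧ u.real 10 0 = (1 + δ) ^ K ∧
      (K = I ∨ 1 < (1 + δ) ^ K * δ) ∧ (K = 0 ∨ (1 + δ) ^ (K - 1) * δ ≤ 1)) ?_ ?_
  · rw [hi0, hm] at this
    obtain ⟨K, h1, h2, -, h3, h4⟩ := this
    refine ⟨K, h1, h2, h3, ?_⟩
    rcases h4 with rfl | h4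
    · simp; positivity
    · have h5 := one_add_mul_le_pow (a := δ) (by linarith) (K - 1)
      have h6 : ((K - 1 : ℕ) : ℝ) * δ ^ 2 ≤ 1 := by nlinarith
      have h7 : ((K - 1 : ℕ) : ℝ) ≤ 1 / δ ^ 2 := by
        rwa [le_div_iff₀ (by positivity)]
      have h8 : (K : ℝ) ≤ (K - 1 : ℕ) + 1 := by exact_mod_cast (by omega : K ≤ K - 1 + 1)
      linarith
  · refine ⟨0, le_rfl, ?_, ?_, .inl rfl, .inl rfl⟩
    · rw [int_setInt_of_ne _ (by decide)]
      simp [hs2, Stmt.run, hbase s1 (by rw [hi1]), pow_two]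
    · simp [hs2, hs1, Stmt.run]
  · intro I _ u hu fi fr ⟨K, h1, h2, h3, h4, h5⟩
    have g0 : u.int 0 = s.int 0 := (fi 0 (by decide)).trans hi0
    have g13 : u.real 13 0 = δ := by rw [fr 13 (by decide), hr13, hδ]
    rw [Mem.setInt_real, int_setInt_of_ne _ (by decide)]
    have hcond : (Test.not (.ltReal (.ofInt (.const 1)) (rvar 10 * rvar 13))).holds u ↔
        (1 + δ) ^ K * δ ≤ 1 := by
      simp [h3, g13]
    unfold sizeStep
    simp only [Stmt.run, hcond]
    by_cases hc : (1 + δ) ^ K * δ ≤ 1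
    · rw [if_pos hc]
      have hKI : K = I := h4.resolve_right fun h => absurd hc (not_le.2 h)
      refine ⟨K + 1, by omega, ?_, ?_, .inl (by omega), .inr (by simpa using hc)⟩
      · simp only [Mem.setInt_int, Mem.setReal_int, IntExp.eval_mul, IntExp.eval_ivar,
          IntExp.eval_const, h2]
        rw [hbase _ (by rw [Mem.setReal_int, g0])]
        simp only [and_self, if_true]
        ring
      · simp [h3, g13, pow_succ]
    · rw [if_neg hc]
      exact ⟨K, by omega, h2, h3, .inr (not_le.1 hc), h5⟩

end NashWelfare

/-! ### Rearrangement of the bundles and correctness of the solver -/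

namespace NashWelfare

open Finset RealRAM

section

variable {n m : ℕ} {η a r : ℕ → ℝ} {ord : ℕ → ℕ} {x : ℕ → ℕ}

/-- Rearrangement: giving the larger of positive values to the agents of larger weight does not
decrease the weighted product. -/
theorem exists_perm_prod_rpow_le (h : IsOrder n η ord) (f : Fin n → ℝ) (hf : ∀ i, 0 < f i) :
    ∃ ρ : Equiv.Perm (Fin n), Monotone (f ∘ ρ) ∧
      ∏ i, f i ^ η i ≤ ∏ k, f (ρ k) ^ η (ord k) := by
  let g : Fin n → Fin n := fun k => ⟨ord k, h.lt k k.2⟩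
  have hg : Function.Bijective g := Finite.injective_iff_bijective.1 fun k k' e =>
    Fin.ext (h.inj k k.2 k' k'.2 (congrArg Fin.val e))
  let π := Equiv.ofBijective g hg
  refine ⟨Tuple.sort f, Tuple.monotone_sort f, ?_⟩
  set ρ := Tuple.sort f with hρ
  have hmono : Monotone (f ∘ ρ) := Tuple.monotone_sort f
  have hexp : ∀ (u : Fin n → ℝ) (e : Fin n → ℝ), (∀ k, 0 < u k) →
      ∏ k, u k ^ e k = Real.exp (∑ k, e k * Real.log (u k)) := fun u e hu => by
    rw [Real.exp_sum]
    refine Finset.prod_congr rfl fun k _ => ?_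
    rw [Real.rpow_def_of_pos (hu k), mul_comm]
  have h1 : ∏ i, f i ^ η i = ∏ k, f (π k) ^ η (ord k) :=
    (Equiv.prod_comp π (fun i : Fin n => f i ^ η i)).symm
  rw [h1, hexp _ _ (fun k => hf _), hexp _ _ (fun k => hf _), Real.exp_le_exp]
  -- After taking logarithms, both the weights and the sorted values increase with `k`, so the
  -- rearrangement inequality applies.
  have hv : Monovary (fun k : Fin n => η (ord k)) (fun k => Real.log (f (ρ k))) := by
    refine Monotone.monovary (fun k k' hk => h.mono k k' hk k'.2) fun k k' hk => ?_
    exact Real.log_le_log (hf _) (hmono hk)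
  have := hv.sum_mul_comp_perm_le_sum_mul (σ := π.trans ρ.symm)
  simpa using this

/-- A common valuation makes bundle values independent of who holds them, so sorting only renames
the owners. Position `k` stands for agent `ord k`. -/
theorem exists_relabeling (h : IsOrder n η ord) (hx : ∀ j < m, x j < n)
    (hpos : ∀ i < n, 0 < val m r x i) {c : ℝ} (hc : 0 < c) :
    ∃ o : ℕ → ℕ, (∀ k < n, 0 < val m r o k) ∧
      (∀ i k, i ≤ k → k < n → val m r o i ≤ val m r o k) ∧
      ∏ i ∈ range n, (c * val m r x i) ^ η i ≤
        ∏ k ∈ range n, (c * val m r o k) ^ η (ord k) := by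
  obtain ⟨ρ, h1, h2⟩ := exists_perm_prod_rpow_le h (fun i : Fin n => c * val m r x i)
    fun i => mul_pos hc (hpos i i.2)
  let o : ℕ → ℕ := fun j => if hj : x j < n then (ρ.symm ⟨x j, hj⟩ : ℕ) else 0
  have ho : ∀ k : Fin n, val m r o k = val m r x (ρ k) := by
    intro k
    unfold val
    refine sum_congr rfl fun j hj => ?_
    have hj := hx j (mem_range.1 hj)
    have : o j = k ↔ x j = ρ k := by
      simp only [o, dif_pos hj]
      rw [Fin.val_inj, Equiv.symm_apply_eq, Fin.ext_iff]
    simp only [this]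
  refine ⟨o, fun k hk => ?_, fun i k hik hk => ?_, ?_⟩
  · rw [ho ⟨k, hk⟩]
    exact hpos _ (ρ _).2
  · rw [ho ⟨k, hk⟩, ho ⟨i, by omega⟩]
    exact le_of_mul_le_mul_left (h1 (show (⟨i, by omega⟩ : Fin n) ≤ ⟨k, hk⟩ from hik)) hc
  · rw [prod_range, prod_range]
    simpa only [ho] using h2

theorem val_le_mul_val {δ : ℝ} (h : ∀ j < m, a j ≤ (1 + δ) * r j) (i : ℕ) :
    val m a x i ≤ (1 + δ) * val m r x i := by
  unfold val
  rw [mul_sum]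
  refine sum_le_sum fun j hj => ?_
  split_ifs
  · exact h j (mem_range.1 hj)
  · simp

end

/-- Dynamic program, selection of the best entry, and repair. -/
def solve : Stmt := .seq dynamicProgram (.seq select repair)

/-- The losses combine through `(1 - 3 * δ) * (1 + δ) ≤ 1 - 2 * δ`. Returning from rounded to true
values and handing out the unassigned goods only increases the bundles. -/
theorem solve_spec {n m N B K p : ℕ} {δ : ℝ} {η a L r : ℕ → ℝ} {ord cl x : ℕ → ℕ} {s : Mem}
    (E : Env n m N B η L r ord cl s) (ho : IsOrder n η ord) (hc : IsClassing m δ r cl L p)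
    (hr : ∀ j < m, r j ≤ a j ∧ a j ≤ (1 + δ) * r j) (hδ : 0 < δ) (hδ1 : δ < 1 / 3)
    (hη : ∀ i < n, 0 < η i) (ha : s.real 2 = a) (ha0 : ∀ j < m, 0 ≤ a j)
    (hB : B = 2 * m + 1) (hN : N = B ^ (2 + 2 * K)) (hK : K = m ∨ 1 < (1 + δ) ^ K * δ)
    (hn : 0 < n) (hx : Good n m a x) (h6 : ∀ q, s.int 6 q = 0) (h4 : ∀ q, s.int 4 q = 0)
    (hr6 : ∀ q, s.real 6 q = 0) :
    Good n m a ((solve.run s).int 1) ∧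
    ∏ i ∈ range n, ((1 - 3 * δ) * val m a x i) ^ η i ≤ nash n m η a ((solve.run s).int 1) ∧
    ∀ i < n, ∀ h < n, ∃ j < m, (solve.run s).int 1 j = h ∧
      level m η a ((solve.run s).int 1) h - a j / min (η i) (η h) ≤
        level m η a ((solve.run s).int 1) i := by
  have hr0 : ∀ j < m, 0 ≤ r j := fun j hj => by
    have h1 := ha0 j hj
    have h2 := (hr j hj).2
    by_contra hneg
    nlinarith
  have hclm : ∀ j < m, cl j ≤ m := fun j hj => (hc.cl_le j hj).trans hc.le
  have hrpos : ∀ i < n, 0 < val m r x i := fun i hi => by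
    have h1 := hx.pos i hi
    have h2 := val_le_mul_val (x := x) (fun j hj => (hr j hj).2) i
    by_contra hneg
    nlinarith
  obtain ⟨o, o1, o2, o3⟩ := exists_relabeling ho hx.lt hrpos (c := 1 - 2 * δ) (by linarith)
  have T := dynamicProgram_inv E hclm ho.inj (by omega) h6 hr6
  obtain ⟨s₀, hs₀, hge⟩ := T.isTable.exists_ge hc hδ (by linarith) (fun k => Nat.succ_ne_zero _)
    (fun k hk => hη _ (ho.lt k hk)) hB hN hK o o1 o2
  have hle1 : ∏ i ∈ range n, ((1 - 3 * δ) * val m a x i) ^ η i ≤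
      ∏ i ∈ range n, ((1 - 2 * δ) * val m r x i) ^ η i := by
    refine prod_le_prod (fun i hi => Real.rpow_nonneg (mul_nonneg (by linarith)
      (hx.pos i (mem_range.1 hi)).le) _) fun i hi => ?_
    refine Real.rpow_le_rpow (mul_nonneg (by linarith) (hx.pos i (mem_range.1 hi)).le) ?_
      (hη i (mem_range.1 hi)).le
    have h2 := val_le_mul_val (x := x) (fun j hj => (hr j hj).2) i
    have h3 := hrpos i (mem_range.1 hi)
    calc (1 - 3 * δ) * val m a x i ≤ (1 - 3 * δ) * ((1 + δ) * val m r x i) :=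
          mul_le_mul_of_nonneg_left h2 (by linarith)
      _ ≤ (1 - 2 * δ) * val m r x i := by nlinarith [mul_pos hδ h3, mul_pos (mul_pos hδ hδ) h3]
  have hpos : 0 < (dynamicProgram.run s).real 6 (n * N + s₀) := by
    refine lt_of_lt_of_le ?_ ((hle1.trans o3).trans hge)
    exact prod_pos fun i hi => Real.rpow_pos_of_pos
      (mul_pos (by linarith) (hx.pos i (mem_range.1 hi))) _
  set s1 := dynamicProgram.run s with hs1
  have E1 : Env n m N B η L r ord cl s1 := E.run _ (by decide) (by decide) (by decide) (by decide)
    (by decide) (by decide)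
  obtain ⟨q, hq, hqpos, hqge, hrow⟩ := select_spec E1 hs₀ hpos
  obtain ⟨-, v2, v3⟩ := T.valid n q hq hqpos
  set Y := row m s1 (n * N + q) with hY
  set s2 := select.run s1 with hs2
  rw [ho.prod_comp (fun i => val m r Y (i + 1) ^ η i)] at v2
  -- A worthless bundle would make the objective value `0`, as all weights are positive.
  have hYpos : ∀ i < n, 0 < val m r Y (i + 1) := fun i hi => by
    refine lt_of_le_of_ne (sum_nonneg fun j hj => ?_) fun h => ?_
    · split_ifs
      exacts [hr0 j (mem_range.1 hj), le_rfl]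
    · rw [v2] at hqpos
      refine hqpos.ne' (prod_eq_zero (mem_range.2 hi) ?_)
      rw [← h, Real.zero_rpow (hη i hi).ne']
  have hYle : ∀ i < n, val m r Y (i + 1) ≤ val m a (s2.int 1) i := fun i hi => by
    refine sum_le_sum fun j hj => ?_
    have hj := mem_range.1 hj
    rw [hrow j hj]
    by_cases h : Y j = i + 1
    · rw [if_pos h, if_pos (by omega)]
      exact (hr j hj).1
    · rw [if_neg h]
      split_ifs
      exacts [ha0 j hj, le_rfl]
  have hgood : Good n m a (s2.int 1) := by
    refine ⟨fun j hj => ?_, fun i hi => (hYpos i hi).trans_le (hYle i hi)⟩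
    rw [hrow j hj]
    by_cases h : Y j = 0
    · omega
    · obtain ⟨i, hi, e⟩ := v3 j hj h
      have := ho.lt i hi
      omega
  have hr2 : s2.real 2 = a := by
    rw [hs2, Stmt.run_real select 2 (by decide), hs1, Stmt.run_real _ 2 (by decide), ha]
  have hr1 : s2.real 1 = η := by
    rw [hs2, Stmt.run_real select 1 (by decide), E1.weight]
  have hi0 : s2.int 0 = s1.int 0 := Stmt.run_int select 0 (by decide) _
  have hi4 : ∀ i < n, s2.int 4 i = 0 := fun i _ => by
    rw [hs2, Stmt.run_int select 4 (by decide), hs1, Stmt.run_int _ 4 (by decide), h4]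
  obtain ⟨f1, f2, f3⟩ := repair_spec s2 (by rw [hi0, E1.agents]) (by rw [hi0, E1.goods])
    (by rw [hr1]; exact hη) (by rw [hr2]; exact ha0) (by rw [hr2]; exact hgood) hi4
  rw [hr1, hr2] at f2 f3
  rw [hr2] at f1
  refine ⟨f1, ?_, f3⟩
  refine ((hle1.trans o3).trans hge).trans (hqge.trans (le_trans ?_ f2))
  rw [v2]
  refine prod_le_prod (fun i hi => Real.rpow_nonneg (hYpos i (mem_range.1 hi)).le _) fun i hi => ?_
  exact Real.rpow_le_rpow (hYpos i (mem_range.1 hi)).le (hYle i (mem_range.1 hi))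
    (hη i (mem_range.1 hi)).le

end NashWelfare

/-! ### Assembly of the algorithm and its running time -/

namespace NashWelfare

open Finset RealRAM

/-- Compute the accuracy, the number of states, the order of the agents and the classes. -/
def prepare : Stmt :=
  .seq (.setReal 13 (.const 0) (.get 0 (.const 0) / .ofInt (.const 3)))
    (.seq size (.seq order classes))

/-- Store the loop bounds of the dynamic program. -/
def setBounds : Program :=
  .seq (.setInt 0 (.const 2) (ivar 26))
    (.seq (.setInt 0 (.const 3) (goodsE + .const 2)) (.setInt 0 (.const 4) digitBaseE))

/-- The whole algorithm. -/
def algorithm : Program := .seq prepare.compile (.seq setBounds solve.compile)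

/-- A bound on the running time in terms of the number of states. -/
def algorithmCost : Polynomial ℝ := prepare.costPoly + (18 + solve.costPoly)

/-- For `m ≥ 2`, `2 * m + 1 ≤ m ^ 3` and `2 + 2 * K ≤ 4 + 18 / ε ^ 2 ≤ 22 / ε ^ 2` give the exponent
`66 / ε ^ 2`. For `m = 1` powers of `m` do not grow, but `K ≤ 1` bounds the size by `3 ^ 4 = 81`. -/
theorem size_le {m K : ℕ} {ε : ℝ} (hm : 0 < m) (hε : 0 < ε) (hε1 : ε < 1) (hKm : K ≤ m)
    (hK : (K : ℝ) ≤ 1 + 1 / (ε / 3) ^ 2) :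
    (((2 * m + 1) ^ (2 + 2 * K) : ℕ) : ℝ) ≤ 81 * (m : ℝ) ^ (66 / ε ^ 2) := by
  rcases (Nat.succ_le_of_lt hm).eq_or_lt with h1 | h1
  · have h1 : m = 1 := h1.symm
    subst h1
    have : (2 * 1 + 1) ^ (2 + 2 * K) ≤ 3 ^ 4 := Nat.pow_le_pow_right (by norm_num) (by omega)
    have h2 : (((2 * 1 + 1) ^ (2 + 2 * K) : ℕ) : ℝ) ≤ ((3 ^ 4 : ℕ) : ℝ) := Nat.cast_le.2 this
    simp only [Nat.cast_one, Real.one_rpow]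
    refine h2.trans ?_
    norm_num
  · have hm1 : (1 : ℝ) ≤ m := by exact_mod_cast hm
    have h2 : 2 * m + 1 ≤ m ^ 3 := by
      have h3 : 2 * 2 ≤ m * m := Nat.mul_le_mul h1 h1
      have h4 : 4 * m ≤ m * m * m := Nat.mul_le_mul_right m h3
      have h5 : m ^ 3 = m * m * m := by ring
      have h6 : 2 ≤ m := h1
      omega
    have h3 : (2 * m + 1) ^ (2 + 2 * K) ≤ m ^ (3 * (2 + 2 * K)) := by
      rw [pow_mul]
      exact Nat.pow_le_pow_left h2 _
    have h4 : (((2 * m + 1) ^ (2 + 2 * K) : ℕ) : ℝ) ≤ (m : ℝ) ^ (3 * (2 + 2 * K)) := by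
      exact_mod_cast h3
    have h5 : (m : ℝ) ^ (3 * (2 + 2 * K)) ≤ (m : ℝ) ^ (66 / ε ^ 2) := by
      rw [← Real.rpow_natCast]
      refine Real.rpow_le_rpow_of_exponent_le hm1 ?_
      push_cast
      have h6 : 1 / (ε / 3) ^ 2 = 9 / ε ^ 2 := by field_simp; norm_num
      have h7 : 1 ≤ 1 / ε ^ 2 := by
        rw [le_div_iff₀ (by positivity)]
        nlinarith
      have h8 : 9 / ε ^ 2 = 9 * (1 / ε ^ 2) := by ring
      have h9 : 66 / ε ^ 2 = 66 * (1 / ε ^ 2) := by ring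
      rw [h6, h8] at hK
      rw [h9]
      linarith
    have h6 : 0 ≤ (m : ℝ) ^ (66 / ε ^ 2) := by positivity
    linarith

theorem algorithm_spec {n m : ℕ} {ε : ℝ} {η a : ℕ → ℝ} {x : ℕ → ℕ} {s : Mem} (hε : 0 < ε)
    (hε1 : ε < 1) (hn : 0 < n) (h0 : s.int 0 0 = n) (h1 : s.int 0 1 = m)
    (h2 : ∀ c, 2 ≤ c → s.int 0 c = 0) (hs : s.real 0 0 = ε) (hη : s.real 1 = η)
    (hη0 : ∀ i < n, 0 < η i) (ha : s.real 2 = a) (ha0 : ∀ j < m, 0 ≤ a j)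
    (hi : ∀ k ≠ 0, ∀ c, s.int k c = 0) (hr : ∀ k, 3 ≤ k → ∀ c, s.real k c = 0)
    (hx : Good n m a x) :
    ∃ (t : ℕ) (u : Mem), Runs algorithm s t u ∧
      (t : ℝ) ≤ algorithmCost.eval (81 * (m : ℝ) ^ (66 / ε ^ 2)) ∧
      Good n m a (u.int 1) ∧
      ∏ i ∈ range n, ((1 - ε) * val m a x i) ^ η i ≤ nash n m η a (u.int 1) ∧
      ∀ i < n, ∀ h < n, ∃ j < m, u.int 1 j = h ∧
        level m η a (u.int 1) h - a j / min (η i) (η h) ≤ level m η a (u.int 1) i := by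
  -- Every agent owns a good in the allocation `x`, so `n ≤ m` and the number of states bounds all
  -- loop lengths.
  choose! g hgm hgx using fun i (hi : i < n) => exists_good_of_pos (hx.pos i hi)
  have hnm : n ≤ m := by
    have := card_le_card_of_injOn (s := range n) (t := range m) g
      (fun i hi => mem_coe.2 (mem_range.2 (hgm i (mem_range.1 (mem_coe.1 hi)))))
      (fun i hi i' hi' e => by
        rw [← hgx i (mem_range.1 (mem_coe.1 hi)), ← hgx i' (mem_range.1 (mem_coe.1 hi')), e])
    simpa using this
  have hm : 0 < m := by omega
  set s1 := (Stmt.setReal 13 (.const 0) (.get 0 (.const 0) / .ofInt (.const 3))).run s with hs1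
  have r1 : ∀ k, k ≠ 13 → s1.real k = s.real k := fun k hk => real_setReal_of_ne _ hk _ _
  have hδ : s1.real 13 0 = ε / 3 := by simp [hs1, Stmt.run, hs]
  obtain ⟨K, hKm, hsize, hK, hK'⟩ := size_spec (s := s1) (B := 2 * m + 1) h1 hδ (by positivity) rfl
  set s2 := size.run s1 with hs2
  have i2 : ∀ k, k ≠ 10 → k ≠ 26 → s2.int k = s.int k := fun k hk hk' => by
    rw [hs2, Stmt.run_int size k (by simp [Stmt.modInt, size, sizeStep, hk, hk'])]; rfl
  have r2 : ∀ k, k ≠ 10 → k ≠ 13 → s2.real k = s.real k := fun k hk hk' => by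
    rw [hs2, Stmt.run_real size k (by simp [Stmt.modReal, size, sizeStep, hk]), r1 k hk']
  have hδ2 : s2.real 13 0 = ε / 3 := by rw [hs2, Stmt.run_real size 13 (by decide), hδ]
  have hord := order_spec (s := s2) (n := n) (η := η)
    (by rw [i2 0 (by decide) (by decide), h0]) (by rw [r2 1 (by decide) (by decide), hη])
  set s3 := order.run s2 with hs3
  have i3 : ∀ k, k ≠ 2 → k ≠ 10 → k ≠ 11 → k ≠ 22 → s3.int k = s2.int k := fun k a b c d => by
    rw [hs3, Stmt.run_int order k (by simp [Stmt.modInt, order, orderStep, rankStep, a, b, c, d])]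
  have r3 : ∀ k, s3.real k = s2.real k := fun k => by
    rw [hs3, Stmt.run_real order k (by simp [Stmt.modReal, order, orderStep, rankStep])]
  obtain ⟨p, hcl, hround⟩ := classes_spec (s := s3) (m := m) (δ := ε / 3) (a := a)
    (by rw [i3 0 (by decide) (by decide) (by decide) (by decide), i2 0 (by decide) (by decide), h1])
    (by rw [r3, hδ2]) (by positivity) (by rw [r3, r2 2 (by decide) (by decide), ha]) ha0
    (fun c => by rw [r3, r2 3 (by decide) (by decide), hr 3 le_rfl])
    (fun c => by rw [r3, r2 4 (by decide) (by decide), hr 4 (by decide)])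
    (fun c => by rw [i3 3 (by decide) (by decide) (by decide) (by decide),
      i2 3 (by decide) (by decide), hi 3 (by decide)])
  set s4 := classes.run s3 with hs4
  have i4 : ∀ k, k ≠ 3 → k ≠ 10 → k ≠ 11 → s4.int k = s3.int k := fun k a b c => by
    rw [hs4, Stmt.run_int classes k
      (by simp [Stmt.modInt, classes, classStep, nextStep, assignStep, a, b, c])]
  have r4 : ∀ k, k ≠ 3 → k ≠ 4 → k ≠ 11 → s4.real k = s3.real k := fun k a b c => by
    rw [hs4, Stmt.run_real classes k
      (by simp [Stmt.modReal, classes, classStep, nextStep, assignStep, a, b, c])]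
  have hrun : prepare.run s = s4 := rfl
  obtain ⟨N, hN⟩ : ∃ N, N = (2 * m + 1) ^ (2 + 2 * K) := ⟨_, rfl⟩
  have h40 : s4.int 0 = s.int 0 := by
    rw [i4 0 (by decide) (by decide) (by decide), i3 0 (by decide) (by decide) (by decide)
      (by decide), i2 0 (by decide) (by decide)]
  have h426 : s4.int 26 0 = N := by
    rw [i4 26 (by decide) (by decide) (by decide), i3 26 (by decide) (by decide) (by decide)
      (by decide), hsize, hN]
  set s5 := ((s4.setInt 0 2 N).setInt 0 3 (m + 2)).setInt 0 4 (2 * m + 1) with hs5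
  -- These assignments write the array of loop bounds, which `Stmt.wf` forbids, so they are run
  -- directly at cost `4 + 6 + 8`.
  have hset : Runs setBounds s4 18 s5 := by
    have e2 : (ivar 26).eval s4 = N := h426
    have e3 : (goodsE + .const 2).eval (s4.setInt 0 2 N) = m + 2 := by simp [goodsE, h40, h1]
    have e4 : digitBaseE.eval ((s4.setInt 0 2 N).setInt 0 3 (m + 2)) = 2 * m + 1 := by
      simp [digitBaseE, goodsE, h40, h1, mul_comm]
    have w2 := Runs.setInt s4 0 (.const 2) (ivar 26)
    rw [e2] at w2
    have w3 := Runs.setInt (s4.setInt 0 2 N) 0 (.const 3) (goodsE + .const 2)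
    rw [e3] at w3
    have w4 := Runs.setInt ((s4.setInt 0 2 N).setInt 0 3 (m + 2)) 0 (.const 4) digitBaseE
    rw [e4] at w4
    exact .seq w2 (.seq w3 w4)
  have i5 : ∀ k, k ≠ 0 → s5.int k = s4.int k := fun k hk => by
    rw [hs5, int_setInt_of_ne _ hk, int_setInt_of_ne _ hk, int_setInt_of_ne _ hk]
  have E : Env n m N (2 * m + 1) η (s4.real 3) (s4.real 4) (s4.int 2) (s4.int 3) s5 := by
    refine ⟨by simp [hs5, h40, h0], by simp [hs5, h40, h1], by simp [hs5], by simp [hs5],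
      by simp [hs5], i5 2 (by decide), i5 3 (by decide), ?_, rfl, rfl⟩
    rw [hs5, Mem.setInt_real, Mem.setInt_real, Mem.setInt_real, r4 1 (by decide) (by decide)
      (by decide), r3, r2 1 (by decide) (by decide), hη]
  have hord4 : IsOrder n η (s4.int 2) := by
    rw [i4 2 (by decide) (by decide) (by decide)]; exact hord
  have zint : ∀ k, k ≠ 0 → k ≠ 2 → k ≠ 3 → k ≠ 10 → k ≠ 11 → k ≠ 22 → k ≠ 26 →
      ∀ c, s5.int k c = 0 := fun k a b c d e f g q => by
    rw [i5 k a, i4 k c d e, i3 k b d e f, i2 k d g, hi k a]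
  obtain ⟨f1, f2, f3⟩ := solve_spec E hord4 hcl hround (by positivity) (by linarith) hη0
    (by rw [hs5, Mem.setInt_real, Mem.setInt_real, Mem.setInt_real, r4 2 (by decide) (by decide)
      (by decide), r3, r2 2 (by decide) (by decide), ha]) ha0 rfl hN hK hn hx
    (zint 6 (by decide) (by decide) (by decide) (by decide) (by decide) (by decide) (by decide))
    (zint 4 (by decide) (by decide) (by decide) (by decide) (by decide) (by decide) (by decide))
    (fun q => by rw [hs5, Mem.setInt_real, Mem.setInt_real, Mem.setInt_real, r4 6 (by decide)
      (by decide) (by decide), r3, r2 6 (by decide) (by decide), hr 6 (by decide)])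
  have hM : (N : ℝ) ≤ 81 * (m : ℝ) ^ (66 / ε ^ 2) := by
    rw [hN]; exact size_le hm hε hε1 hKm hK'
  have hBN : 2 * m + 1 ≤ N := by
    rw [hN]; exact Nat.le_self_pow (by omega) _
  have hMle : ∀ c, c ≤ N → (c : ℝ) ≤ 81 * (m : ℝ) ^ (66 / ε ^ 2) := fun c hc =>
    (Nat.cast_le.2 hc).trans hM
  obtain ⟨t1, ht1, ht1'⟩ := prepare.runs_compile (by decide) (81 * (m : ℝ) ^ (66 / ε ^ 2)) s
    (fun c => by
      refine hMle _ ?_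
      rcases Nat.lt_or_ge c 2 with h | h
      · interval_cases c
        · rw [h0]; omega
        · rw [h1]; omega
      · rw [h2 c h]; omega)
  obtain ⟨t2, ht2, ht2'⟩ := solve.runs_compile (by decide) (81 * (m : ℝ) ^ (66 / ε ^ 2)) s5
    (fun c => by
      refine hMle _ ?_
      rcases Nat.lt_or_ge c 5 with h | h
      · interval_cases c
        · rw [E.agents]; omega
        · rw [E.goods]; omega
        · rw [E.states]
        · rw [E.digits]; omega
        · rw [E.base]; omega
      · have : s5.int 0 c = 0 := by
          have h3 : c ≠ 2 := by omega
          have h4 : c ≠ 3 := by omega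
          have h5 : c ≠ 4 := by omega
          simp [hs5, h3, h4, h5, h40, h2 c (by omega)]
        rw [this]; omega)
  refine ⟨t1 + (18 + t2), solve.run s5, .seq ht1 (.seq hset ht2), ?_, f1, ?_, f3⟩
  · unfold algorithmCost
    simp only [Polynomial.eval_add, Polynomial.eval_ofNat]
    push_cast
    linarith
  · have : 1 - 3 * (ε / 3) = 1 - ε := by ring
    rwa [this] at f2

end NashWelfare

end

/-! ### The main theorem -/

open Finset NashWelfare in
theorem theorem5 :
    ∃ (P : RealRAM.Program) (p : Polynomial ℝ) (c : ℝ),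
      ∀ (ε : ℝ), 0 < ε → ε < 1 →
      ∀ (n m : ℕ), 0 < n →
      ∀ (I : Instance n m), I.IsAdditive → I.IsIdentical → I.HasNonzeroOptimum →
        ∃ (t : ℕ) (s : RealRAM.Mem) (x : Allocation n m),
          RealRAM.Runs P (I.input ε) t s ∧
          (t : ℝ) ≤ p.eval ((m : ℝ) ^ (c / ε ^ 2)) ∧
          s.Outputs x ∧
          I.IsApproximation (1 - ε) x ∧
          I.IsWWEF1 x := by
  -- The substitution absorbs the factor `81` from `size_le`.
  refine ⟨algorithm, algorithmCost.comp (81 * Polynomial.X), 66, ?_⟩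
  intro ε hε hε1 n m hn I hadd hid ⟨xopt, hopt, hne⟩
  let i₀ : Fin n := ⟨0, hn⟩
  set s := I.input ε with hs
  set η := s.real 1 with hη
  set a := s.real 2 with ha
  have hη' : ∀ i : Fin n, η i = I.η i := fun i => by simp [hη, hs, Instance.input]
  -- The positions below `m` hold the values of agent `0`, which are everybody's values.
  have ha' : ∀ (i : Fin n) (j : Fin m), a j = I.v i {j} := by
    intro i j
    have hm : 0 < m := j.pos
    have h1 : a j = ∑ i' : Fin n, ∑ j' : Fin m,
        if (j : ℕ) = (i' : ℕ) * m + (j' : ℕ) then I.v i' {j'} else 0 := by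
      simp [ha, hs, Instance.input]
    rw [h1, sum_eq_single i₀, sum_eq_single j]
    · simp [i₀, hid i₀ i]
    · intro j' _ hj'
      exact if_neg fun h => hj' (Fin.ext (by simpa [i₀] using h.symm))
    · simp
    · intro i' _ hi'
      refine sum_eq_zero fun j' _ => if_neg fun h => hi' (Fin.ext ?_)
      exact (mul_add_inj (p := 0) j.2 j'.2 (by simpa using h)).1.symm
    · simp
  have hval : ∀ (y : Allocation n m) (X : ℕ → ℕ), (∀ j : Fin m, X j = y j) → ∀ i : Fin n,
      I.v i (y.bundle i) = val m a X i := by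
    intro y X hX i
    rw [hadd i, Allocation.bundle, sum_filter, NashWelfare.val, sum_range]
    refine sum_congr rfl fun j _ => ?_
    rw [hX j, ha' i j]
    simp [Fin.ext_iff]
  have hη0 : ∀ i < n, 0 < η i := fun i hi => by
    rw [hη' ⟨i, hi⟩]; exact I.η_pos _
  have ha0 : ∀ j < m, 0 ≤ a j := fun j hj => by
    rw [ha' i₀ ⟨j, hj⟩]; exact I.v_nonneg _ _
  have hH : 0 < ∑ i, I.η i := sum_pos (fun i _ => I.η_pos i) ⟨i₀, mem_univ _⟩
  let X : ℕ → ℕ := fun j => if hj : j < m then xopt ⟨j, hj⟩ else 0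
  have hX : ∀ j : Fin m, X j = xopt j := fun j => by simp [X]
  have hgood : Good n m a X := by
    refine ⟨fun j hj => by rw [hX ⟨j, hj⟩]; exact (xopt _).2, fun i hi => ?_⟩
    rw [← hval xopt X hX ⟨i, hi⟩]
    refine lt_of_le_of_ne (I.v_nonneg _ _) fun h => hne ?_
    unfold Instance.nashWelfare
    rw [prod_eq_zero (mem_univ ⟨i, hi⟩), Real.zero_rpow (one_div_pos.2 hH).ne']
    rw [← h, Real.zero_rpow (I.η_pos _).ne']
  obtain ⟨t, u, hrun, ht, g1, g2, g3⟩ := algorithm_spec (s := s) (n := n) (m := m) hε hε1 hn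
    (by simp [hs, Instance.input]) (by simp [hs, Instance.input])
    (fun c hc => by
      have h0 : c ≠ 0 := by omega
      have h1 : c ≠ 1 := by omega
      simp [hs, Instance.input, h0, h1])
    (by simp [hs, Instance.input]) hη.symm hη0 ha.symm ha0
    (fun k hk c => by simp [hs, Instance.input, hk])
    (fun k hk c => by
      have h0 : k ≠ 0 := by omega
      have h1 : k ≠ 1 := by omega
      have h2 : k ≠ 2 := by omega
      simp [hs, Instance.input, h0, h1, h2]) hgood
  let x : Allocation n m := fun j => ⟨u.int 1 j, g1.lt j j.2⟩
  have hx : ∀ j : Fin m, u.int 1 j = x j := fun j => rfl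
  refine ⟨t, u, x, hrun, ?_, hx, ⟨xopt, hopt, ?_⟩, fun i h => ?_⟩
  · simpa using ht
  · have hvx := hval x (u.int 1) hx
    have hvo := hval xopt X hX
    have hnn : ∀ i : Fin n, 0 ≤ I.v i (xopt.bundle i) := fun i => I.v_nonneg _ _
    -- The factors collect to `(1 - ε)` raised to the total weight, which the normalizing exponent
    -- turns into `1 - ε`.
    have h1 : ∏ i, ((1 - ε) * I.v i (xopt.bundle i)) ^ I.η i =
        (1 - ε) ^ (∑ i, I.η i) * ∏ i, I.v i (xopt.bundle i) ^ I.η i := by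
      rw [Real.rpow_sum_of_pos (by linarith), ← prod_mul_distrib]
      exact prod_congr rfl fun i _ => Real.mul_rpow (by linarith) (hnn i)
    have h2 : ∏ i, ((1 - ε) * I.v i (xopt.bundle i)) ^ I.η i ≤
        ∏ i, I.v i (x.bundle i) ^ I.η i := by
      rw [prod_range] at g2
      unfold nash at g2
      rw [prod_range] at g2
      simpa only [hvx, hvo, hη'] using g2
    have h3 : 0 ≤ ∏ i, I.v i (xopt.bundle i) ^ I.η i :=
      prod_nonneg fun i _ => Real.rpow_nonneg (hnn i) _
    unfold Instance.nashWelfare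
    calc (1 - ε) * (∏ i, I.v i (xopt.bundle i) ^ I.η i) ^ (1 / ∑ i, I.η i)
        = ((1 - ε) ^ (∑ i, I.η i) * ∏ i, I.v i (xopt.bundle i) ^ I.η i) ^ (1 / ∑ i, I.η i) := by
          rw [Real.mul_rpow (Real.rpow_nonneg (by linarith) _) h3,
            ← Real.rpow_mul (by linarith), mul_one_div_cancel hH.ne', Real.rpow_one]
      _ ≤ _ := by
          rw [← h1]
          exact Real.rpow_le_rpow (prod_nonneg fun i _ => Real.rpow_nonneg
            (mul_nonneg (by linarith) (hnn i)) _) h2 (one_div_pos.2 hH).le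
  · obtain ⟨j, hj, hjh, hle⟩ := g3 i i.2 h h.2
    refine ⟨⟨j, hj⟩, by simpa [Allocation.bundle, Fin.ext_iff, x] using hjh, ?_⟩
    have hvx := hval x (u.int 1) hx
    unfold level at hle
    rw [← hvx, ← hvx, hη', hη', ha' i ⟨j, hj⟩, hid h i] at hle
    exact hle
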